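/- Let $\mathbb K$ be an algebraically closed field of characteristic $0$. For $n\ge 0$ let $H_n$ be the $n$-th nil affine Hecke algebra over $\mathbb K$ (the KLR algebra of type $\mathfrak{sl}_2$): it has generators $x_1,\dots,x_n$ and $\tau_1,\dots,\tau_{n-1}$ and relations $x_ix_j=x_jx_i$; $\tau_ix_{i+1}-x_i\tau_i=1$; $\tau_ix_i-x_{i+1}\tau_i=-1$; $\tau_ix_j=x_j\tau_i$ for $j\ne i,i+1$; $\tau_i\tau_j=\tau_j\tau_i$ for $|i-j|>1$; $\tau_i^2=0$; $\tau_{i+1}\tau_i\tau_{i+1}=\tau_i\tau_{i+1}\tau_i$. It is graded by $\deg x_i=2$, $\deg\tau_i=-2$, and $H_n\to H_{n+1}$ is the map with $x_i\mapsto x_i$, $\tau_i\mapsto\tau_i$. Put $s_i=(x_i-x_{i+1})\tau_i+1$. Let $\mathcal H_n$ be the category of graded projective left $H_n$-modules $M$ that are left-bounded ($M_j=0$ for $j\ll0$) and locally finite-dimensional ($\dim_{\mathbb K} M_j<\infty$ for all $j$), and let $\mathcal H=\bigoplus_{n\ge0}\mathcal H_n$. This is a $\mathbb Z$-graded additive category;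 we use homogeneous morphisms of all degrees. For every $n\ge1$ the map $(a\otimes b,c)\mapsto a\tau_nb+c$ is a bijection $$H_n\otimes_{H_{n-1}}H_n\ \oplus\ H_n[x_{n+1}]\ \xrightarrow{\ \sim\ }\ H_{n+1}\qquad(\ast)$$ (the Kang–Kashiwara splitting), and the induction and restriction functors $$E_1=H_{n+1}\otimes_{H_n}-:\mathcal H_n\to\mathcal H_{n+1},\qquad E_0=E_1^*=\mathrm{Res}^{H_{n+1}}_{H_n}:\mathcal H_{n+1}\to\mathcal H_n\quad(E_0=0\text{ on }\mathcal H_0)$$ are well defined on $\mathcal H$. Products of functors are composites, and the identifications below are: $E_1E_1=H_{n+2}\otimes_{H_n}-$ and $E_0E_1=H_{n+1}\otimes_{H_n}-$ on $\mathcal H_n$; $E_1E_0=(H_n\otimes_{H_{n-1}}H_n)\otimes_{H_n}-$ on $\mathcal H_n$ for $n\ge1$, and $E_1E_0=0$ on $\mathcal H_0$; $E_0=H_{n+1}\otimes_{H_{n+1}}-$ on $\mathcal H_{n+1}$ and $E_0E_0=H_{n+2}\otimes_{H_{n+2}}-$ on $\mathcal H_{n+2}$. The following formulas define natural transformations: $$X_1:E_1\to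 E_1,\ a\mapsto ax_{n+1};\qquad T_{11}:E_1E_1\to E_1E_1,\ a\mapsto a\tau_{n+1};$$ $$X_0:E_0\to E_0,\ a\mapsto x_{n+1}a;\qquad T_{00}:E_0E_0\to E_0E_0,\ a\mapsto-\tau_{n+1}a;$$ $$T_{01}:E_0E_1\to E_1E_0,\quad\text{the projection } H_{n+1}\twoheadrightarrow H_n\otimes_{H_{n-1}}H_n\text{ given by }(\ast)\quad(T_{01}=0\text{ on }\mathcal H_0);$$ $$T_{10}:E_1E_0\to E_0E_1,\quad a\otimes b\mapsto a(x_n-x_{n+1})s_nb.$$ **Theorem.** The functors $E_0,E_1$ and the transformations $X_i$, $T_{ij}$ ($i,j\in\{0,1\}$) define a 2-representation of $\mathcal U_q^+(\widehat{\mathfrak{sl}}_2)$ on $\mathcal H$, where the Dynkin diagram of $\widehat{\mathfrak{sl}}_2$ has both edges oriented from $0$ to $1$. That is: the $E_i$ are $\mathbb K$-linear additive graded endofunctors of $\mathcal H$; $X_i$ has degree $2$, and $T_{ij}$ has degree $-C_{ij}$, where $C_{00}=C_{11}=2$ and $C_{01}=C_{10}=-2$; and with $Q_{00}=Q_{11}=0$,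 $Q_{01}(u,v)=Q_{10}(u,v)=(u-v)^2$, for all $i,j,k\in\{0,1\}$: 1. $T_{ij}\circ X_iE_j-E_jX_i\circ T_{ij}=\delta_{ij}\,\mathrm{id}$; 2. $T_{ij}\circ E_iX_j-X_jE_i\circ T_{ij}=-\delta_{ij}\,\mathrm{id}$; 3. $T_{ij}\circ T_{ji}=Q_{ij}(E_jX_i,X_jE_i)$; 4. $T_{jk}E_i\circ E_jT_{ik}\circ T_{ij}E_k-E_kT_{ij}\circ T_{ik}E_j\circ E_iT_{jk}=\delta_{ik}\dfrac{Q_{ij}(X_iE_j,E_iX_j)E_i-E_iQ_{ij}(E_jX_i,X_jE_i)}{X_iE_jE_i-E_iE_jX_i}$, where the quotient is the polynomial obtained by exact division. -/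

import Mathlib

open CategoryTheory
open scoped TensorProduct Polynomial

universe u v w

noncomputable section

namespace TwoRepSl2

/-! ## Graded additive categories -/

/-- A `K`-linear `ℤ`-graded additive category, in its enriched form: every space of morphisms is the
direct sum of its homogeneous parts, degrees add under composition, every object has all
grading shifts, and there are a zero object and binary direct sums whose structure maps have degree
zero.  Homogeneous idempotents of degree zero are also required to split. -/
class GradedAdditiveCategory (K : Type w) [Field K] (C : Type u) [Category.{v} C]
    [Preadditive C] [Linear K C] where
  /-- the morphisms `M ⟶ N` that are homogeneous of degree `d` -/
  homDeg : ∀ M N : C, ℤ → Submodule K (M ⟶ N)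
  isInternal : ∀ M N : C, DirectSum.IsInternal (homDeg M N)
  id_mem : ∀ M : C, 𝟙 M ∈ homDeg M M 0
  comp_mem : ∀ {M N P : C} {d e : ℤ} {f : M ⟶ N} {g : N ⟶ P},
    f ∈ homDeg M N d → g ∈ homDeg N P e → f ≫ g ∈ homDeg M P (d + e)
  exists_shift : ∀ (M : C) (d : ℤ), ∃ (N : C) (e : M ≅ N),
    e.hom ∈ homDeg M N d ∧ e.inv ∈ homDeg N M (-d)
  exists_zero : ∃ Z : C, 𝟙 Z = 0
  exists_sum : ∀ M N : C, ∃ (S : C) (i₁ : M ⟶ S) (i₂ : N ⟶ S) (p₁ : S ⟶ M) (p₂ : S ⟶ N),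
    i₁ ∈ homDeg M S 0 ∧ i₂ ∈ homDeg N S 0 ∧ p₁ ∈ homDeg S M 0 ∧ p₂ ∈ homDeg S N 0 ∧
    i₁ ≫ p₁ = 𝟙 M ∧ i₂ ≫ p₂ = 𝟙 N ∧ i₁ ≫ p₂ = 0 ∧ i₂ ≫ p₁ = 0 ∧ p₁ ≫ i₁ + p₂ ≫ i₂ = 𝟙 S
  exists_split : ∀ (M : C) (e : M ⟶ M), e ∈ homDeg M M 0 → e ≫ e = e →
    ∃ (N : C) (p : M ⟶ N) (i : N ⟶ M),
      p ∈ homDeg M N 0 ∧ i ∈ homDeg N M 0 ∧ i ≫ p = 𝟙 N ∧ p ≫ i = e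

/-! ## Quivers and 2-representations -/

/-- A quiver without loops on the vertex set `I`: `m i j` is the number of edges from `i` to `j`. -/
structure LoopFreeQuiver (I : Type) where
  m : I → I → ℕ
  loopless : ∀ i, m i i = 0

namespace LoopFreeQuiver

variable {I : Type} [DecidableEq I] (Q : LoopFreeQuiver I)

/-- The symmetric generalized Cartan matrix of the underlying graph. -/
def cartan (i j : I) : ℤ := if i = j then 2 else -((Q.m i j : ℤ) + (Q.m j i : ℤ))

/-- `Q_{ij}(a, b) = (1 - δ_{ij}) (b - a) ^ m_{ij} (a - b) ^ m_{ji}`, evaluated in a ring. -/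
def poly (i j : I) {R : Type*} [Ring R] (a b : R) : R :=
  if i = j then 0 else (b - a) ^ Q.m i j * (a - b) ^ Q.m j i

/-- The divided difference `(Q_{ij}(a, b) - Q_{ij}(c, b)) / (a - c)`, written as a polynomial in
`a`, `b`, `c`; see `divDiff_mul`. -/
def divDiff (i j : I) {R : Type*} [Ring R] (a b c : R) : R :=
  if i = j then 0 else
    (-1) ^ Q.m i j * ∑ k ∈ Finset.range (Q.m i j + Q.m j i),
      (a - b) ^ k * (c - b) ^ (Q.m i j + Q.m j i - 1 - k)

theorem divDiff_mul (i j : I) {R : Type*} [CommRing R] (a b c : R) :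
    Q.divDiff i j a b c * (a - c) = Q.poly i j a b - Q.poly i j c b := by
  unfold divDiff poly
  split_ifs with h
  · simp
  · have h1 := (Commute.all (a - b) (c - b)).geom_sum₂_mul (Q.m i j + Q.m j i)
    have h2 : (a - b) - (c - b) = a - c := by ring
    rw [h2] at h1
    have h3 : ∀ y : R, (b - y) ^ Q.m i j * (y - b) ^ Q.m j i
        = (-1) ^ Q.m i j * (y - b) ^ (Q.m i j + Q.m j i) := by
      intro y
      rw [← neg_sub y b, neg_pow, pow_add]
      ring
    rw [mul_assoc, h1, h3, h3]
    ring

end LoopFreeQuiver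

section TwoRep

variable {C : Type u} [Category.{v} C] {I : Type}

/-- For endofunctors `E i` of `C`, natural transformations `X_i : E_i → E_i` and
`T_{ij} : E_i E_j → E_j E_i`.  Products of functors are composites (`E_i E_j` applies `E_j` first),
so that `E_i E_j` is `E j ⋙ E i`. -/
@[ext]
structure TwoRepData (E : I → (C ⥤ C)) where
  X : ∀ i, E i ⟶ E i
  T : ∀ i j, E j ⋙ E i ⟶ E i ⋙ E j

namespace TwoRepData

variable {E : I → (C ⥤ C)} (ρ : TwoRepData E)

/-- the component of `X_i` at `M` -/
def x (i : I) (M : C) : (E i).obj M ⟶ (E i).obj M := (ρ.X i).app M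

/-- the component of `T_{ij}` at `M` -/
def t (i j : I) (M : C) : (E i).obj ((E j).obj M) ⟶ (E j).obj ((E i).obj M) := (ρ.T i j).app M

end TwoRepData

/-- The 2-representations of `𝒰_q⁺(Q)` on the graded additive category `C` in which the generating
objects act by the endofunctors `E i`.  All identities between natural transformations are
written out on an object `M`: the component of `F α` at `M` is `F.map (α.app M)` and the component
of `α F` is `α.app (F.obj M)`. -/
@[ext]
structure TwoRep (K : Type w) [Field K] [Preadditive C] [Linear K C] [GradedAdditiveCategory K C]
    [DecidableEq I] (Q : LoopFreeQuiver I) (E : I → (C ⥤ C)) extends TwoRepData E where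
  /-- the functors `E_i` are additive, `K`-linear and graded -/
  map_add : ∀ (i : I) {M N : C} (f g : M ⟶ N), (E i).map (f + g) = (E i).map f + (E i).map g
  map_smul : ∀ (i : I) {M N : C} (r : K) (f : M ⟶ N), (E i).map (r • f) = r • (E i).map f
  map_deg : ∀ (i : I) {M N : C} (d : ℤ) (f : M ⟶ N),
    f ∈ GradedAdditiveCategory.homDeg (K := K) M N d →
      (E i).map f ∈ GradedAdditiveCategory.homDeg (K := K) ((E i).obj M) ((E i).obj N) d
  /-- `X_i` has degree `2` -/
  x_deg : ∀ (i : I) (M : C), toTwoRepData.x i M ∈ GradedAdditiveCategory.homDeg (K := K) _ _ 2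
  /-- `T_{ij}` has degree `-C_{ij}` -/
  t_deg : ∀ (i j : I) (M : C),
    toTwoRepData.t i j M ∈ GradedAdditiveCategory.homDeg (K := K) _ _ (-Q.cartan i j)
  /-- `T_{ij} ∘ X_i E_j - E_j X_i ∘ T_{ij} = 0` for `i ≠ j` -/
  t_x_ne : ∀ (i j : I), i ≠ j → ∀ M : C,
    toTwoRepData.x i ((E j).obj M) ≫ toTwoRepData.t i j M -
      toTwoRepData.t i j M ≫ (E j).map (toTwoRepData.x i M) = 0
  /-- `T_{ii} ∘ X_i E_i - E_i X_i ∘ T_{ii} = 1` -/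
  t_x_eq : ∀ (i : I) (M : C),
    toTwoRepData.x i ((E i).obj M) ≫ toTwoRepData.t i i M -
      toTwoRepData.t i i M ≫ (E i).map (toTwoRepData.x i M) = 𝟙 ((E i).obj ((E i).obj M))
  /-- `T_{ij} ∘ E_i X_j - X_j E_i ∘ T_{ij} = 0` for `i ≠ j` -/
  t_x'_ne : ∀ (i j : I), i ≠ j → ∀ M : C,
    (E i).map (toTwoRepData.x j M) ≫ toTwoRepData.t i j M -
      toTwoRepData.t i j M ≫ toTwoRepData.x j ((E i).obj M) = 0
  /-- `T_{ii} ∘ E_i X_i - X_i E_i ∘ T_{ii} = -1` -/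
  t_x'_eq : ∀ (i : I) (M : C),
    (E i).map (toTwoRepData.x i M) ≫ toTwoRepData.t i i M -
      toTwoRepData.t i i M ≫ toTwoRepData.x i ((E i).obj M) = -𝟙 ((E i).obj ((E i).obj M))
  /-- `T_{ij} ∘ T_{ji} = Q_{ij}(E_j X_i, X_j E_i)` -/
  t_t : ∀ (i j : I) (M : C),
    toTwoRepData.t j i M ≫ toTwoRepData.t i j M =
      Q.poly i j (R := End ((E j).obj ((E i).obj M)))
        ((E j).map (toTwoRepData.x i M)) (toTwoRepData.x j ((E i).obj M))
  /-- `T_{jk} E_i ∘ E_j T_{ik} ∘ T_{ij} E_k - E_k T_{ij} ∘ T_{ik} E_j ∘ E_i T_{jk} = 0`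
  for `i ≠ k` -/
  braid_ne : ∀ (i j k : I), i ≠ k → ∀ M : C,
    toTwoRepData.t i j ((E k).obj M) ≫ (E j).map (toTwoRepData.t i k M) ≫
        toTwoRepData.t j k ((E i).obj M) -
      (E i).map (toTwoRepData.t j k M) ≫ toTwoRepData.t i k ((E j).obj M) ≫
        (E k).map (toTwoRepData.t i j M) = 0
  /-- `T_{ji} E_i ∘ E_j T_{ii} ∘ T_{ij} E_i - E_i T_{ij} ∘ T_{ii} E_j ∘ E_i T_{ji}` is the divided
  difference
  `(Q_{ij}(X_i E_j, E_i X_j) E_i - E_i Q_{ij}(E_j X_i, X_j E_i)) / (X_i E_j E_i - E_i E_j X_i)` -/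
  braid_eq : ∀ (i j : I) (M : C),
    toTwoRepData.t i j ((E i).obj M) ≫ (E j).map (toTwoRepData.t i i M) ≫
        toTwoRepData.t j i ((E i).obj M) -
      (E i).map (toTwoRepData.t j i M) ≫ toTwoRepData.t i i ((E j).obj M) ≫
        (E i).map (toTwoRepData.t i j M) =
      Q.divDiff i j (R := End ((E i).obj ((E j).obj ((E i).obj M))))
        (toTwoRepData.x i ((E j).obj ((E i).obj M)))
        ((E i).map (toTwoRepData.x j ((E i).obj M)))
        ((E i).map ((E j).map (toTwoRepData.x i M)))

end TwoRep

/-- The Dynkin diagram of affine `sl₂`, with both edges pointing from `0` to `1`. -/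
def affineSl2 : LoopFreeQuiver (Fin 2) where
  m i j := if i = 0 ∧ j = 1 then 2 else 0
  loopless i := by fin_cases i <;> simp

/-! ## Nil affine Hecke algebras -/

/-- The generators of the `n`-th nil affine Hecke algebra.  Indices start at `0`, so `x i` and `t i`
are the elements usually written `x_{i+1}` and `τ_{i+1}`. -/
inductive Gen (n : ℕ) : Type
  | x (i : ℕ) (h : i < n)
  | t (i : ℕ) (h : i + 1 < n)

/-- The degree of a generator: `2` for the `x i` and `-2` for the `τ i`. -/
def Gen.deg {n : ℕ} : Gen n → ℤ
  | .x _ _ => 2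
  | .t _ _ => -2

/-- The inclusion of the generators for `n` into those for `n + 1`. -/
def Gen.succ {n : ℕ} : Gen n → Gen (n + 1)
  | .x i h => .x i (by omega)
  | .t i h => .t i (by omega)

section NilHecke

variable (K : Type u) [Field K]

/-- the generator `x i` in the free algebra -/
abbrev fx {n : ℕ} (i : ℕ) (h : i < n) : FreeAlgebra K (Gen n) := FreeAlgebra.ι K (Gen.x i h)

/-- the generator `t i` in the free algebra -/
abbrev ft {n : ℕ} (i : ℕ) (h : i + 1 < n) : FreeAlgebra K (Gen n) := FreeAlgebra.ι K (Gen.t i h)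

/-- The defining relations of the nil affine Hecke algebra. -/
inductive Rel (n : ℕ) : FreeAlgebra K (Gen n) → FreeAlgebra K (Gen n) → Prop
  | x_x (i j : ℕ) (hi : i < n) (hj : j < n) : Rel n (fx K i hi * fx K j hj) (fx K j hj * fx K i hi)
  | t_x (i j : ℕ) (hi : i + 1 < n) (hj : j < n) (h₁ : j ≠ i) (h₂ : j ≠ i + 1) :
      Rel n (ft K i hi * fx K j hj) (fx K j hj * ft K i hi)
  | t_x_succ (i : ℕ) (hi : i + 1 < n) :
      Rel n (ft K i hi * fx K (i + 1) hi - fx K i (by omega) * ft K i hi) 1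
  | t_x_self (i : ℕ) (hi : i + 1 < n) :
      Rel n (ft K i hi * fx K i (by omega) - fx K (i + 1) hi * ft K i hi) (-1)
  | t_t (i j : ℕ) (hi : i + 1 < n) (hj : j + 1 < n) (h : i + 1 < j) :
      Rel n (ft K i hi * ft K j hj) (ft K j hj * ft K i hi)
  | t_sq (i : ℕ) (hi : i + 1 < n) : Rel n (ft K i hi * ft K i hi) 0
  | braid (i : ℕ) (hi : i + 2 < n) :
      Rel n (ft K (i + 1) hi * ft K i (by omega) * ft K (i + 1) hi)
        (ft K i (by omega) * ft K (i + 1) hi * ft K i (by omega))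

/-- The `n`-th nil affine Hecke algebra over `K`, i.e. the KLR algebra `H_n` of the quiver with one
vertex and no edges. -/
def NilHecke (n : ℕ) : Type u := RingQuot (Rel K n)

instance (n : ℕ) : Ring (NilHecke K n) := inferInstanceAs (Ring (RingQuot (Rel K n)))

instance (n : ℕ) : Algebra K (NilHecke K n) := inferInstanceAs (Algebra K (RingQuot (Rel K n)))

/-- The quotient map from the free algebra. -/
def NilHecke.proj (n : ℕ) : FreeAlgebra K (Gen n) →ₐ[K] NilHecke K n :=
  RingQuot.mkAlgHom K (Rel K n)

/-- The class of a generator. -/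
def NilHecke.gen {n : ℕ} (g : Gen n) : NilHecke K n := 
  NilHecke.proj K n (FreeAlgebra.ι K g)

/-- The element `x_{n+1}` of `H_{n+1}` in the usual indexing from `1`. -/
def xLast (n : ℕ) : NilHecke K (n + 1) := NilHecke.gen K (.x n (by omega))

/-- The element `x_{n+1}` of `H_{n+2}` in the usual indexing from `1`. -/
def xPrev (n : ℕ) : NilHecke K (n + 2) := NilHecke.gen K (.x n (by omega))

/-- The element `τ_{n+1}` of `H_{n+2}` in the usual indexing from `1`. -/
def tLast (n : ℕ) : NilHecke K (n + 2) := NilHecke.gen K (.t n (by omega))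

/-- The element `s_{n+1} = (x_{n+1} - x_{n+2}) τ_{n+1} + 1` of `H_{n+2}` in the usual indexing. -/
def sLast (n : ℕ) : NilHecke K (n + 2) := (xPrev K n - xLast K (n + 1)) * tLast K n + 1

variable {K}

theorem NilHecke.induction {n : ℕ} {P : NilHecke K n → Prop}
    (scalar : ∀ r : K, P (algebraMap K _ r)) (gen : ∀ g, P (NilHecke.gen K g))
    (mul : ∀ a b, P a → P b → P (a * b)) (add : ∀ a b, P a → P b → P (a + b)) (a : NilHecke K n) :
    P a := by
  obtain ⟨a, rfl⟩ : ∃ b, NilHecke.proj K n b = a := RingQuot.mkAlgHom_surjective K (Rel K n) a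
  induction a using FreeAlgebra.induction with
  | grade0 r => simpa using scalar r
  | grade1 g => exact gen g
  | mul a b ha hb => simpa using mul _ _ ha hb
  | add a b ha hb => simpa using add _ _ ha hb

theorem gen_rel {n : ℕ} {a b : FreeAlgebra K (Gen n)} (h : Rel K n a b) :
    FreeAlgebra.lift K (NilHecke.gen K) a = FreeAlgebra.lift K (NilHecke.gen K) b := by
  have key : FreeAlgebra.lift K (NilHecke.gen K) = NilHecke.proj K n := by
    ext g
    simp [NilHecke.gen]
  rw [key]
  exact RingQuot.mkAlgHom_rel K h

theorem gen_succ_rel {n : ℕ} {a b : FreeAlgebra K (Gen n)} (h : Rel K n a b) :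
    FreeAlgebra.lift K (fun g : Gen n => NilHecke.gen K g.succ) a =
      FreeAlgebra.lift K (fun g : Gen n => NilHecke.gen K g.succ) b := by
  cases h with
  | x_x i j hi hj =>
    have := gen_rel (Rel.x_x (K := K) (n := n + 1) i j (by omega) (by omega))
    simpa [Gen.succ] using this
  | t_x i j hi hj h₁ h₂ =>
    have := gen_rel (Rel.t_x (K := K) (n := n + 1) i j (by omega) (by omega) h₁ h₂)
    simpa [Gen.succ] using this
  | t_x_succ i hi =>
    have := gen_rel (Rel.t_x_succ (K := K) (n := n + 1) i (by omega))
    simpa [Gen.succ] using this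
  | t_x_self i hi =>
    have := gen_rel (Rel.t_x_self (K := K) (n := n + 1) i (by omega))
    simpa [Gen.succ] using this
  | t_t i j hi hj h =>
    have := gen_rel (Rel.t_t (K := K) (n := n + 1) i j (by omega) (by omega) h)
    simpa [Gen.succ] using this
  | t_sq i hi =>
    have := gen_rel (Rel.t_sq (K := K) (n := n + 1) i (by omega))
    simpa [Gen.succ] using this
  | braid i hi =>
    have := gen_rel (Rel.braid (K := K) (n := n + 1) i (by omega))
    simpa [Gen.succ] using this

variable (K) in
/-- The embedding `H_n → H_{n+1}` on the first `n` strands. -/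
def incl (n : ℕ) : NilHecke K n →ₐ[K] NilHecke K (n + 1) :=
  RingQuot.liftAlgHom K
    ⟨FreeAlgebra.lift K (fun g : Gen n => NilHecke.gen K g.succ), fun _ _ h => gen_succ_rel h⟩

theorem incl_gen {n : ℕ} (g : Gen n) : incl K n (NilHecke.gen K g) = NilHecke.gen K g.succ := by
  refine (RingQuot.liftAlgHom_mkAlgHom_apply (S := K) _ _ _).trans ?_
  simp

variable (K) in
/-- The grading of `H_n`: the span of the products of generators of total degree `d`. -/
def NilHecke.gr (n : ℕ) (d : ℤ) : Submodule K (NilHecke K n) :=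
  Submodule.span K {a | ∃ l : List (Gen n),
    (l.map Gen.deg).sum = d ∧ (l.map (NilHecke.gen K)).prod = a}

/-- `τ_{n+1}` commutes with the image of `H_n` in `H_{n+2}`. -/
theorem tLast_comm (n : ℕ) (h : NilHecke K n) :
    tLast K n * incl K (n + 1) (incl K n h) = incl K (n + 1) (incl K n h) * tLast K n := by
  induction h using NilHecke.induction with
  | scalar r =>
    simp only [AlgHom.commutes]
    exact (Algebra.commutes r _).symm
  | gen g =>
    rw [incl_gen, incl_gen]
    cases g with
    | x i hi =>
      have := gen_rel (Rel.t_x (K := K) (n := n + 2) n i (by omega) (by omega) (by omega) (by omega))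
      simpa [Gen.succ, tLast] using this
    | t i hi =>
      have := gen_rel (Rel.t_t (K := K) (n := n + 2) i n (by omega) (by omega) (by omega))
      simpa [Gen.succ, tLast] using this.symm
  | mul a b ha hb =>
    rw [map_mul, map_mul, ← mul_assoc, ha, mul_assoc, hb, mul_assoc]
  | add a b ha hb => rw [map_add, map_add, mul_add, add_mul, ha, hb]

end NilHecke

/-! ## Induction and restriction of modules -/

section Modules

variable {K : Type u} [Field K]

/-- Restriction of an `H_{n+1}`-module to `H_n`. -/
def Res (K : Type u) [Field K] (_n : ℕ) (M : Type u) : Type u := M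

section Res
variable (n : ℕ) (M : Type u) [AddCommGroup M] [Module K M] [Module (NilHecke K (n + 1)) M]
  [IsScalarTower K (NilHecke K (n + 1)) M]

instance : AddCommGroup (Res K n M) := inferInstanceAs (AddCommGroup M)
instance : Module K (Res K n M) := inferInstanceAs (Module K M)
instance : Module (NilHecke K n) (Res K n M) := Module.compHom M (incl K n).toRingHom

/-- The identity map from a module to its restriction. -/
def Res.mk : M →ₗ[K] Res K n M := LinearMap.id

/-- The identity map from the restriction of a module to the module. -/
def Res.val : Res K n M →ₗ[K] M := LinearMap.id

instance : IsScalarTower K (NilHecke K n) (Res K n M) where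
  smul_assoc r a m := by
    change incl K n (r • a) • Res.val n M m = r • (incl K n a • Res.val n M m)
    rw [map_smul, smul_assoc]

end Res

section Ind
variable (n : ℕ) (M : Type u) [AddCommGroup M] [Module K M] [Module (NilHecke K n) M]
  [IsScalarTower K (NilHecke K n) M]

/-- The relations `a h ⊗ m = a ⊗ h m` for `h ∈ H_n` in `H_{n+1} ⊗_K M`. -/
def indRel : Submodule (NilHecke K (n + 1)) (NilHecke K (n + 1) ⊗[K] M) :=
  Submodule.span _ {z | ∃ (a : NilHecke K (n + 1)) (h : NilHecke K n) (m : M),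
    z = (a * incl K n h) ⊗ₜ[K] m - a ⊗ₜ[K] (h • m)}

/-- The induced module `H_{n+1} ⊗_{H_n} M`. -/
def Ind (K : Type u) [Field K] (n : ℕ) (M : Type u) [AddCommGroup M] [Module K M]
    [Module (NilHecke K n) M] : Type u :=
  (NilHecke K (n + 1) ⊗[K] M) ⧸ (indRel (K := K) n M)

end Ind

section Ind
variable (n : ℕ) (M : Type u) [AddCommGroup M] [Module K M] [Module (NilHecke K n) M]

instance : AddCommGroup (Ind K n M) :=
  inferInstanceAs (AddCommGroup ((NilHecke K (n + 1) ⊗[K] M) ⧸ (indRel (K := K) n M)))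
instance : Module (NilHecke K (n + 1)) (Ind K n M) :=
  inferInstanceAs (Module (NilHecke K (n + 1)) ((NilHecke K (n + 1) ⊗[K] M) ⧸ (indRel (K := K) n M)))
instance : Module K (Ind K n M) :=
  inferInstanceAs (Module K ((NilHecke K (n + 1) ⊗[K] M) ⧸ (indRel (K := K) n M)))
instance : IsScalarTower K (NilHecke K (n + 1)) (Ind K n M) :=
  inferInstanceAs (IsScalarTower K (NilHecke K (n + 1))
    ((NilHecke K (n + 1) ⊗[K] M) ⧸ (indRel (K := K) n M)))

variable {n M}

/-- The class `a ⊗ m` in `H_{n+1} ⊗_{H_n} M`. -/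
def Ind.mk (a : NilHecke K (n + 1)) (m : M) : Ind K n M :=
  Submodule.Quotient.mk (p := indRel (K := K) n M) (a ⊗ₜ[K] m)

variable {N : Type u} [AddCommGroup N] [Module K N] [Module (NilHecke K n) N]

/-- The map `a ⊗ m ↦ a ⊗ f m` induced by an `H_n`-linear map `f`. -/
def Ind.map [IsScalarTower K (NilHecke K n) M] [IsScalarTower K (NilHecke K n) N]
    (f : M →ₗ[NilHecke K n] N) : Ind K n M →ₗ[NilHecke K (n + 1)] Ind K n N :=
  Submodule.mapQ (indRel (K := K) n M) (indRel (K := K) n N)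
    (TensorProduct.AlgebraTensorModule.map LinearMap.id (f.restrictScalars K)) (by
      unfold indRel
      rw [Submodule.span_le]
      rintro _ ⟨a, h, m, rfl⟩
      refine Submodule.subset_span ⟨a, h, f m, ?_⟩
      simp)

theorem Ind.map_mk [IsScalarTower K (NilHecke K n) M] [IsScalarTower K (NilHecke K n) N]
    (f : M →ₗ[NilHecke K n] N) (a : NilHecke K (n + 1)) (m : M) :
    Ind.map f (Ind.mk a m) = Ind.mk a (f m) := rfl

variable (n M) in
theorem Ind.induction {P : Ind K n M → Prop} (mk : ∀ a m, P (Ind.mk a m))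
    (add : ∀ y z, P y → P z → P (y + z)) (z : Ind K n M) : P z := by
  obtain ⟨z, rfl⟩ := Submodule.Quotient.mk_surjective (indRel (K := K) n M) z
  induction z using TensorProduct.induction_on with
  | zero =>
    have : Ind.mk (0 : NilHecke K (n + 1)) (0 : M) = 0 := by
      unfold Ind.mk
      rw [TensorProduct.zero_tmul]
      rfl
    have h := mk 0 0
    rw [this] at h
    exact h
  | tmul a m => exact mk a m
  | add y z hy hz => exact add _ _ hy hz

theorem Ind.mk_add (a : NilHecke K (n + 1)) (m m' : M) :
    Ind.mk a (m + m') = Ind.mk a m + Ind.mk a m' := by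
  unfold Ind.mk
  rw [TensorProduct.tmul_add]
  rfl

theorem Ind.mk_smul (r : K) (a : NilHecke K (n + 1)) (m : M) :
    Ind.mk a (r • m) = r • Ind.mk a m := by
  unfold Ind.mk
  rw [TensorProduct.tmul_smul]
  rfl

theorem Ind.map_ext {f g : Ind K n M →ₗ[NilHecke K (n + 1)] Ind K n N}
    (h : ∀ a m, f (Ind.mk a m) = g (Ind.mk a m)) : f = g :=
  LinearMap.ext fun z => Ind.induction n M (P := fun z => f z = g z) h
    (fun y z hy hz => by rw [map_add, map_add, hy, hz]) z

section map
variable [IsScalarTower K (NilHecke K n) M] [IsScalarTower K (NilHecke K n) N]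

theorem Ind.map_add (f g : M →ₗ[NilHecke K n] N) : Ind.map (f + g) = Ind.map f + Ind.map g :=
  Ind.map_ext fun a m => Ind.mk_add a (f m) (g m)

theorem Ind.map_smul (r : K) (f : M →ₗ[NilHecke K n] N) : Ind.map (r • f) = r • Ind.map f :=
  Ind.map_ext fun a m => Ind.mk_smul r a (f m)

theorem Ind.map_id : Ind.map (LinearMap.id : M →ₗ[NilHecke K n] M) = LinearMap.id :=
  Ind.map_ext fun _ _ => rfl

theorem Ind.map_comp {L : Type u} [AddCommGroup L] [Module K L] [Module (NilHecke K n) L]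
    [IsScalarTower K (NilHecke K n) L] (f : M →ₗ[NilHecke K n] N) (g : N →ₗ[NilHecke K n] L) :
    Ind.map (g.comp f) = (Ind.map g).comp (Ind.map f) :=
  Ind.map_ext fun _ _ => rfl

end map

end Ind

/-- The restriction of an `H_{n+1}`-linear map to an `H_n`-linear map. -/
def Res.map (n : ℕ) {M N : Type u} [AddCommGroup M] [Module (NilHecke K (n + 1)) M]
    [AddCommGroup N] [Module (NilHecke K (n + 1)) N] (f : M →ₗ[NilHecke K (n + 1)] N) :
    Res K n M →ₗ[NilHecke K n] Res K n N where
  toFun := f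
  map_add' := f.map_add
  map_smul' a m := f.map_smul (incl K n a) m
end Modules

/-! ## The category `𝓗` -/

section Grading

variable {K : Type u} [Field K]

theorem isInternal_iff {V : Type*} [AddCommGroup V] [Module K V] (A : ℤ → Submodule K V) :
    DirectSum.IsInternal A ↔
      (∀ (s : Finset ℤ) (v : ℤ → V), (∀ i ∈ s, v i ∈ A i) → ∑ i ∈ s, v i = 0 → ∀ i ∈ s, v i = 0) ∧
        ⨆ i, A i = ⊤ := by
  rw [DirectSum.isInternal_submodule_iff_iSupIndep_and_iSup_eq_top,
    iSupIndep_iff_finsetSum_eq_zero_imp_eq_zero]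

/-- A grading passes to a direct summand whose structure maps preserve degrees. -/
theorem isInternal_retract {V W : Type*} [AddCommGroup V] [Module K V] [AddCommGroup W] [Module K W]
    {A : ℤ → Submodule K V} (hA : DirectSum.IsInternal A) (i : W →ₗ[K] V) (p : V →ₗ[K] W)
    (hpi : ∀ w, p (i w) = w) (hd : ∀ d v, v ∈ A d → i (p v) ∈ A d) :
    DirectSum.IsInternal (fun d => (A d).comap i) := by
  rw [isInternal_iff] at hA ⊢
  refine ⟨fun s w hw h0 d hd' => ?_, ?_⟩
  · have := hA.1 s (fun d => i (w d)) hw (by rw [← map_sum, h0, map_zero]) d hd'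
    rw [← hpi (w d), this, map_zero]
  · rw [eq_top_iff]
    rintro w -
    have h1 : i w ∈ ⨆ d, A d := hA.2 ▸ Submodule.mem_top
    have h2 : (⨆ d, A d) ≤ (⨆ d, (A d).comap i).comap p := by
      refine iSup_le fun d v hv => ?_
      exact Submodule.mem_iSup_of_mem d (hd d v hv)
    have h3 : p (i w) ∈ ⨆ d, (A d).comap i := h2 h1
    rwa [hpi] at h3

theorem isInternal_prod {V W : Type*} [AddCommGroup V] [Module K V] [AddCommGroup W] [Module K W]
    {A : ℤ → Submodule K V} {B : ℤ → Submodule K W} (hA : DirectSum.IsInternal A)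
    (hB : DirectSum.IsInternal B) : DirectSum.IsInternal (fun d => (A d).prod (B d)) := by
  rw [isInternal_iff] at hA hB ⊢
  refine ⟨fun s v hv h0 d hd => ?_, ?_⟩
  · refine Prod.ext ?_ ?_
    · refine hA.1 s (fun d => (v d).1) (fun d hd => (hv d hd).1) ?_ d hd
      simpa [Prod.fst_sum] using congrArg Prod.fst h0
    · refine hB.1 s (fun d => (v d).2) (fun d hd => (hv d hd).2) ?_ d hd
      simpa [Prod.snd_sum] using congrArg Prod.snd h0
  · rw [eq_top_iff]
    rintro ⟨v, w⟩ -
    have hv : v ∈ ⨆ d, A d := hA.2 ▸ Submodule.mem_top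
    have hw : w ∈ ⨆ d, B d := hB.2 ▸ Submodule.mem_top
    have h1 : (⨆ d, A d) ≤ (⨆ d, (A d).prod (B d)).comap (LinearMap.inl K V W) :=
      iSup_le fun d v hv => Submodule.mem_iSup_of_mem d ⟨hv, (B d).zero_mem⟩
    have h2 : (⨆ d, B d) ≤ (⨆ d, (A d).prod (B d)).comap (LinearMap.inr K V W) :=
      iSup_le fun d w hw => Submodule.mem_iSup_of_mem d ⟨(A d).zero_mem, hw⟩
    have h3 : ((v, 0) : V × W) + (0, w) ∈ ⨆ d, (A d).prod (B d) := Submodule.add_mem _ (h1 hv) (h2 hw)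
    rwa [Prod.mk_add_mk, add_zero, zero_add] at h3

end Grading

/-- A family `(M_n)` of modules over the algebras `H_n`, each with a family of subspaces indexed by
`ℤ` (on which no condition is imposed yet). -/
structure NHFamily (K : Type u) [Field K] where
  M : ℕ → Type u
  [addCommGroup : ∀ n, AddCommGroup (M n)]
  [module : ∀ n, Module K (M n)]
  [moduleNH : ∀ n, Module (NilHecke K n) (M n)]
  [tower : ∀ n, IsScalarTower K (NilHecke K n) (M n)]
  gr : ∀ n, ℤ → Submodule K (M n)

attribute [instance] NHFamily.addCommGroup NHFamily.module NHFamily.moduleNH NHFamily.tower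

variable {K : Type u} [Field K]

/-- The objects of `𝓗 = ⨁_n 𝓗_n`: each `M_n` is a graded `H_n`-module which is projective,
left-bounded and locally finite-dimensional, and only finitely many `M_n` are nonzero. -/
structure NHFamily.IsObj (F : NHFamily K) : Prop where
  isInternal : ∀ n, DirectSum.IsInternal (F.gr n)
  smul_mem : ∀ n (i j : ℤ) (a : NilHecke K n) (m : F.M n),
    a ∈ NilHecke.gr K n i → m ∈ F.gr n j → a • m ∈ F.gr n (i + j)
  projective : ∀ n, Module.Projective (NilHecke K n) (F.M n)
  bounded : ∀ n, ∃ b : ℤ, ∀ j < b, F.gr n j = ⊥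
  finite : ∀ n j, Module.Finite K (F.gr n j)
  support : {n | Nontrivial (F.M n)}.Finite

/-- Families of `H_n`-linear maps `M_n → N_n`. -/
abbrev NHFamily.Maps (F G : NHFamily K) : Type u := ∀ n, F.M n →ₗ[NilHecke K n] G.M n

/-- The families of `H_n`-linear maps that raise degrees by `d`. -/
def NHFamily.mapsDeg (F G : NHFamily K) (d : ℤ) : Submodule K (F.Maps G) where
  carrier := {f | ∀ n j m, m ∈ F.gr n j → f n m ∈ G.gr n (j + d)}
  add_mem' hf hg n j m hm := Submodule.add_mem _ (hf n j m hm) (hg n j m hm)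
  zero_mem' _ _ _ _ := Submodule.zero_mem _
  smul_mem' r _ hf n j m hm := Submodule.smul_mem _ r (hf n j m hm)

/-- The morphisms of `𝓗` (of all degrees): sums of homogeneous maps. -/
def NHFamily.homs (F G : NHFamily K) : Submodule K (F.Maps G) := ⨆ d, F.mapsDeg G d

theorem NHFamily.comp_mapsDeg {F G L : NHFamily K} {d e : ℤ} {f : F.Maps G} {g : G.Maps L}
    (hf : f ∈ F.mapsDeg G d) (hg : g ∈ G.mapsDeg L e) :
    (fun n => (g n).comp (f n)) ∈ F.mapsDeg L (d + e) := by
  intro n j m hm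
  have := hg n _ _ (hf n j m hm)
  rwa [add_assoc] at this

theorem NHFamily.comp_homs {F G L : NHFamily K} {f : F.Maps G} {g : G.Maps L}
    (hf : f ∈ F.homs G) (hg : g ∈ G.homs L) : (fun n => (g n).comp (f n)) ∈ F.homs L := by
  refine Submodule.iSup_induction (F.mapsDeg G) (motive := fun f => (fun n => (g n).comp (f n)) ∈ F.homs L)
    hf (fun d f hf => ?_) ?_ (fun f₁ f₂ h₁ h₂ => ?_)
  · refine Submodule.iSup_induction (G.mapsDeg L)
      (motive := fun g => (fun n => (g n).comp (f n)) ∈ F.homs L) hg (fun e g hg => ?_) ?_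
      (fun g₁ g₂ h₁ h₂ => ?_)
    · exact Submodule.mem_iSup_of_mem _ (NHFamily.comp_mapsDeg hf hg)
    · exact Submodule.zero_mem _
    · exact Submodule.add_mem _ h₁ h₂
  · have : (fun n => (g n).comp ((0 : F.Maps G) n)) = (0 : F.Maps L) := by
      funext n; exact LinearMap.comp_zero _
    rw [this]; exact Submodule.zero_mem _
  · have : (fun n => (g n).comp ((f₁ + f₂) n)) =
        (fun n => (g n).comp (f₁ n)) + fun n => (g n).comp (f₂ n) := by
      funext n; exact LinearMap.comp_add _ _ _
    rw [this]; exact Submodule.add_mem _ h₁ h₂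

variable (K) in
/-- The category `𝓗` for `sl₂`, in its enriched form: the morphisms are the sums of
homogeneous `H_n`-linear maps of all degrees. -/
structure HCat where
  fam : NHFamily K
  isObj : fam.IsObj

instance : Category (HCat K) where
  Hom A B := A.fam.homs B.fam
  id A := ⟨fun _ => LinearMap.id, Submodule.mem_iSup_of_mem 0 fun n j m hm => by simpa using hm⟩
  comp f g := ⟨fun n => (g.1 n).comp (f.1 n), NHFamily.comp_homs f.2 g.2⟩

instance : Preadditive (HCat K) where
  homGroup A B := inferInstanceAs (AddCommGroup (A.fam.homs B.fam))
  add_comp _ _ _ _ _ g := Subtype.ext (funext fun n => LinearMap.comp_add _ _ (g.1 n))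
  comp_add _ _ _ f _ _ := Subtype.ext (funext fun n => LinearMap.add_comp (f.1 n) _ _)

instance : Linear K (HCat K) where
  homModule A B := inferInstanceAs (Module K (A.fam.homs B.fam))
  smul_comp _ _ _ r _ g := Subtype.ext (funext fun n => LinearMap.ext fun _ =>
    LinearMap.map_smul_of_tower (g.1 n) r _)
  comp_smul _ _ _ _ _ _ := rfl

/-- The component at `n` of a morphism of `𝓗`. -/
def HCat.hom {A B : HCat K} (f : A ⟶ B) (n : ℕ) : A.fam.M n →ₗ[NilHecke K n] B.fam.M n := f.1 n

/-- The morphisms of `𝓗` that raise degrees by `d`. -/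
def HCat.homDeg (A B : HCat K) (d : ℤ) : Submodule K (A ⟶ B) :=
  (A.fam.mapsDeg B.fam d).comap (A.fam.homs B.fam).subtype

theorem HCat.mem_homDeg {A B : HCat K} {d : ℤ} {f : A ⟶ B} :
    f ∈ HCat.homDeg A B d ↔ ∀ n j m, m ∈ A.fam.gr n j → HCat.hom f n m ∈ B.fam.gr n (j + d) :=
  Iff.rfl

/-- A homogeneous family of maps as a morphism. -/
def HCat.ofDeg {A B : HCat K} {d : ℤ} (f : A.fam.Maps B.fam) (hf : f ∈ A.fam.mapsDeg B.fam d) :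
    A ⟶ B := ⟨f, Submodule.mem_iSup_of_mem d hf⟩

theorem HCat.hom_ext {A B : HCat K} {f g : A ⟶ B} (h : ∀ n m, HCat.hom f n m = HCat.hom g n m) :
    f = g :=
  Subtype.ext (funext fun n => LinearMap.ext (h n))

theorem HCat.isInternal_homDeg (A B : HCat K) : DirectSum.IsInternal (HCat.homDeg A B) := by
  rw [isInternal_iff]
  refine ⟨fun s f hf h0 d hd => ?_, ?_⟩
  · have key : ∀ n (m : A.fam.M n), HCat.hom (f d) n m = 0 := by
      intro n m
      have hm : m ∈ ⨆ j, A.fam.gr n j :=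
        ((isInternal_iff _).1 (A.isObj.isInternal n)).2 ▸ Submodule.mem_top
      refine Submodule.iSup_induction (A.fam.gr n) (motive := fun m => HCat.hom (f d) n m = 0) hm
        (fun j m hm => ?_) (map_zero _) (fun m₁ m₂ h₁ h₂ => by rw [map_add, h₁, h₂, add_zero])
      have hB := ((isInternal_iff _).1 (B.isObj.isInternal n)).1 (s.image (j + ·))
        (fun e => HCat.hom (f (e - j)) n m) ?_ ?_ (j + d) (Finset.mem_image_of_mem _ hd)
      · simpa using hB
      · intro e he
        obtain ⟨d', hd', rfl⟩ := Finset.mem_image.1 he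
        have := hf d' hd' n j m hm
        rw [add_sub_cancel_left]
        exact this
      · rw [Finset.sum_image (fun a _ b _ h => by simpa using h)]
        have h1 : ((∑ i ∈ s, f i).1 n) m = 0 := by rw [h0]; rfl
        have h2 : (∑ i ∈ s, f i).1 = ∑ i ∈ s, (f i).1 :=
          map_sum (A.fam.homs B.fam).subtype f s
        rw [h2, Finset.sum_apply, LinearMap.sum_apply] at h1
        simpa [HCat.hom] using h1
    exact HCat.hom_ext fun n m => key n m
  · rw [eq_top_iff]
    rintro f -
    have h : (⨆ d, A.fam.mapsDeg B.fam d) ≤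
        (⨆ d, HCat.homDeg A B d).map (A.fam.homs B.fam).subtype :=
      iSup_le fun d g hg => ⟨HCat.ofDeg g hg, Submodule.mem_iSup_of_mem d hg, rfl⟩
    obtain ⟨g, hg, hgf⟩ := h f.2
    rwa [← Subtype.ext hgf]

/-- The grading shift of an object of `𝓗` by `d`. -/
def HCat.shift (A : HCat K) (d : ℤ) : HCat K where
  fam := { M := A.fam.M, gr := fun n j => A.fam.gr n (j - d) }
  isObj :=
    { isInternal := fun n => by
        have h := A.isObj.isInternal n
        rw [DirectSum.isInternal_submodule_iff_iSupIndep_and_iSup_eq_top] at h ⊢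
        refine ⟨h.1.comp (f := fun j => j - d) (sub_left_injective), ?_⟩
        rw [← h.2]
        exact (Equiv.subRight d).iSup_comp (g := A.fam.gr n)
      smul_mem := fun n i j a m ha hm => by
        have := A.isObj.smul_mem n i (j - d) a m ha hm
        rwa [← add_sub_assoc] at this
      projective := A.isObj.projective
      bounded := fun n => by
        obtain ⟨b, hb⟩ := A.isObj.bounded n
        exact ⟨b + d, fun j hj => hb _ (by omega)⟩
      finite := fun n j => A.isObj.finite n (j - d)
      support := A.isObj.support }

/-- The zero object of `𝓗`. -/
def HCat.zero : HCat K where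
  fam := { M := fun _ => PUnit, gr := fun _ _ => ⊥ }
  isObj :=
    { isInternal := fun n => by
        rw [isInternal_iff]
        exact ⟨fun _ _ _ _ _ _ => Subsingleton.elim _ _, Subsingleton.elim _ _⟩
      smul_mem := fun n i j a m _ _ => Subsingleton.elim (α := PUnit) _ _
      projective := fun n => inferInstance
      bounded := fun n => ⟨0, fun _ _ => rfl⟩
      finite := fun n j => inferInstance
      support := by
        refine Set.finite_empty.subset fun n hn => ?_
        exact (not_nontrivial_iff_subsingleton.2 (inferInstanceAs (Subsingleton PUnit)) hn).elim }

/-- The direct sum of two objects of `𝓗`. -/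
def HCat.sum (A B : HCat K) : HCat K where
  fam := { M := fun n => A.fam.M n × B.fam.M n, gr := fun n j => (A.fam.gr n j).prod (B.fam.gr n j) }
  isObj :=
    { isInternal := fun n => isInternal_prod (A.isObj.isInternal n) (B.isObj.isInternal n)
      smul_mem := fun n i j a m ha hm =>
        ⟨A.isObj.smul_mem n i j a _ ha hm.1, B.isObj.smul_mem n i j a _ ha hm.2⟩
      projective := fun n => by
        have := A.isObj.projective n
        have := B.isObj.projective n
        infer_instance
      bounded := fun n => by
        obtain ⟨b, hb⟩ := A.isObj.bounded n
        obtain ⟨c, hc⟩ := B.isObj.bounded n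
        refine ⟨min b c, fun j hj => ?_⟩
        change (A.fam.gr n j).prod (B.fam.gr n j) = ⊥
        rw [hb j (by omega), hc j (by omega), Submodule.prod_bot]
      finite := fun n j => by
        exact Module.Finite.iff_fg.2 ((Module.Finite.iff_fg.1 (A.isObj.finite n j)).prod
          (Module.Finite.iff_fg.1 (B.isObj.finite n j)))
      support := by
        refine (A.isObj.support.union B.isObj.support).subset fun n hn => ?_
        by_contra h
        have h1 := not_nontrivial_iff_subsingleton.1 fun h' => h (Or.inl h')
        have h2 := not_nontrivial_iff_subsingleton.1 fun h' => h (Or.inr h')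
        exact not_nontrivial_iff_subsingleton.2
          (inferInstanceAs (Subsingleton (A.fam.M n × B.fam.M n))) hn }

/-- The image of a homogeneous idempotent of degree zero. -/
def HCat.image (A : HCat K) (e : A ⟶ A) (he : e ∈ HCat.homDeg A A 0) (hee : e ≫ e = e) : HCat K where
  fam :=
    { M := fun n => LinearMap.range (HCat.hom e n)
      gr := fun n j => (A.fam.gr n j).comap
        ((LinearMap.range (HCat.hom e n)).subtype.restrictScalars K) }
  isObj :=
    { isInternal := fun n => by
        refine isInternal_retract (A.isObj.isInternal n)
          ((LinearMap.range (HCat.hom e n)).subtype.restrictScalars K)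
          ((HCat.hom e n).rangeRestrict.restrictScalars K) ?_ ?_
        · rintro ⟨_, m, rfl⟩
          exact Subtype.ext (congrArg (fun f : A ⟶ A => HCat.hom f n m) hee)
        · intro d m hm
          have := he n d m hm
          rwa [add_zero] at this
      smul_mem := fun n i j a m ha hm => A.isObj.smul_mem n i j a m.1 ha hm
      projective := fun n => by
        have := A.isObj.projective n
        refine Module.Projective.of_split (LinearMap.range (HCat.hom e n)).subtype
          (HCat.hom e n).rangeRestrict (LinearMap.ext ?_)
        rintro ⟨_, m, rfl⟩
        exact Subtype.ext (congrArg (fun f : A ⟶ A => HCat.hom f n m) hee)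
      bounded := fun n => by
        obtain ⟨b, hb⟩ := A.isObj.bounded n
        refine ⟨b, fun j hj => ?_⟩
        change (A.fam.gr n j).comap _ = ⊥
        rw [hb j hj, Submodule.comap_bot, LinearMap.ker_eq_bot]
        exact Subtype.val_injective
      finite := fun n j => by
        have := A.isObj.finite n j
        exact Module.Finite.of_injective
          (((LinearMap.range (HCat.hom e n)).subtype.restrictScalars K).restrict
            (p := (A.fam.gr n j).comap ((LinearMap.range (HCat.hom e n)).subtype.restrictScalars K))
            (q := A.fam.gr n j) (fun m hm => hm))
          (fun x y h => Subtype.ext (Subtype.ext (congrArg (fun z : A.fam.gr n j => z.1) h)))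
      support := by
        refine A.isObj.support.subset fun n hn => ?_
        have : Nontrivial (LinearMap.range (HCat.hom e n)) := hn
        exact (Subtype.val_injective (p := fun m => m ∈ LinearMap.range (HCat.hom e n))).nontrivial }

instance : GradedAdditiveCategory K (HCat K) where
  homDeg := HCat.homDeg
  isInternal := HCat.isInternal_homDeg
  id_mem A n j m hm := by rwa [add_zero]
  comp_mem hf hg := NHFamily.comp_mapsDeg hf hg
  exists_shift A d := by
    have h1 : (fun n => LinearMap.id : A.fam.Maps (A.shift d).fam) ∈
        A.fam.mapsDeg (A.shift d).fam d := by
      intro n j m hm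
      change m ∈ A.fam.gr n (j + d - d)
      rwa [add_sub_cancel_right]
    have h2 : (fun n => LinearMap.id : (A.shift d).fam.Maps A.fam) ∈
        (A.shift d).fam.mapsDeg A.fam (-d) := fun n j m hm => hm
    exact ⟨A.shift d, ⟨HCat.ofDeg _ h1, HCat.ofDeg _ h2, rfl, rfl⟩, h1, h2⟩
  exists_zero := ⟨HCat.zero, HCat.hom_ext fun n m => Subsingleton.elim (α := PUnit) _ _⟩
  exists_sum A B := by
    have h1 : (fun n => LinearMap.inl _ _ _ : A.fam.Maps (A.sum B).fam) ∈
        A.fam.mapsDeg (A.sum B).fam 0 := fun n j m hm => by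
      rw [add_zero]; exact ⟨hm, Submodule.zero_mem _⟩
    have h2 : (fun n => LinearMap.inr _ _ _ : B.fam.Maps (A.sum B).fam) ∈
        B.fam.mapsDeg (A.sum B).fam 0 := fun n j m hm => by
      rw [add_zero]; exact ⟨Submodule.zero_mem _, hm⟩
    have h3 : (fun n => LinearMap.fst _ _ _ : (A.sum B).fam.Maps A.fam) ∈
        (A.sum B).fam.mapsDeg A.fam 0 := fun n j m hm => by
      rw [add_zero]; exact hm.1
    have h4 : (fun n => LinearMap.snd _ _ _ : (A.sum B).fam.Maps B.fam) ∈
        (A.sum B).fam.mapsDeg B.fam 0 := fun n j m hm => by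
      rw [add_zero]; exact hm.2
    refine ⟨A.sum B, HCat.ofDeg _ h1, HCat.ofDeg _ h2, HCat.ofDeg _ h3, HCat.ofDeg _ h4,
      h1, h2, h3, h4, rfl, rfl, rfl, rfl, HCat.hom_ext fun n m => ?_⟩
    exact Prod.ext (add_zero _) (zero_add _)
  exists_split A e he hee := by
    have h1 : (fun n => (HCat.hom e n).rangeRestrict : A.fam.Maps (A.image e he hee).fam) ∈
        A.fam.mapsDeg (A.image e he hee).fam 0 := fun n j m hm => he n j m hm
    have h2 : (fun n => (LinearMap.range (HCat.hom e n)).subtype :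
        (A.image e he hee).fam.Maps A.fam) ∈ (A.image e he hee).fam.mapsDeg A.fam 0 :=
      fun n j m hm => by rw [add_zero]; exact hm
    refine ⟨A.image e he hee, HCat.ofDeg _ h1, HCat.ofDeg _ h2, h1, h2, HCat.hom_ext ?_, rfl⟩
    rintro n ⟨_, m, rfl⟩
    exact Subtype.ext (congrArg (fun f : A ⟶ A => HCat.hom f n m) hee)


/-! ## The functors `E_0`, `E_1` and the natural transformations -/

variable {K : Type u} [Field K]

/-- The restriction functor on families: `(E_0 M)_n` is `M_{n+1}` viewed as an `H_n`-module. -/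
def NHFamily.res (F : NHFamily K) : NHFamily K where
  M n := Res K n (F.M (n + 1))
  gr n d := (F.gr (n + 1) d).comap (Res.val n (F.M (n + 1)))

/-- The modules of the induced family: `(E_1 M)_0 = 0` and `(E_1 M)_{n+1} = H_{n+1} ⊗_{H_n} M_n`. -/
def NHFamily.indM (F : NHFamily K) : ℕ → Type u
  | 0 => PUnit
  | n + 1 => Ind K n (F.M n)

instance (F : NHFamily K) : ∀ n, AddCommGroup (F.indM n)
  | 0 => (inferInstance : AddCommGroup PUnit.{u + 1})
  | n + 1 => (inferInstance : AddCommGroup (Ind K n (F.M n)))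

instance (F : NHFamily K) : ∀ n, Module K (F.indM n)
  | 0 => (inferInstance : Module K PUnit.{u + 1})
  | n + 1 => (inferInstance : Module K (Ind K n (F.M n)))

instance (F : NHFamily K) : ∀ n, Module (NilHecke K n) (F.indM n)
  | 0 => (inferInstance : Module (NilHecke K 0) PUnit.{u + 1})
  | n + 1 => (inferInstance : Module (NilHecke K (n + 1)) (Ind K n (F.M n)))

instance (F : NHFamily K) : ∀ n, IsScalarTower K (NilHecke K n) (F.indM n)
  | 0 => (inferInstance : IsScalarTower K (NilHecke K 0) PUnit.{u + 1})
  | n + 1 => (inferInstance : IsScalarTower K (NilHecke K (n + 1)) (Ind K n (F.M n)))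

/-- The induction functor on families, with the tensor product grading. -/
def NHFamily.ind (F : NHFamily K) : NHFamily K where
  M := F.indM
  gr
    | 0, _ => ⊥
    | n + 1, d => Submodule.span K {z : Ind K n (F.M n) | ∃ (i j : ℤ) (a : NilHecke K (n + 1))
        (m : F.M n), i + j = d ∧ a ∈ NilHecke.gr K (n + 1) i ∧ m ∈ F.gr n j ∧ z = Ind.mk a m}

/-- The effect of restriction on maps. -/
def NHFamily.resMap {F G : NHFamily K} (f : F.Maps G) : F.res.Maps G.res :=
  fun n => Res.map n (M := F.M (n + 1)) (N := G.M (n + 1)) (f (n + 1))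

/-- The effect of induction on maps. -/
def NHFamily.indMap {F G : NHFamily K} (f : F.Maps G) : F.ind.Maps G.ind
  | 0 => (0 : PUnit.{u + 1} →ₗ[NilHecke K 0] PUnit.{u + 1})
  | n + 1 => Ind.map (f n)

theorem NHFamily.resMap_deg {F G : NHFamily K} {d : ℤ} {f : F.Maps G} (hf : f ∈ F.mapsDeg G d) :
    NHFamily.resMap f ∈ F.res.mapsDeg G.res d := fun n j m hm => hf (n + 1) j m hm

theorem NHFamily.indMap_deg {F G : NHFamily K} {d : ℤ} {f : F.Maps G} (hf : f ∈ F.mapsDeg G d) :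
    NHFamily.indMap f ∈ F.ind.mapsDeg G.ind d := by
  rintro (_ | n) j m hm
  · exact Subsingleton.elim (α := PUnit) _ _
  · have key : Submodule.span K {z : Ind K n (F.M n) | ∃ (i j' : ℤ) (a : NilHecke K (n + 1))
        (m : F.M n), i + j' = j ∧ a ∈ NilHecke.gr K (n + 1) i ∧ m ∈ F.gr n j' ∧ z = Ind.mk a m} ≤
        (G.ind.gr (n + 1) (j + d)).comap ((Ind.map (f n)).restrictScalars K) := by
      rw [Submodule.span_le]
      rintro _ ⟨i, j', a, m, rfl, ha, hm, rfl⟩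
      exact Submodule.subset_span ⟨i, j' + d, a, f n m, by ring, ha, hf n j' m hm, rfl⟩
    exact key hm

/-- The effect of induction on maps as a `K`-linear map. -/
def NHFamily.indMapₗ (F G : NHFamily K) : F.Maps G →ₗ[K] F.ind.Maps G.ind where
  toFun := NHFamily.indMap
  map_add' f g := by
    funext n
    cases n with
    | zero => exact LinearMap.ext fun m => Subsingleton.elim (α := PUnit) _ _
    | succ n => exact Ind.map_add (f n) (g n)
  map_smul' r f := by
    funext n
    cases n with
    | zero => exact LinearMap.ext fun m => Subsingleton.elim (α := PUnit) _ _
    | succ n => exact Ind.map_smul r (f n)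

/-- The effect of restriction on maps as a `K`-linear map. -/
def NHFamily.resMapₗ (F G : NHFamily K) : F.Maps G →ₗ[K] F.res.Maps G.res where
  toFun := NHFamily.resMap
  map_add' _ _ := rfl
  map_smul' _ _ := rfl

theorem NHFamily.map_homs {F G F' G' : NHFamily K} (φ : F.Maps G →ₗ[K] F'.Maps G')
    (hφ : ∀ d f, f ∈ F.mapsDeg G d → φ f ∈ F'.mapsDeg G' d) {f : F.Maps G} (hf : f ∈ F.homs G) :
    φ f ∈ F'.homs G' := by
  refine Submodule.iSup_induction (F.mapsDeg G) (motive := fun f => φ f ∈ F'.homs G') hf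
    (fun d f hf => Submodule.mem_iSup_of_mem d (hφ d f hf)) ?_ (fun f₁ f₂ h₁ h₂ => ?_)
  · rw [map_zero]; exact Submodule.zero_mem _
  · rw [map_add]; exact Submodule.add_mem _ h₁ h₂

/-- The functor `E_0`: restriction, as an endofunctor of `𝓗` once `𝓗` is known to be stable. -/
def resFunctor (h : ∀ A : HCat K, A.fam.res.IsObj) : HCat K ⥤ HCat K where
  obj A := ⟨A.fam.res, h A⟩
  map {A B} f := ⟨NHFamily.resMap f.1,
    NHFamily.map_homs (NHFamily.resMapₗ A.fam B.fam) (fun _ _ hf => NHFamily.resMap_deg hf) f.2⟩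

/-- The functor `E_1`: induction, as an endofunctor of `𝓗` once `𝓗` is known to be stable. -/
def indFunctor (h : ∀ A : HCat K, A.fam.ind.IsObj) : HCat K ⥤ HCat K where
  obj A := ⟨A.fam.ind, h A⟩
  map {A B} f := ⟨NHFamily.indMap f.1,
    NHFamily.map_homs (NHFamily.indMapₗ A.fam B.fam) (fun _ _ hf => NHFamily.indMap_deg hf) f.2⟩
  map_id A := by
    refine Subtype.ext (funext fun n => ?_)
    cases n with
    | zero => exact LinearMap.ext fun m => Subsingleton.elim (α := PUnit) _ _
    | succ n => exact Ind.map_id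
  map_comp f g := by
    refine Subtype.ext (funext fun n => ?_)
    cases n with
    | zero => exact LinearMap.ext fun m => Subsingleton.elim (α := PUnit) _ _
    | succ n => exact Ind.map_comp (f.1 n) (g.1 n)

/-- The functors `E_0` (restriction) and `E_1` (induction). -/
def sl2Functors (h₀ : ∀ A : HCat K, A.fam.res.IsObj) (h₁ : ∀ A : HCat K, A.fam.ind.IsObj) :
    Fin 2 → (HCat K ⥤ HCat K)
  | 0 => resFunctor h₀
  | 1 => indFunctor h₁

variable (K) in
/-- The map `H_{n+1} ⊗_{H_n} H_{n+1} → H_{n+2}`, `a ⊗ b ↦ a τ_{n+1} b`. -/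
def tensorEmb (n : ℕ) : Ind K n (Res K n (NilHecke K (n + 1))) →ₗ[NilHecke K (n + 1)]
    Res K (n + 1) (NilHecke K (n + 2)) :=
  Submodule.liftQ (indRel (K := K) n (Res K n (NilHecke K (n + 1))))
    (TensorProduct.AlgebraTensorModule.lift
      { toFun := fun a =>
          { toFun := fun b => Res.mk (n + 1) (NilHecke K (n + 2))
              (incl K (n + 1) a * tLast K n * incl K (n + 1) (Res.val n (NilHecke K (n + 1)) b))
            map_add' := fun b c => by simp only [map_add, mul_add]
            map_smul' := fun r b => by simp }
        map_add' := fun a b => by ext c; simp [add_mul]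
        map_smul' := fun a b => by
          refine LinearMap.ext fun c => ?_
          change incl K (n + 1) (a * b) * tLast K n * _ =
            incl K (n + 1) a * (incl K (n + 1) b * tLast K n * _)
          rw [map_mul, mul_assoc, mul_assoc, mul_assoc] })
    (by
      unfold indRel
      rw [Submodule.span_le]
      rintro _ ⟨a, h, m, rfl⟩
      rw [SetLike.mem_coe, LinearMap.mem_ker, map_sub, sub_eq_zero]
      change incl K (n + 1) (a * incl K n h) * tLast K n * incl K (n + 1) (Res.val n _ m) =
        incl K (n + 1) a * tLast K n * incl K (n + 1) (incl K n h * Res.val n _ m)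
      rw [map_mul, map_mul, mul_assoc (incl K (n + 1) a), ← tLast_comm]
      simp only [mul_assoc])

variable (K) in
/-- The Kang-Kashiwara map `H_{n+1} ⊗_{H_n} H_{n+1} ⊕ H_{n+1}[x_{n+2}] → H_{n+2}`,
`(a ⊗ b, ∑ c_k x^k) ↦ a τ_{n+1} b + ∑ c_k x_{n+2}^k`. -/
def kangKashiwara (n : ℕ) (p : Ind K n (Res K n (NilHecke K (n + 1))) × (NilHecke K (n + 1))[X]) :
    NilHecke K (n + 2) :=
  Res.val (n + 1) (NilHecke K (n + 2)) (tensorEmb K n p.1) +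
    p.2.eval₂ (incl K (n + 1)).toRingHom (xLast K (n + 1))


/-- The formulas for the natural transformations, in the usual indexing of `x_i`, `τ_i`, `s_i` from
`1`.  Only the components at which the source and the target are not zero by definition occur. -/
structure IsSl2Data {h₀ : ∀ A : HCat K, A.fam.res.IsObj} {h₁ : ∀ A : HCat K, A.fam.ind.IsObj}
    (ρ : TwoRepData (sl2Functors h₀ h₁)) : Prop where
  /-- `X_1 : a ⊗ m ↦ a x_{n+1} ⊗ m` on `H_{n+1} ⊗_{H_n} M_n` -/
  x_one : ∀ (A : HCat K) (n : ℕ) (a : NilHecke K (n + 1)) (m : A.fam.M n),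
    HCat.hom (ρ.x 1 A) (n + 1) (Ind.mk a m) = Ind.mk (a * xLast K n) m
  /-- `X_0 : m ↦ x_{n+1} m` on `M_{n+1}` -/
  x_zero : ∀ (A : HCat K) (n : ℕ) (m : A.fam.M (n + 1)),
    HCat.hom (ρ.x 0 A) n (Res.mk (K := K) n (A.fam.M (n + 1)) m) =
      Res.mk (K := K) n (A.fam.M (n + 1)) (xLast K n • m)
  /-- `T_{11} : a ⊗ (b ⊗ m) ↦ a b τ_{n+1} ⊗ (1 ⊗ m)` on
  `H_{n+2} ⊗_{H_{n+1}} (H_{n+1} ⊗_{H_n} M_n)` -/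
  t_one_one : ∀ (A : HCat K) (n : ℕ) (a : NilHecke K (n + 2)) (b : NilHecke K (n + 1))
    (m : A.fam.M n),
    HCat.hom (ρ.t 1 1 A) (n + 2) (Ind.mk (M := Ind K n (A.fam.M n)) a (Ind.mk b m)) =
      Ind.mk (M := Ind K n (A.fam.M n)) (a * incl K (n + 1) b * tLast K n) (Ind.mk 1 m)
  /-- `T_{00} : m ↦ -τ_{n+1} m` on `M_{n+2}` -/
  t_zero_zero : ∀ (A : HCat K) (n : ℕ) (m : A.fam.M (n + 2)),
    HCat.hom (ρ.t 0 0 A) n (Res.mk (K := K) n (Res K (n + 1) (A.fam.M (n + 2)))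
        (Res.mk (K := K) (n + 1) (A.fam.M (n + 2)) m)) =
      Res.mk (K := K) n (Res K (n + 1) (A.fam.M (n + 2)))
        (Res.mk (K := K) (n + 1) (A.fam.M (n + 2)) (-(tLast K n • m)))
  /-- `T_{10} : a ⊗ m ↦ a (x_{n+1} - x_{n+2}) s_{n+1} ⊗ m`, from `H_{n+1} ⊗_{H_n} M_{n+1}` to
  `H_{n+2} ⊗_{H_{n+1}} M_{n+1}` -/
  t_one_zero : ∀ (A : HCat K) (n : ℕ) (a : NilHecke K (n + 1)) (m : A.fam.M (n + 1)),
    HCat.hom (ρ.t 1 0 A) (n + 1) (Ind.mk a (Res.mk (K := K) n (A.fam.M (n + 1)) m)) =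
      Res.mk (K := K) (n + 1) (Ind K (n + 1) (A.fam.M (n + 1)))
        (Ind.mk (incl K (n + 1) a * (xPrev K n - xLast K (n + 1)) * sLast K n) m)
  /-- `T_{01}`, from `H_{n+2} ⊗_{H_{n+1}} M_{n+1}` to
  `H_{n+1} ⊗_{H_n} M_{n+1} = (H_{n+1} ⊗_{H_n} H_{n+1}) ⊗_{H_{n+1}} M_{n+1}`, is induced by the
  projection to the first summand of `H_{n+2} ≃ H_{n+1} ⊗_{H_n} H_{n+1} ⊕ H_{n+1}[x_{n+2}]` -/
  t_zero_one : ∀ (A : HCat K) (n : ℕ) (a b : NilHecke K (n + 1)) (p : (NilHecke K (n + 1))[X])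
    (m : A.fam.M (n + 1)),
    HCat.hom (ρ.t 0 1 A) (n + 1) (Res.mk (K := K) (n + 1) (Ind K (n + 1) (A.fam.M (n + 1)))
        (Ind.mk (kangKashiwara K n (Ind.mk a (Res.mk n (NilHecke K (n + 1)) b), p)) m)) =
      Ind.mk a (Res.mk (K := K) n (A.fam.M (n + 1)) (b • m))

end TwoRepSl2

end

/-! Indices start at `0` and `x_i`, `τ_i` are written accordingly. Everything rests on a PBW
theorem: `H_{N+1}` is free as a left module over `H_N[x_N]` on the strings `τ_{N-1} ⋯ τ_k`, `0 ≤ k ≤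
N` (`toHecke_ofHecke`, `ofHecke_toHecke`). Independence is obtained by constructing the answer. On
the free module `CosetModule` the right multiplications by `x_j` and `τ_j` are written down row by
row, the relations of `H_{N+1}` are verified for them (`genOp_rel`), and acting on the generator
that stands for `1` gives an inverse of the evident map to `H_{N+1}`. The one long row, `x_k` on the
`k`-th generator, enters this verification only through the sum of all `x_j`. That sum acts by a
central scalar, so the relations for `x_k` follow from those for the other `x_j`.

In the expansion of an element of `H_{n+2}` the coefficient of the empty string is its polynomial
part, and every other string begins with `τ_n`. Modulo the polynomial part `τ_n x_n^a` equals
`x_{n+1}^a τ_n`, so the other coefficients recover the tensor part. This is the Kang-Kashiwara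
bijection (`kangKashiwara_bijective`).

Stability of the category: induction preserves projectives because it is left adjoint to the exact
functor of restriction, and restriction does because `H_{n+1}` is projective over `H_n` by PBW. The
tensor grading of an induced module is direct because it consists of eigenvectors of one operator
with eigenvalues `2 ^ d`, which are distinct in characteristic `0`. The Kang-Kashiwara map tensored
with a module describes each graded piece by one for fewer strands together with powers of the last
`x`, and an induction on `n` gives boundedness and finiteness (`indGr_bounded_finite`).

The relations: let `y`, `z` be the last two variables, `τ` their crossing, and `c = (y - z) s`. The
map `T_{01}` is a bimodule projection that sends `a τ b` to `a ⊗ b` and kills polynomials in `z`;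
the map `T_{10}` is right multiplication by `c`. The decisive identity is that `c` is a double
commutator, `c = y²τ - 2yτy + τy²`, and likewise with `z` in place of `y` (`crossElt_eq`,
`crossElt_eq'`). Since `T_{01}` turns the outer `τ` into a tensor sign, both composites of `T_{01}`
and `T_{10}` become the square of a difference of dots. The braid relations with `i ≠ k` reduce to
the braid relation for `τ` and to its compatibility with products of two elements `c`
(`cross_braid`, `cross_braid'`). The two relations whose right side is a nonzero divided difference
reduce to expanding `τ_1 τ_0 c` and `c τ_0 τ_1` in `H_3` into terms `a τ_1 b` with `a`, `b` in `H_2`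
(`tau_tau_cross`, `cross_tau_tau`).

Finally the prescribed formulas give the values of `X_i` and `T_{ij}` on generators of the modules
involved, which proves uniqueness (`IsSl2Data.unique`). -/

noncomputable section

namespace TwoRepSl2

namespace NilHecke

/-! ### Generators of the nil affine Hecke algebra and strings of crossings. -/

section Generators

variable (K : Type u) [Field K] (n : ℕ)

/-- The generator `x i` of `H_n`, extended by zero to all indices. -/
def x (i : ℕ) : NilHecke K n := if h : i < n then gen K (.x i h) else 0

/-- The generator `τ i` of `H_n`, extended by zero to all indices. -/
def t (i : ℕ) : NilHecke K n := if h : i + 1 < n then gen K (.t i h) else 0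

variable {K n}

theorem gen_x {i : ℕ} (h : i < n) : gen K (.x i h) = x K n i := by simp [x, h]

theorem gen_t {i : ℕ} (h : i + 1 < n) : gen K (.t i h) = t K n i := by simp [t, h]

theorem x_mul_x (i j : ℕ) : x K n i * x K n j = x K n j * x K n i := by
  by_cases hi : i < n
  · by_cases hj : j < n
    · simpa [gen_x] using gen_rel (Rel.x_x (K := K) i j hi hj)
    · simp [x, hj]
  · simp [x, hi]

theorem t_mul_x {i j : ℕ} (h₁ : j ≠ i) (h₂ : j ≠ i + 1) :
    t K n i * x K n j = x K n j * t K n i := by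
  by_cases hi : i + 1 < n
  · by_cases hj : j < n
    · simpa [gen_x, gen_t] using gen_rel (Rel.t_x (K := K) i j hi hj h₁ h₂)
    · simp [x, hj]
  · simp [t, hi]

theorem t_mul_x_succ {i : ℕ} (hi : i + 1 < n) :
    t K n i * x K n (i + 1) = x K n i * t K n i + 1 := by
  have := gen_rel (Rel.t_x_succ (K := K) i hi)
  simp only [map_sub, map_mul, FreeAlgebra.lift_ι_apply, gen_x, gen_t, map_one] at this
  rw [← this]
  abel

theorem t_mul_x_self {i : ℕ} (hi : i + 1 < n) :
    t K n i * x K n i = x K n (i + 1) * t K n i - 1 := by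
  have := gen_rel (Rel.t_x_self (K := K) i hi)
  simp only [map_sub, map_mul, FreeAlgebra.lift_ι_apply, gen_x, gen_t, map_neg, map_one] at this
  rw [sub_eq_add_neg, ← this]
  abel

theorem t_mul_t {i j : ℕ} (h : i + 1 < j) : t K n i * t K n j = t K n j * t K n i := by
  by_cases hj : j + 1 < n
  · have hi : i + 1 < n := by omega
    simpa [gen_t] using gen_rel (Rel.t_t (K := K) i j hi hj h)
  · simp [t, hj]

theorem t_mul_t' {i j : ℕ} (h : i + 1 < j ∨ j + 1 < i) :
    t K n i * t K n j = t K n j * t K n i := by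
  rcases h with h | h
  · exact t_mul_t h
  · exact (t_mul_t h).symm

theorem t_mul_self (i : ℕ) : t K n i * t K n i = 0 := by
  by_cases hi : i + 1 < n
  · simpa [gen_t] using gen_rel (Rel.t_sq (K := K) i hi)
  · simp [t, hi]

theorem t_braid (i : ℕ) :
    t K n (i + 1) * t K n i * t K n (i + 1) = t K n i * t K n (i + 1) * t K n i := by
  by_cases hi : i + 2 < n
  · simpa [gen_t] using gen_rel (Rel.braid (K := K) i hi)
  · have : ¬ i + 1 + 1 < n := hi
    simp [t, this]

theorem t_of_le {i : ℕ} (h : n ≤ i + 1) : t K n i = 0 := by simp [t, h]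

theorem incl_x {i : ℕ} (h : i < n) : incl K n (x K n i) = x K (n + 1) i := by
  rw [← gen_x h, incl_gen, ← gen_x (by omega)]; rfl

theorem incl_t {i : ℕ} (h : i + 1 < n) : incl K n (t K n i) = t K (n + 1) i := by
  rw [← gen_t h, incl_gen, ← gen_t (by omega)]; rfl

theorem xLast_eq : xLast K n = x K (n + 1) n := gen_x _

theorem xPrev_eq : xPrev K n = x K (n + 2) n := gen_x _

theorem tLast_eq : tLast K n = t K (n + 2) n := gen_t _

variable (K n) in
/-- The product `τ_{i-1} τ_{i-2} ⋯ τ_k`. -/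
def tDown : ℕ → ℕ → NilHecke K n
  | 0, _ => 1
  | i + 1, k => if k ≤ i then t K n i * tDown i k else 1

theorem tDown_of_le {i k : ℕ} (h : i ≤ k) : tDown K n i k = 1 := by
  cases i with
  | zero => rfl
  | succ i => rw [tDown, if_neg (by omega)]

theorem tDown_succ {i k : ℕ} (h : k ≤ i) : tDown K n (i + 1) k = t K n i * tDown K n i k := by
  rw [tDown, if_pos h]

theorem tDown_mul_x_of_lt {i j k : ℕ} (h : j < k ∨ i < j) :
    tDown K n i k * x K n j = x K n j * tDown K n i k := by
  induction i with
  | zero => simp [tDown]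
  | succ i ih =>
    by_cases hk : k ≤ i
    · rw [tDown_succ hk, mul_assoc, ih (by omega), ← mul_assoc, t_mul_x (by omega) (by omega),
        mul_assoc]
    · rw [tDown_of_le (by omega), one_mul, mul_one]

theorem tDown_mul_t_comm {i j k : ℕ} (h : j + 1 < k ∨ i < j) :
    tDown K n i k * t K n j = t K n j * tDown K n i k := by
  induction i with
  | zero => simp [tDown]
  | succ i ih =>
    by_cases hk : k ≤ i
    · rw [tDown_succ hk, mul_assoc, ih (by omega), ← mul_assoc, t_mul_t' (by omega),
        mul_assoc]
    · rw [tDown_of_le (by omega), one_mul, mul_one]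

theorem tDown_mul_t_pred {i k : ℕ} (h : k < i) :
    tDown K n i (k + 1) * t K n k = tDown K n i k := by
  induction i with
  | zero => omega
  | succ i ih =>
    rw [tDown_succ (i := i) (k := k) (by omega)]
    by_cases hk : k < i
    · rw [tDown_succ (by omega), mul_assoc, ih hk]
    · obtain rfl : k = i := by omega
      rw [tDown_of_le le_rfl, tDown_of_le le_rfl, one_mul, mul_one]

theorem tDown_mul_t_self {i k : ℕ} (h : k < i) : tDown K n i k * t K n k = 0 := by
  rw [← tDown_mul_t_pred h, mul_assoc, t_mul_self, mul_zero]

/-- The crossing slides through the string by a single braid move and loses one from its index,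
since the string carries the strands to its right one place over. -/
theorem tDown_mul_t {i j k : ℕ} (h₁ : k ≤ j) (h₂ : j + 1 < i) :
    tDown K n i k * t K n (j + 1) = t K n j * tDown K n i k := by
  induction i with
  | zero => omega
  | succ i ih =>
    rw [tDown_succ (by omega), mul_assoc]
    by_cases hj : j + 1 < i
    · rw [ih hj, ← mul_assoc, ← mul_assoc, t_mul_t' (by omega)]
    · obtain rfl : i = j + 1 := by omega
      rw [tDown_succ h₁, mul_assoc, tDown_mul_t_comm (by omega), ← mul_assoc, ← mul_assoc, t_braid]
      simp only [mul_assoc]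

/-- The dot drops by one position when it meets `τ_j`. The correction is the string with `τ_j`
removed; its two remaining pieces commute. -/
theorem tDown_mul_x {i j k : ℕ} (h₁ : k ≤ j) (h₂ : j < i) (hi : i < n) :
    tDown K n i k * x K n (j + 1) =
      x K n j * tDown K n i k + tDown K n j k * tDown K n i (j + 1) := by
  induction i with
  | zero => omega
  | succ i ih =>
    rw [tDown_succ (by omega), mul_assoc]
    by_cases hj : j < i
    · rw [ih hj (by omega), mul_add, ← mul_assoc, ← mul_assoc, ← mul_assoc, t_mul_x (by omega) (by omega),
        ← tDown_mul_t_comm (Or.inr hj), tDown_succ (k := j + 1) hj, mul_assoc (tDown K n j k)]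
    · obtain rfl : i = j := by omega
      rw [tDown_mul_x_of_lt (by omega), ← mul_assoc, t_mul_x_succ hi, add_mul,
        tDown_of_le (k := i + 1) le_rfl, mul_one, one_mul, mul_assoc]

/-- Here the dot travels along the whole string from position `k` to position `i`, so each crossing
contributes one correction in which it is removed. -/
theorem tDown_mul_x_self {i k : ℕ} (h : k ≤ i) (hi : i < n) :
    tDown K n i k * x K n k =
      x K n i * tDown K n i k - ∑ j ∈ Finset.Ico k i, tDown K n j k * tDown K n i (j + 1) := by
  induction i with
  | zero =>
    obtain rfl : k = 0 := by omega
    simp [tDown]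
  | succ i ih =>
    by_cases hk : k ≤ i
    · rw [tDown_succ hk, mul_assoc, ih hk (by omega), mul_sub, ← mul_assoc, t_mul_x_self hi,
        Finset.sum_Ico_succ_top hk, tDown_of_le (i := i + 1) (k := i + 1) le_rfl, Finset.mul_sum, sub_mul,
        one_mul, mul_one, mul_assoc, add_comm (Finset.sum _ _), sub_sub]
      congr 2
      refine Finset.sum_congr rfl fun j hj => ?_
      rw [Finset.mem_Ico] at hj
      rw [tDown_succ (k := j + 1) (by omega), ← mul_assoc, ← mul_assoc, tDown_mul_t_comm (Or.inr hj.2)]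
    · obtain rfl : k = i + 1 := by omega
      simp [tDown_of_le]

theorem incl_tDown {i k : ℕ} (h : i < n) : incl K n (tDown K n i k) = tDown K (n + 1) i k := by
  induction i with
  | zero => simp [tDown]
  | succ i ih =>
    by_cases hk : k ≤ i
    · rw [tDown_succ hk, tDown_succ hk, map_mul, ih (by omega), incl_t h]
    · rw [tDown_of_le (by omega), tDown_of_le (by omega), map_one]

/-- Only `x_i` and `x_{i+1}` fail to commute with `τ_i`, and their error terms are opposite. -/
theorem t_mul_sum_x (i : ℕ) :
    t K n i * ∑ j ∈ Finset.range n, x K n j = (∑ j ∈ Finset.range n, x K n j) * t K n i := by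
  by_cases hi : i + 1 < n
  · rw [← sub_eq_zero, Finset.mul_sum, Finset.sum_mul, ← Finset.sum_sub_distrib]
    have key : ∀ j, t K n i * x K n j - x K n j * t K n i =
        (if j = i then -(x K n i * t K n i + 1 - x K n (i + 1) * t K n i) else 0) +
        (if j = i + 1 then (x K n i * t K n i + 1 - x K n (i + 1) * t K n i) else 0) := by
      intro j
      by_cases h₁ : j = i
      · subst h₁
        simp [t_mul_x_self hi]
        abel
      · by_cases h₂ : j = i + 1
        · subst h₂
          simp [t_mul_x_succ hi]
        · simp [h₁, h₂, t_mul_x h₁ h₂]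
    rw [Finset.sum_congr rfl fun j _ => key j, Finset.sum_add_distrib, Finset.sum_ite_eq',
      Finset.sum_ite_eq', if_pos (by simp; omega), if_pos (by simpa using hi), neg_add_cancel]
  · simp [t_of_le (not_lt.1 hi)]

/-- The centrality of this element later replaces every direct computation with `tDown_mul_x_self`
in the check of the relations. -/
theorem commute_sum_x (a : NilHecke K n) : Commute (∑ j ∈ Finset.range n, x K n j) a := by
  induction a using NilHecke.induction with
  | scalar r => exact (Algebra.commutes r _).symm
  | gen g =>
    cases g with
    | x i h =>
      rw [gen_x]
      exact Commute.sum_left _ _ _ fun j _ => x_mul_x j i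
    | t i h =>
      rw [gen_t]
      exact (t_mul_sum_x i).symm
  | mul a b ha hb => exact ha.mul_right hb
  | add a b ha hb => exact ha.add_right hb

end Generators

end NilHecke

end TwoRepSl2

end

/-! ### The right action of `H_{N+1}` on a free `H_N[X]`-module. -/

noncomputable section

namespace TwoRepSl2

namespace NilHecke

open Polynomial

section CosetModule

variable (K : Type u) [Field K] (N : ℕ)

/-- The free left `H_N[X]`-module on `N + 1` generators; it models `H_{N+1}` with `X` acting as
`x N` and the `k`-th generator standing for `τ_{N-1} ⋯ τ_k`. -/
abbrev CosetModule : Type u := Fin (N + 1) →₀ (NilHecke K N)[X]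

namespace CosetModule

/-- The `k`-th generator, or zero for `k > N`. -/
def e (k : ℕ) : CosetModule K N := if h : k < N + 1 then Finsupp.single ⟨k, h⟩ 1 else 0

variable {K N}

theorem e_of_lt {k : ℕ} (h : k < N + 1) : e K N k = Finsupp.single ⟨k, h⟩ 1 := dif_pos h

theorem e_of_gt {k : ℕ} (h : N < k) : e K N k = 0 := dif_neg (by omega)

theorem induction {P : CosetModule K N → Prop} (zero : P 0) (add : ∀ v w, P v → P w → P (v + w))
    (smul : ∀ (r : (NilHecke K N)[X]) (k : ℕ), k < N + 1 → P (r • e K N k)) (v : CosetModule K N) :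
    P v := by
  induction v using Finsupp.induction_linear with
  | zero => exact zero
  | add v w hv hw => exact add v w hv hw
  | single k r => simpa [e_of_lt k.2] using smul r k k.2

theorem linearMap_ext {M : Type*} [AddCommMonoid M] [Module ((NilHecke K N)[X]) M]
    {f g : CosetModule K N →ₗ[(NilHecke K N)[X]] M}
    (h : ∀ k, k < N + 1 → f (e K N k) = g (e K N k)) : f = g := by
  refine LinearMap.ext fun v => ?_
  induction v using CosetModule.induction with
  | zero => simp
  | add v w hv hw => rw [map_add, map_add, hv, hw]
  | smul r k hk => rw [map_smul, map_smul, h k hk]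

variable (K N)

/-- The value of right multiplication by `τ j` at the `k`-th generator. -/
def tRow (j k : ℕ) : CosetModule K N :=
  if j = k then 0 else if j + 1 = k then e K N j else if j < k then C (t K N j) • e K N k else
    C (t K N (j - 1)) • e K N k

/-- The value of right multiplication by `x j` at the `k`-th generator. -/
def xRow (j k : ℕ) : CosetModule K N :=
  if j < k then C (x K N j) • e K N k else
    if j = k then (X : (NilHecke K N)[X]) • e K N k - ∑ i ∈ Finset.Ico k N, C (tDown K N i k) • e K N (i + 1) else
      C (x K N (j - 1)) • e K N k + C (tDown K N (j - 1) k) • e K N j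

/-- Right multiplication by `τ j`. -/
def tOp (j : ℕ) : Module.End (NilHecke K N)[X] (CosetModule K N) :=
  Finsupp.linearCombination _ fun k => tRow K N j k

/-- Right multiplication by `x j`. -/
def xOp (j : ℕ) : Module.End (NilHecke K N)[X] (CosetModule K N) :=
  Finsupp.linearCombination _ fun k => xRow K N j k

variable {K N}

theorem tOp_e {j k : ℕ} (h : k < N + 1) : tOp K N j (e K N k) = tRow K N j k := by
  simp [tOp, e_of_lt h]

theorem xOp_e {j k : ℕ} (h : k < N + 1) : xOp K N j (e K N k) = xRow K N j k := by
  simp [xOp, e_of_lt h]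

theorem tOp_self (k : ℕ) : tOp K N k (e K N k) = 0 := by
  by_cases h : k < N + 1
  · simp [tOp_e h, tRow]
  · have h₀ : e K N k = 0 := e_of_gt (by omega)
    simp [h₀]

theorem tOp_pred {k : ℕ} (h : k < N) : tOp K N k (e K N (k + 1)) = e K N k := by
  simp [tOp_e (show k + 1 < N + 1 by omega), tRow]

theorem tOp_of_lt {j k : ℕ} (h : j + 1 < k) :
    tOp K N j (e K N k) = C (t K N j) • e K N k := by
  by_cases hk : k < N + 1
  · rw [tOp_e hk, tRow, if_neg (by omega), if_neg (by omega), if_pos (by omega)]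
  · have h₀ : e K N k = 0 := e_of_gt (by omega)
    simp [h₀]

theorem tOp_of_gt {j k : ℕ} (h : k ≤ j) :
    tOp K N (j + 1) (e K N k) = C (t K N j) • e K N k := by
  by_cases hk : k < N + 1
  · rw [tOp_e hk, tRow, if_neg (by omega), if_neg (by omega), if_neg (by omega), Nat.add_sub_cancel]
  · have h₀ : e K N k = 0 := e_of_gt (by omega)
    simp [h₀]

theorem xOp_of_lt {j k : ℕ} (h : j < k) : xOp K N j (e K N k) = C (x K N j) • e K N k := by
  by_cases hk : k < N + 1
  · rw [xOp_e hk, xRow, if_pos h]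
  · have h₀ : e K N k = 0 := e_of_gt (by omega)
    simp [h₀]

theorem xOp_of_gt {j k : ℕ} (h : k ≤ j) :
    xOp K N (j + 1) (e K N k) =
      C (x K N j) • e K N k + C (tDown K N j k) • e K N (j + 1) := by
  by_cases hk : k < N + 1
  · rw [xOp_e hk, xRow, if_neg (by omega), if_neg (by omega), Nat.add_sub_cancel]
  · have h₁ : e K N k = 0 := e_of_gt (by omega)
    have h₂ : e K N (j + 1) = 0 := e_of_gt (by omega)
    rw [h₁, h₂, map_zero, smul_zero, smul_zero, add_zero]

theorem xOp_self {k : ℕ} (hk : k < N + 1) :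
    xOp K N k (e K N k) =
      (X : (NilHecke K N)[X]) • e K N k - ∑ i ∈ Finset.Ico k N, C (tDown K N i k) • e K N (i + 1) := by
  rw [xOp_e hk, xRow, if_neg (by omega), if_pos rfl]

/-- The corrections in the row of `x_k` have sign `-` and those in the rows of `x_{i+1}` with `i ≥
k` have sign `+`. They are the same terms, so only the scalars survive. -/
theorem sum_xOp_e {k : ℕ} (hk : k < N + 1) :
    ∑ j ∈ Finset.range (N + 1), xOp K N j (e K N k) =
      (C (∑ j ∈ Finset.range N, x K N j) + X) • e K N k := by
  have hk' : k ≤ N := by omega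
  rw [← Finset.sum_range_add_sum_Ico _ hk.le, Finset.sum_eq_sum_Ico_succ_bot hk,
    ← Finset.sum_Ico_add' _ k N 1, xOp_self hk,
    Finset.sum_congr rfl fun j hj => xOp_of_lt (Finset.mem_range.1 hj),
    Finset.sum_congr rfl fun j hj => xOp_of_gt (Finset.mem_Ico.1 hj).1, Finset.sum_add_distrib,
    ← Finset.sum_range_add_sum_Ico _ hk', map_add, add_smul, add_smul, map_sum, map_sum,
    Finset.sum_smul, Finset.sum_smul]
  abel

/-- The ring `H_N[X]` is not commutative, so multiplication by a scalar is linear, and can be moved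
past coefficients, only because this scalar is central. -/
theorem commute_center (r : (NilHecke K N)[X]) :
    Commute (C (∑ j ∈ Finset.range N, x K N j) + X) r := by
  refine Commute.add_left ?_ (commute_X r)
  induction r using Polynomial.induction_on' with
  | add p q hp hq => exact hp.add_right hq
  | monomial n a =>
    rw [← C_mul_X_pow_eq_monomial]
    exact ((commute_sum_x a).map C).mul_right (commute_X_pow _ _).symm

theorem sum_xOp (v : CosetModule K N) :
    ∑ j ∈ Finset.range (N + 1), xOp K N j v = (C (∑ j ∈ Finset.range N, x K N j) + X) • v := by
  induction v using CosetModule.induction with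
  | zero => simp
  | add v w hv hw => simp only [map_add, smul_add, Finset.sum_add_distrib, hv, hw]
  | smul r k hk =>
    simp only [map_smul]
    rw [← Finset.smul_sum, sum_xOp_e hk, smul_smul, smul_smul, (commute_center r).eq]

/-- If the commutators of `f` with all `x_j` but one are known on a vector, the last one is
determined. This is how the long row of `x_k` is bypassed. -/
theorem sum_xOp_comm (f : Module.End (NilHecke K N)[X] (CosetModule K N)) (v : CosetModule K N) :
    ∑ j ∈ Finset.range (N + 1), (xOp K N j (f v) - f (xOp K N j v)) = 0 := by
  rw [Finset.sum_sub_distrib, ← map_sum, sum_xOp, sum_xOp, map_smul, sub_self]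

theorem xOp_xOp_of_lt {j l k : ℕ} (hjl : j < l) (hj : j ≠ k) (hl : l ≠ k) (hN : l ≤ N) :
    xOp K N l (xOp K N j (e K N k)) = xOp K N j (xOp K N l (e K N k)) := by
  obtain ⟨l, rfl⟩ : ∃ m, l = m + 1 := ⟨l - 1, by omega⟩
  rcases lt_or_gt_of_ne hj with hj | hj
  · rcases lt_or_gt_of_ne hl with hl | hl
    · simp only [xOp_of_lt hj, xOp_of_lt hl, map_smul, smul_smul, ← C_mul, x_mul_x j]
    · have h : k ≤ l := by omega
      simp only [xOp_of_lt hj, xOp_of_gt h, xOp_of_lt hjl, map_smul, map_add, smul_add, smul_smul,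
        ← C_mul, x_mul_x j, tDown_mul_x_of_lt (K := K) (n := N) (i := l) (Or.inl hj)]
  · obtain ⟨j, rfl⟩ : ∃ m, j = m + 1 := ⟨j - 1, by omega⟩
    have h : k ≤ l := by omega
    have h' : k ≤ j := by omega
    have h'' : j + 1 ≤ l := by omega
    simp only [xOp_of_gt h, xOp_of_gt h', xOp_of_gt h'', xOp_of_lt hjl, map_smul, map_add, smul_add,
      smul_smul, ← C_mul]
    rw [tDown_mul_x (K := K) (n := N) (i := l) h' (by omega) (by omega),
      tDown_mul_x_of_lt (K := K) (n := N) (i := j) (j := l) (by omega), x_mul_x j, C_add, add_smul]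
    abel

/-- Rows with both indices different from `k` are compared directly; the remaining case is forced by
the central sum. -/
theorem xOp_xOp_e {j l k : ℕ} (hj : j ≤ N) (hl : l ≤ N) (hk : k < N + 1) :
    xOp K N l (xOp K N j (e K N k)) = xOp K N j (xOp K N l (e K N k)) := by
  have good : ∀ j l, j ≤ N → l ≤ N → j ≠ k → l ≠ k →
      xOp K N l (xOp K N j (e K N k)) = xOp K N j (xOp K N l (e K N k)) := by
    intro j l hj hl hjk hlk
    rcases lt_trichotomy j l with h | rfl | h
    · exact xOp_xOp_of_lt h hjk hlk hl
    · rfl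
    · exact (xOp_xOp_of_lt h hlk hjk hj).symm
  -- In the sum of commutators of the `x_j` with `x_l`, all terms with `j ≠ k` vanish by `good`,
  -- hence so does the term `j = k`.
  have bad : ∀ l, l ≤ N → l ≠ k →
      xOp K N k (xOp K N l (e K N k)) = xOp K N l (xOp K N k (e K N k)) := by
    intro l hl hlk
    have h := sum_xOp_comm (xOp K N l) (e K N k)
    rw [Finset.sum_eq_single_of_mem k (Finset.mem_range.2 hk) fun j hj hjk => ?_] at h
    · exact sub_eq_zero.1 h
    · exact sub_eq_zero.2 (good l j hl (by simpa [Nat.lt_succ_iff] using hj) hlk hjk)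
  by_cases hjk : j = k
  · by_cases hlk : l = k
    · rw [hjk, hlk]
    · rw [hjk, bad l hl hlk]
  · by_cases hlk : l = k
    · rw [hlk, bad j hj hjk]
    · exact good j l hj hl hjk hlk

/-- The condition `j ≠ k` excludes the long row. Each position of `i` and `j` relative to `k` is
then either a relation in `H_N` or a rule for moving `τ` past a string. -/
theorem xOp_tOp_of_ne {i j k : ℕ} (hi : i < N) (h₁ : j ≠ i) (h₂ : j ≠ i + 1) (hjk : j ≠ k) :
    xOp K N j (tOp K N i (e K N k)) = tOp K N i (xOp K N j (e K N k)) := by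
  rcases lt_trichotomy (i + 1) k with hik | hik | hik
  · rcases lt_or_gt_of_ne hjk with hj | hj
    · simp only [xOp_of_lt hj, tOp_of_lt hik, map_smul, smul_smul, ← C_mul, t_mul_x h₁ h₂]
    · obtain ⟨j, rfl⟩ : ∃ m, j = m + 1 := ⟨j - 1, by omega⟩
      have hkj : k ≤ j := by omega
      simp only [xOp_of_gt hkj, tOp_of_lt hik, tOp_of_lt (show i + 1 < j + 1 by omega), map_smul,
        map_add, smul_add, smul_smul, ← C_mul]
      rw [t_mul_x (by omega) (by omega), tDown_mul_t_comm (Or.inl hik)]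
  · subst hik
    rw [tOp_pred hi]
    rcases lt_or_gt_of_ne hjk with hj | hj
    · rw [xOp_of_lt hj, xOp_of_lt (by omega), map_smul, tOp_pred hi]
    · obtain ⟨j, rfl⟩ : ∃ m, j = m + 1 := ⟨j - 1, by omega⟩
      rw [xOp_of_gt (by omega), xOp_of_gt (by omega), map_add, map_smul, map_smul, tOp_pred hi,
        tOp_of_lt (by omega), smul_smul, ← C_mul, tDown_mul_t_pred (by omega)]
  · rcases eq_or_lt_of_le (show k ≤ i by omega) with rfl | hik
    · rw [tOp_self, map_zero]
      rcases lt_or_gt_of_ne hjk with hj | hj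
      · rw [xOp_of_lt hj, map_smul, tOp_self, smul_zero]
      · obtain ⟨j, rfl⟩ : ∃ m, j = m + 1 := ⟨j - 1, by omega⟩
        rw [xOp_of_gt (by omega), map_add, map_smul, map_smul, tOp_self, smul_zero, zero_add,
          tOp_of_lt (by omega), smul_smul, ← C_mul, tDown_mul_t_self (by omega), C_0, zero_smul]
    · obtain ⟨i, rfl⟩ : ∃ m, i = m + 1 := ⟨i - 1, by omega⟩
      have hki : k ≤ i := by omega
      rcases lt_or_gt_of_ne hjk with hj | hj
      · simp only [xOp_of_lt hj, tOp_of_gt hki, map_smul, smul_smul, ← C_mul,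
          t_mul_x (K := K) (n := N) (i := i) (j := j) (by omega) (by omega)]
      · obtain ⟨j, rfl⟩ : ∃ m, j = m + 1 := ⟨j - 1, by omega⟩
        have hkj : k ≤ j := by omega
        simp only [xOp_of_gt hkj, tOp_of_gt hki, map_smul, map_add, smul_add, smul_smul, ← C_mul]
        rw [t_mul_x (by omega) (by omega)]
        congr 1
        rcases lt_or_gt_of_ne h₁ with h | h
        · rw [tOp_of_gt (show j + 1 ≤ i by omega), smul_smul, ← C_mul, tDown_mul_t_comm (by omega)]
        · rw [tOp_of_lt (by omega), smul_smul, ← C_mul, tDown_mul_t hki (by omega)]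

theorem xOp_succ_tOp_of_ne {i k : ℕ} (hi : i < N) (hik : i ≠ k) :
    xOp K N (i + 1) (tOp K N i (e K N k)) - tOp K N i (xOp K N i (e K N k)) = e K N k := by
  rcases lt_trichotomy (i + 1) k with h | rfl | h
  · by_cases hk : k < N + 1
    · rw [tOp_of_lt h, map_smul, xOp_of_lt h, xOp_of_lt (show i < k by omega), map_smul, tOp_of_lt h,
        smul_smul, smul_smul, ← C_mul, ← C_mul, t_mul_x_succ (by omega), C_add, add_smul, C_1, one_smul,
        add_sub_cancel_left]
    · have h₀ : e K N k = 0 := e_of_gt (by omega)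
      simp [h₀]
  · rw [tOp_pred hi, xOp_of_gt le_rfl, xOp_of_lt (by omega), map_smul, tOp_pred hi,
      tDown_of_le le_rfl, C_1, one_smul, add_sub_cancel_left]
  · obtain ⟨i, rfl⟩ : ∃ m, i = m + 1 := ⟨i - 1, by omega⟩
    have hki : k ≤ i := by omega
    rw [tOp_of_gt hki, map_smul, xOp_of_gt (by omega), xOp_of_gt hki, map_add, map_smul, map_smul,
      tOp_of_gt hki, tOp_self, smul_add, smul_zero, add_zero, smul_smul, smul_smul, smul_smul, ← C_mul,
      ← C_mul, ← C_mul, tDown_succ hki, ← mul_assoc, t_mul_self, zero_mul, C_0, zero_smul, add_zero,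
      t_mul_x_succ hi, C_add, add_smul, C_1, one_smul, add_sub_cancel_left]

theorem xOp_self_tOp_of_ne {i k : ℕ} (hi : i < N) (hik : i + 1 ≠ k) :
    xOp K N i (tOp K N i (e K N k)) - tOp K N i (xOp K N (i + 1) (e K N k)) = -e K N k := by
  rcases lt_or_gt_of_ne hik with h | h
  · by_cases hk : k < N + 1
    · rw [tOp_of_lt h, map_smul, xOp_of_lt h, xOp_of_lt (show i < k by omega), map_smul, tOp_of_lt h,
        smul_smul, smul_smul, ← C_mul, ← C_mul, t_mul_x_self (by omega), C_sub, sub_smul, C_1, one_smul]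
      abel
    · have h₀ : e K N k = 0 := e_of_gt (by omega)
      simp [h₀]
  · rcases eq_or_lt_of_le (show k ≤ i by omega) with rfl | h'
    · rw [tOp_self, map_zero, xOp_of_gt le_rfl, map_add, map_smul, tOp_self, smul_zero, map_smul,
        tOp_pred hi, tDown_of_le le_rfl, C_1, one_smul, zero_add, zero_sub]
    · obtain ⟨i, rfl⟩ : ∃ m, i = m + 1 := ⟨i - 1, by omega⟩
      have hki : k ≤ i := by omega
      rw [tOp_of_gt hki, map_smul, xOp_of_gt hki, xOp_of_gt (show k ≤ i + 1 by omega), map_add,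
        map_smul, map_smul, tOp_of_gt hki, tOp_pred hi, smul_add, smul_smul, smul_smul, smul_smul,
        ← C_mul, ← C_mul, ← C_mul, tDown_succ hki, t_mul_x_self hi, C_sub, sub_smul, C_1, one_smul]
      abel

theorem sub_add_sub_comm' {A : Type*} [AddCommGroup A] (a b c d : A) :
    (c - d) + (a - b) = (c - b) + (a - d) := by abel

theorem sub_add_sub_swap {A : Type*} [AddCommGroup A] {a b c d : A} (h : (a - b) + (c - d) = 0) :
    (c - b) + (a - d) = 0 := by
  rw [← h]; abel

/-- For each `k` exactly one of the relations between `τ_i` and the dots would need the long row: a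
mixed one if `k` is `i` or `i + 1`, and otherwise the commutation with `x_k`. The other relations
together with the vanishing sum of commutators imply it. -/
theorem tx_relations {i k : ℕ} (hi : i < N) (hk : k < N + 1) :
    (∀ j, j < N + 1 → j ≠ i → j ≠ i + 1 →
      xOp K N j (tOp K N i (e K N k)) = tOp K N i (xOp K N j (e K N k))) ∧
    xOp K N (i + 1) (tOp K N i (e K N k)) - tOp K N i (xOp K N i (e K N k)) = e K N k ∧
    xOp K N i (tOp K N i (e K N k)) - tOp K N i (xOp K N (i + 1) (e K N k)) = -e K N k := by
  have hsum := sum_xOp_comm (tOp K N i) (e K N k)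
  by_cases hki : k = i ∨ k = i + 1
  · have h0 : ∀ j, j ≠ i → j ≠ i + 1 →
        xOp K N j (tOp K N i (e K N k)) = tOp K N i (xOp K N j (e K N k)) :=
      fun j h₁ h₂ => xOp_tOp_of_ne hi h₁ h₂ (by omega)
    -- Only the commutators with `x_i` and `x_{i+1}` remain in the sum; rearranged, they add up the
    -- two mixed relations, one of which is known.
    rw [Finset.sum_eq_add_of_mem i (i + 1) (by simp; omega) (by simpa using hi) (by omega)
      (fun j _ hj => sub_eq_zero.2 (h0 j hj.1 hj.2))] at hsum
    refine ⟨fun j _ => h0 j, ?_⟩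
    rcases hki with rfl | rfl
    · have h := xOp_self_tOp_of_ne (K := K) (k := k) hi (by omega)
      exact ⟨(add_left_injective _).eq_iff.1 ((sub_add_sub_swap hsum).trans
        ((neg_add_cancel _).symm.trans (by rw [h, add_comm]))), h⟩
    · have h := xOp_succ_tOp_of_ne (K := K) (k := i + 1) hi (by omega)
      exact ⟨h, (add_left_injective _).eq_iff.1 (((add_comm _ _).trans (sub_add_sub_swap hsum)).trans
        ((neg_add_cancel _).symm.trans (by rw [h])))⟩
  · rw [not_or] at hki
    have h₁ := xOp_succ_tOp_of_ne (K := K) (k := k) hi (by omega)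
    have h₂ := xOp_self_tOp_of_ne (K := K) (k := k) hi (by omega)
    refine ⟨fun j hj hji hji' => ?_, h₁, h₂⟩
    by_cases hjk : j = k
    · subst hjk
      -- Three commutators remain here, and the two with `x_i` and `x_{i+1}` cancel by the mixed
      -- relations.
      have hf : ∀ l ∈ Finset.range (N + 1), xOp K N l (tOp K N i (e K N j)) -
          tOp K N i (xOp K N l (e K N j)) =
          (if l = i then xOp K N i (tOp K N i (e K N j)) - tOp K N i (xOp K N i (e K N j)) else 0) +
          (if l = i + 1 then xOp K N (i + 1) (tOp K N i (e K N j)) -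
            tOp K N i (xOp K N (i + 1) (e K N j)) else 0) +
          (if l = j then xOp K N j (tOp K N i (e K N j)) - tOp K N i (xOp K N j (e K N j)) else 0) := by
        intro l _
        by_cases a : l = i
        · subst a; simp [Ne.symm hji]
        · by_cases b : l = i + 1
          · subst b; simp [Ne.symm hji']
          · by_cases c : l = j
            · subst c; simp [hji, hji']
            · simp [a, b, c, xOp_tOp_of_ne hi a b c]
      rw [Finset.sum_congr rfl hf, Finset.sum_add_distrib, Finset.sum_add_distrib,
        Finset.sum_ite_eq', Finset.sum_ite_eq', Finset.sum_ite_eq', if_pos (by simp; omega),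
        if_pos (by simpa using hi), if_pos (by simpa using hk)] at hsum
      have h12 : xOp K N i (tOp K N i (e K N j)) - tOp K N i (xOp K N i (e K N j)) +
          (xOp K N (i + 1) (tOp K N i (e K N j)) - tOp K N i (xOp K N (i + 1) (e K N j))) = 0 := by
        refine (add_comm _ _).trans ((sub_add_sub_comm' _ _ _ _).trans ?_)
        rw [h₁, h₂, add_neg_cancel]
      rw [h12, zero_add] at hsum
      exact sub_eq_zero.1 hsum
    · exact xOp_tOp_of_ne hi hji hji' hjk

theorem tOp_tOp_self {i k : ℕ} (hi : i < N) (hk : k < N + 1) :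
    tOp K N i (tOp K N i (e K N k)) = 0 := by
  rcases lt_trichotomy (i + 1) k with h | rfl | h
  · rw [tOp_of_lt h, map_smul, tOp_of_lt h, smul_smul, ← C_mul, t_mul_self, C_0, zero_smul]
  · rw [tOp_pred hi, tOp_self]
  · rcases eq_or_lt_of_le (show k ≤ i by omega) with rfl | h'
    · rw [tOp_self, map_zero]
    · obtain ⟨i, rfl⟩ : ∃ m, i = m + 1 := ⟨i - 1, by omega⟩
      have hki : k ≤ i := by omega
      rw [tOp_of_gt hki, map_smul, tOp_of_gt hki, smul_smul, ← C_mul, t_mul_self, C_0, zero_smul]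

theorem tOp_tOp_comm {i j k : ℕ} (hij : i + 1 < j) (hj : j < N) (hk : k < N + 1) :
    tOp K N j (tOp K N i (e K N k)) = tOp K N i (tOp K N j (e K N k)) := by
  obtain ⟨j, rfl⟩ : ∃ m, j = m + 1 := ⟨j - 1, by omega⟩
  rcases lt_trichotomy (i + 1) k with h | rfl | h
  · rcases lt_trichotomy (j + 2) k with h' | rfl | h'
    · rw [tOp_of_lt h, map_smul, tOp_of_lt h', map_smul, tOp_of_lt h, smul_smul, smul_smul, ← C_mul,
        ← C_mul, t_mul_t hij]
    · rw [tOp_of_lt h, map_smul, tOp_pred hj, tOp_of_lt (by omega)]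
    · rcases eq_or_lt_of_le (show k ≤ j + 1 by omega) with rfl | h''
      · rw [tOp_of_lt h, map_smul, tOp_self, map_zero, smul_zero]
      · rw [tOp_of_lt h, map_smul, tOp_of_gt (by omega), map_smul, tOp_of_lt h, smul_smul, smul_smul,
          ← C_mul, ← C_mul, t_mul_t (by omega)]
  · rw [tOp_pred (by omega), tOp_of_gt (by omega), tOp_of_gt (by omega), map_smul, tOp_pred (by omega)]
  · rcases eq_or_lt_of_le (show k ≤ i by omega) with rfl | h'
    · rw [tOp_self, map_zero, tOp_of_gt (by omega), map_smul, tOp_self, smul_zero]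
    · obtain ⟨i, rfl⟩ : ∃ m, i = m + 1 := ⟨i - 1, by omega⟩
      rw [tOp_of_gt (by omega), map_smul, tOp_of_gt (by omega), map_smul, tOp_of_gt (by omega),
        smul_smul, smul_smul, ← C_mul, ← C_mul, t_mul_t (by omega)]

/-- For `k` outside `i, i + 1, i + 2` this is the braid relation in `H_N`. For `k = i` and `k = i +
1` both sides vanish, and for `k = i + 2` both equal `τ_i` times the `i`-th generator. -/
theorem tOp_braid {i k : ℕ} (hi : i + 1 < N) (hk : k < N + 1) :
    tOp K N (i + 1) (tOp K N i (tOp K N (i + 1) (e K N k))) =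
      tOp K N i (tOp K N (i + 1) (tOp K N i (e K N k))) := by
  rcases lt_trichotomy (i + 2) k with h | rfl | h
  · have h' : i + 1 < k := by omega
    simp only [tOp_of_lt h, tOp_of_lt h', map_smul, smul_smul, ← C_mul]
    rw [t_braid]
  · rw [tOp_pred hi, tOp_pred (by omega), tOp_of_gt le_rfl, tOp_of_lt (by omega), map_smul, map_smul,
      tOp_pred hi, tOp_pred (by omega)]
  · rcases eq_or_lt_of_le (show k ≤ i + 1 by omega) with rfl | h'
    · rw [tOp_self, map_zero, map_zero, tOp_pred (by omega), tOp_of_gt le_rfl, map_smul, tOp_self,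
        smul_zero]
    · rcases eq_or_lt_of_le (show k ≤ i by omega) with rfl | h''
      · rw [tOp_of_gt le_rfl, map_smul, map_smul, tOp_self]
        simp only [map_zero, smul_zero]
      · obtain ⟨i, rfl⟩ : ∃ m, i = m + 1 := ⟨i - 1, by omega⟩
        have h₁ : k ≤ i := by omega
        have h₂ : k ≤ i + 1 := by omega
        simp only [tOp_of_gt h₁, tOp_of_gt h₂, map_smul, smul_smul, ← C_mul]
        rw [t_braid]

variable (K N) in
/-- Right multiplication by the generators of `H_{N+1}`. -/
def genOp : Gen (N + 1) → (Module.End (NilHecke K N)[X] (CosetModule K N))ᵐᵒᵖ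
  | .x i _ => .op (xOp K N i)
  | .t i _ => .op (tOp K N i)

/-- Right multiplication reverses products, hence the opposite ring; linearity over `H_N[X]` reduces
each relation to its value on the generators. -/
theorem genOp_rel {a b : FreeAlgebra K (Gen (N + 1))} (h : Rel K (N + 1) a b) :
    FreeAlgebra.lift K (genOp K N) a = FreeAlgebra.lift K (genOp K N) b := by
  apply MulOpposite.unop_injective
  refine linearMap_ext fun k hk => ?_
  cases h <;> simp only [map_mul, map_sub, map_neg, map_one, map_zero, FreeAlgebra.lift_ι_apply, genOp,
    MulOpposite.unop_mul, MulOpposite.unop_sub, MulOpposite.unop_neg, MulOpposite.unop_one,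
    MulOpposite.unop_zero, MulOpposite.unop_op, Module.End.mul_apply, LinearMap.sub_apply,
    LinearMap.neg_apply, Module.End.one_apply, LinearMap.zero_apply]
  case x_x i j hi hj => exact xOp_xOp_e (by omega) (by omega) hk
  case t_x i j hi hj h₁ h₂ => exact (tx_relations (by omega) hk).1 j hj h₁ h₂
  case t_x_succ i hi => exact (tx_relations (by omega) hk).2.1
  case t_x_self i hi => exact (tx_relations (by omega) hk).2.2
  case t_t i j hi hj h => exact tOp_tOp_comm h (by omega) hk
  case t_sq i hi => exact tOp_tOp_self (by omega) hk
  case braid i hi => exact tOp_braid (by omega) hk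

variable (K N) in
/-- Right multiplication by elements of `H_{N+1}`. -/
def act : NilHecke K (N + 1) →ₐ[K] (Module.End (NilHecke K N)[X] (CosetModule K N))ᵐᵒᵖ :=
  RingQuot.liftAlgHom K ⟨FreeAlgebra.lift K (genOp K N), fun _ _ h => genOp_rel h⟩

theorem act_gen (g : Gen (N + 1)) : act K N (gen K g) = genOp K N g := by
  refine (RingQuot.liftAlgHom_mkAlgHom_apply (S := K) _ _ _).trans ?_
  simp

end CosetModule

end CosetModule

end NilHecke

end TwoRepSl2

end

/-! ### The PBW theorem: `H_{N+1}` as a free module over `H_N[X]`. -/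

noncomputable section

namespace TwoRepSl2

namespace NilHecke

open Polynomial

section PBW

variable {K : Type u} [Field K] {N : ℕ}

theorem commute_incl_x (a : NilHecke K N) : Commute (incl K N a) (x K (N + 1) N) := by
  induction a using NilHecke.induction with
  | scalar r => rw [AlgHom.commutes]; exact Algebra.commutes r _
  | gen g =>
    cases g with
    | x i h => rw [gen_x, incl_x h]; exact x_mul_x _ _
    | t i h => rw [gen_t, incl_t h]; exact t_mul_x (by omega) (by omega)
  | mul a b ha hb => rw [map_mul]; exact ha.mul_left hb
  | add a b ha hb => rw [map_add]; exact ha.add_left hb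

variable (K N) in
/-- The ring homomorphism `H_N[X] → H_{N+1}` that sends `X` to `x N`. -/
def evalLast : (NilHecke K N)[X] →+* NilHecke K (N + 1) :=
  eval₂RingHom' (incl K N).toRingHom (x K (N + 1) N) commute_incl_x

@[simp]
theorem evalLast_C (a : NilHecke K N) : evalLast K N (C a) = incl K N a :=
  eval₂_C (incl K N).toRingHom (x K (N + 1) N)

@[simp]
theorem evalLast_X : evalLast K N X = x K (N + 1) N :=
  eval₂_X (incl K N).toRingHom (x K (N + 1) N)

namespace CosetModule

variable (K N) in
/-- The map to `H_{N+1}` that sends the `k`-th generator to `τ_{N-1} ⋯ τ_k`. -/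
def toHecke : CosetModule K N →+ NilHecke K (N + 1) :=
  Finsupp.liftAddHom fun k => (AddMonoidHom.mulRight (tDown K (N + 1) N k)).comp
    (evalLast K N : (NilHecke K N)[X] →+ NilHecke K (N + 1))

theorem toHecke_smul_e (r : (NilHecke K N)[X]) {k : ℕ} (hk : k < N + 1) :
    toHecke K N (r • e K N k) = evalLast K N r * tDown K (N + 1) N k := by
  simp [toHecke, e_of_lt hk]

theorem toHecke_e {k : ℕ} (hk : k < N + 1) : toHecke K N (e K N k) = tDown K (N + 1) N k := by
  simpa using toHecke_smul_e 1 hk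

theorem toHecke_smul (r : (NilHecke K N)[X]) (v : CosetModule K N) :
    toHecke K N (r • v) = evalLast K N r * toHecke K N v := by
  induction v using CosetModule.induction with
  | zero => simp
  | add v w hv hw => rw [smul_add, map_add, map_add, hv, hw, mul_add]
  | smul s k hk => rw [smul_smul, toHecke_smul_e _ hk, toHecke_smul_e _ hk, map_mul, mul_assoc]

theorem toHecke_xOp {j : ℕ} (hj : j < N + 1) (v : CosetModule K N) :
    toHecke K N (xOp K N j v) = toHecke K N v * x K (N + 1) j := by
  induction v using CosetModule.induction with
  | zero => simp
  | add v w hv hw => rw [map_add, map_add, map_add, hv, hw, add_mul]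
  | smul s k hk =>
    rw [map_smul, toHecke_smul, toHecke_smul, mul_assoc]
    congr 1
    rw [toHecke_e hk]
    rcases lt_trichotomy j k with h | rfl | h
    · rw [xOp_of_lt h, toHecke_smul_e _ hk, evalLast_C, incl_x (by omega),
        tDown_mul_x_of_lt (Or.inl h)]
    · rw [xOp_self hk, map_sub, toHecke_smul_e _ hk, evalLast_X, map_sum,
        tDown_mul_x_self (by omega) (by omega)]
      congr 1
      refine Finset.sum_congr rfl fun i hi => ?_
      rw [Finset.mem_Ico] at hi
      rw [toHecke_smul_e _ (by omega), evalLast_C, incl_tDown (by omega)]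
    · obtain ⟨j, rfl⟩ : ∃ m, j = m + 1 := ⟨j - 1, by omega⟩
      rw [xOp_of_gt (by omega), map_add, toHecke_smul_e _ hk, toHecke_smul_e _ (by omega), evalLast_C,
        evalLast_C, incl_x (by omega), incl_tDown (by omega),
        tDown_mul_x (by omega) (by omega) (by omega)]

theorem toHecke_tOp {j : ℕ} (hj : j < N) (v : CosetModule K N) :
    toHecke K N (tOp K N j v) = toHecke K N v * t K (N + 1) j := by
  induction v using CosetModule.induction with
  | zero => simp
  | add v w hv hw => rw [map_add, map_add, map_add, hv, hw, add_mul]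
  | smul s k hk =>
    rw [map_smul, toHecke_smul, toHecke_smul, mul_assoc]
    congr 1
    rw [toHecke_e hk]
    rcases lt_trichotomy (j + 1) k with h | rfl | h
    · rw [tOp_of_lt h, toHecke_smul_e _ hk, evalLast_C, incl_t (by omega),
        tDown_mul_t_comm (Or.inl h)]
    · rw [tOp_pred hj, toHecke_e (by omega), tDown_mul_t_pred hj]
    · rcases eq_or_lt_of_le (show k ≤ j by omega) with rfl | h'
      · rw [tOp_self, map_zero, tDown_mul_t_self hj]
      · obtain ⟨j, rfl⟩ : ∃ m, j = m + 1 := ⟨j - 1, by omega⟩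
        rw [tOp_of_gt (by omega), toHecke_smul_e _ hk, evalLast_C, incl_t (by omega),
          tDown_mul_t (by omega) hj]

/-- The rows of `xOp` and `tOp` were modelled on the rules for strings, so the map to `H_{N+1}`
intertwines them with honest right multiplication. -/
theorem toHecke_act (h : NilHecke K (N + 1)) (v : CosetModule K N) :
    toHecke K N ((act K N h).unop v) = toHecke K N v * h := by
  induction h using NilHecke.induction generalizing v with
  | scalar r =>
    have hr : (act K N (algebraMap K _ r)).unop v = C (algebraMap K (NilHecke K N) r) • v := by
      rw [AlgHom.commutes, MulOpposite.algebraMap_apply, MulOpposite.unop_op,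
        Module.algebraMap_end_apply, ← algebraMap_smul ((NilHecke K N)[X]) r v]
      rfl
    rw [hr, toHecke_smul, evalLast_C, AlgHom.commutes, Algebra.commutes]
  | gen g =>
    rw [act_gen]
    cases g with
    | x i h => rw [gen_x]; exact toHecke_xOp h v
    | t i h => rw [gen_t]; exact toHecke_tOp (by omega) v
  | mul a b ha hb =>
    rw [map_mul, MulOpposite.unop_mul, Module.End.mul_apply, hb, ha, mul_assoc]
  | add a b ha hb =>
    rw [map_add, MulOpposite.unop_add, LinearMap.add_apply, map_add, ha, hb, mul_add]

variable (K N) in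
/-- The expansion of an element of `H_{N+1}` in the elements `τ_{N-1} ⋯ τ_k`. -/
def ofHecke : NilHecke K (N + 1) →ₗ[K] CosetModule K N where
  toFun h := (act K N h).unop (e K N N)
  map_add' a b := by simp
  map_smul' r a := by simp

theorem ofHecke_mul (a b : NilHecke K (N + 1)) :
    ofHecke K N (a * b) = (act K N b).unop (ofHecke K N a) := by
  simp [ofHecke]

/-- The last generator stands for the empty string, that is for `1`, so acting on it by `h` and
mapping back returns `h`. -/
theorem toHecke_ofHecke (h : NilHecke K (N + 1)) : toHecke K N (ofHecke K N h) = h := by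
  refine (toHecke_act h _).trans ?_
  rw [toHecke_e (by omega), tDown_of_le le_rfl, one_mul]

theorem ofHecke_one : ofHecke K N 1 = e K N N := by
  simp [ofHecke]

theorem act_x {j : ℕ} (hj : j < N + 1) : (act K N (x K (N + 1) j)).unop = xOp K N j := by
  rw [← gen_x hj, act_gen]; rfl

theorem act_t {j : ℕ} (hj : j < N) : (act K N (t K (N + 1) j)).unop = tOp K N j := by
  rw [← gen_t (show j + 1 < N + 1 by omega), act_gen]; rfl

/-- Generators of `H_N` act on the last generator through the rows with `j < k`, which are
multiplications by scalars. -/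
theorem ofHecke_incl (a : NilHecke K N) : ofHecke K N (incl K N a) = (C a : (NilHecke K N)[X]) • e K N N := by
  induction a using NilHecke.induction with
  | scalar r =>
    rw [AlgHom.commutes, Algebra.algebraMap_eq_smul_one, map_smul, ofHecke_one,
      ← algebraMap_smul ((NilHecke K N)[X]) r (e K N N)]
    rfl
  | gen g =>
    cases g with
    | x i h =>
      rw [gen_x, incl_x h, ← one_mul (x K (N + 1) i), ofHecke_mul, ofHecke_one, act_x (by omega),
        xOp_of_lt h]
    | t i h =>
      rw [gen_t, incl_t h, ← one_mul (t K (N + 1) i), ofHecke_mul, ofHecke_one, act_t (by omega),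
        tOp_of_lt h]
  | mul a b ha hb =>
    have hb' : (act K N (incl K N b)).unop (e K N N) = (C b : (NilHecke K N)[X]) • e K N N := hb
    rw [map_mul, ofHecke_mul, ha, map_smul, hb', smul_smul, C_mul]
  | add a b ha hb => rw [map_add, map_add, ha, hb, C_add, add_smul]

theorem ofHecke_evalLast (r : (NilHecke K N)[X]) : ofHecke K N (evalLast K N r) = r • e K N N := by
  induction r using Polynomial.induction_on with
  | C a => rw [evalLast_C, ofHecke_incl]
  | add p q hp hq => rw [map_add, map_add, hp, hq, add_smul]
  | monomial n a ih =>
    rw [pow_succ, ← mul_assoc, map_mul, ofHecke_mul, ih, map_smul, evalLast_X, act_x (by omega),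
      xOp_self (by omega), Finset.Ico_self, Finset.sum_empty, sub_zero, smul_smul]

theorem ofHecke_evalLast_mul (r : (NilHecke K N)[X]) (a : NilHecke K (N + 1)) :
    ofHecke K N (evalLast K N r * a) = r • ofHecke K N a := by
  rw [ofHecke_mul, ofHecke_evalLast, map_smul]
  rfl

theorem ofHecke_incl_mul (b : NilHecke K N) (a : NilHecke K (N + 1)) :
    ofHecke K N (incl K N b * a) = (C b : (NilHecke K N)[X]) • ofHecke K N a := by
  rw [← evalLast_C, ofHecke_evalLast_mul]

/-- The string grows on the right: `τ_k` moves the generator `k + 1` to the generator `k`, starting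
from the empty string at `N`. -/
theorem ofHecke_tDown {k : ℕ} (hk : k ≤ N) : ofHecke K N (tDown K (N + 1) N k) = e K N k := by
  induction hk using Nat.decreasingInduction with
  | self => rw [tDown_of_le le_rfl, ofHecke_one]
  | of_succ k hk ih => rw [← tDown_mul_t_pred hk, ofHecke_mul, ih, act_t hk, tOp_pred hk]

/-- This is the linear independence half of PBW. -/
theorem ofHecke_toHecke (v : CosetModule K N) : ofHecke K N (toHecke K N v) = v := by
  induction v using CosetModule.induction with
  | zero => simp
  | add v w hv hw => rw [map_add, map_add, hv, hw]
  | smul r k hk => rw [toHecke_smul_e r hk, ofHecke_evalLast_mul, ofHecke_tDown (by omega)]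

end CosetModule

end PBW

end NilHecke

end TwoRepSl2

end

/-! ### Calculus in induced modules and the Kang-Kashiwara splitting. -/

noncomputable section

namespace TwoRepSl2

section IndLemmas

variable {K : Type u} [Field K] {n : ℕ} {M : Type u} [AddCommGroup M] [Module K M]
  [Module (NilHecke K n) M]

theorem Ind.add_mk (a b : NilHecke K (n + 1)) (m : M) :
    Ind.mk (a + b) m = Ind.mk a m + Ind.mk b m := by
  unfold Ind.mk
  rw [TensorProduct.add_tmul]
  rfl

theorem Ind.zero_mk (m : M) : Ind.mk (0 : NilHecke K (n + 1)) m = 0 := by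
  unfold Ind.mk
  rw [TensorProduct.zero_tmul]
  rfl

theorem Ind.mk_zero (a : NilHecke K (n + 1)) : Ind.mk a (0 : M) = 0 := by
  unfold Ind.mk
  rw [TensorProduct.tmul_zero]
  rfl

theorem Ind.neg_mk (a : NilHecke K (n + 1)) (m : M) : Ind.mk (-a) m = -Ind.mk a m := by
  rw [eq_neg_iff_add_eq_zero, ← Ind.add_mk, neg_add_cancel, Ind.zero_mk]

theorem Ind.sub_mk (a b : NilHecke K (n + 1)) (m : M) :
    Ind.mk (a - b) m = Ind.mk a m - Ind.mk b m := by
  rw [sub_eq_add_neg, Ind.add_mk, Ind.neg_mk, sub_eq_add_neg]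

theorem Ind.mk_neg (a : NilHecke K (n + 1)) (m : M) : Ind.mk a (-m) = -Ind.mk a m := by
  rw [eq_neg_iff_add_eq_zero, ← Ind.mk_add, neg_add_cancel, Ind.mk_zero]

theorem Ind.mk_sub (a : NilHecke K (n + 1)) (m m' : M) :
    Ind.mk a (m - m') = Ind.mk a m - Ind.mk a m' := by
  rw [sub_eq_add_neg, Ind.mk_add, Ind.mk_neg, sub_eq_add_neg]

theorem Ind.smul_mk' (r : K) (a : NilHecke K (n + 1)) (m : M) :
    Ind.mk (r • a) m = r • Ind.mk a m := by
  unfold Ind.mk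
  rw [TensorProduct.smul_tmul, TensorProduct.tmul_smul]
  rfl

theorem Ind.smul_mk (b a : NilHecke K (n + 1)) (m : M) : b • Ind.mk a m = Ind.mk (b * a) m := rfl

theorem Ind.mul_incl_mk (a : NilHecke K (n + 1)) (h : NilHecke K n) (m : M) :
    Ind.mk (a * incl K n h) m = Ind.mk a (h • m) :=
  (Submodule.Quotient.eq _).2 (Submodule.subset_span ⟨a, h, m, rfl⟩)

theorem Ind.incl_mk (h : NilHecke K n) (m : M) :
    Ind.mk (incl K n h) m = Ind.mk 1 (h • m) := by
  rw [← Ind.mul_incl_mk, one_mul]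

theorem Ind.mk_eq_smul (a : NilHecke K (n + 1)) (m : M) : Ind.mk a m = a • Ind.mk 1 m := by
  rw [Ind.smul_mk, mul_one]

end IndLemmas

section KangKashiwara

open Polynomial NilHecke NilHecke.CosetModule

variable {K : Type u} [Field K] {n : ℕ}

theorem eval₂_eq_evalLast (p : (NilHecke K (n + 1))[X]) :
    p.eval₂ (incl K (n + 1)).toRingHom (xLast K (n + 1)) = evalLast K (n + 1) p := by
  rw [xLast_eq]; rfl

theorem kangKashiwara_mk (a b : NilHecke K (n + 1)) (p : (NilHecke K (n + 1))[X]) :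
    kangKashiwara K n (Ind.mk a (Res.mk n (NilHecke K (n + 1)) b), p) =
      incl K (n + 1) a * tLast K n * incl K (n + 1) b + evalLast K (n + 1) p :=
  congrArg (_ + ·) (eval₂_eq_evalLast p)

theorem kangKashiwara_add
    (p q : Ind K n (Res K n (NilHecke K (n + 1))) × (NilHecke K (n + 1))[X]) :
    kangKashiwara K n (p + q) = kangKashiwara K n p + kangKashiwara K n q := by
  simp only [kangKashiwara, Prod.fst_add, Prod.snd_add, map_add, eval₂_eq_evalLast]
  abel

variable (K n) in
/-- The Kang-Kashiwara map as an additive homomorphism. -/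
def kangKashiwaraHom : Ind K n (Res K n (NilHecke K (n + 1))) × (NilHecke K (n + 1))[X] →+
    NilHecke K (n + 2) :=
  AddMonoidHom.mk' (kangKashiwara K n) kangKashiwara_add

theorem kangKashiwaraHom_mk (a b : NilHecke K (n + 1)) (p : (NilHecke K (n + 1))[X]) :
    kangKashiwaraHom K n (Ind.mk a (Res.mk n (NilHecke K (n + 1)) b), p) =
      incl K (n + 1) a * tLast K n * incl K (n + 1) b + evalLast K (n + 1) p :=
  kangKashiwara_mk a b p

theorem kangKashiwaraHom_zero_left (p : (NilHecke K (n + 1))[X]) :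
    kangKashiwaraHom K n (0, p) = evalLast K (n + 1) p := by
  have h := kangKashiwaraHom_mk (K := K) (n := n) 0 0 p
  rwa [Ind.zero_mk, map_zero, zero_mul, zero_mul, zero_add] at h

theorem xLast_mul_tLast : xLast K (n + 1) * tLast K n = tLast K n * xPrev K n + 1 := by
  rw [xLast_eq, tLast_eq, xPrev_eq, t_mul_x_self (by omega), sub_add_cancel]

theorem tLast_mul_xLast : tLast K n * xLast K (n + 1) = xPrev K n * tLast K n + 1 := by
  rw [xLast_eq, tLast_eq, xPrev_eq, t_mul_x_succ (by omega)]

theorem tLast_mul_self : tLast K n * tLast K n = 0 := by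
  rw [tLast_eq, t_mul_self]

theorem incl_xLast : incl K (n + 1) (xLast K n) = xPrev K n := by
  rw [xLast_eq, incl_x (by omega), xPrev_eq]

theorem incl_mul_xLast (a : NilHecke K n) :
    incl K n a * xLast K n = xLast K n * incl K n a := by
  rw [xLast_eq]; exact commute_incl_x a

/-- The range is visibly stable under `H_{n+1}`. Stability under the last variable holds since
moving it past `τ` produces another `a τ b` and an element of `H_{n+1}`. -/
theorem kangKashiwaraHom_range_evalLast_mul (r : (NilHecke K (n + 1))[X])
    {c : NilHecke K (n + 2)} (hc : c ∈ (kangKashiwaraHom K n).range) :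
    evalLast K (n + 1) r * c ∈ (kangKashiwaraHom K n).range := by
  obtain ⟨⟨u, p⟩, rfl⟩ := hc
  have hsplit : kangKashiwaraHom K n (u, p) =
      kangKashiwaraHom K n (u, 0) + evalLast K (n + 1) p := by
    rw [← kangKashiwaraHom_zero_left, ← map_add]; simp
  rw [hsplit, mul_add, ← map_mul]
  refine AddSubgroup.add_mem _ ?_ ⟨(0, r * p), kangKashiwaraHom_zero_left _⟩
  have hC : ∀ (a : NilHecke K (n + 1)) (c : NilHecke K (n + 2)),
      c ∈ (kangKashiwaraHom K n).range → incl K (n + 1) a * c ∈ (kangKashiwaraHom K n).range := by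
    rintro a _ ⟨⟨u, p⟩, rfl⟩
    refine ⟨(a • u, C a * p), ?_⟩
    have h1 : Res.val (n + 1) (NilHecke K (n + 2)) (tensorEmb K n (a • u)) =
        incl K (n + 1) a * Res.val (n + 1) (NilHecke K (n + 2)) (tensorEmb K n u) :=
      map_smul (tensorEmb K n) a u
    change Res.val (n + 1) (NilHecke K (n + 2)) (tensorEmb K n (a • u)) + _ =
      _ * (Res.val (n + 1) (NilHecke K (n + 2)) (tensorEmb K n u) + _)
    rw [h1, eval₂_eq_evalLast, eval₂_eq_evalLast, map_mul, evalLast_C, mul_add]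
  have hX : ∀ u : Ind K n (Res K n (NilHecke K (n + 1))),
      xLast K (n + 1) * kangKashiwaraHom K n (u, 0) ∈ (kangKashiwaraHom K n).range := by
    intro u
    induction u using Ind.induction with
    | mk a b =>
      refine ⟨(Ind.mk a (Res.mk n _ (xLast K n * Res.val n _ b)), C (a * Res.val n _ b)), ?_⟩
      have h := kangKashiwaraHom_mk a (Res.val n _ b) (0 : (NilHecke K (n + 1))[X])
      rw [kangKashiwaraHom_mk]
      refine Eq.trans ?_ (congrArg (xLast K (n + 1) * ·) h.symm)
      have h2 (A B : NilHecke K (n + 2)) (hA : A * xLast K (n + 1) = xLast K (n + 1) * A) :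
          A * tLast K n * (xPrev K n * B) + A * B = xLast K (n + 1) * (A * tLast K n * B) := by
        have h3 : xLast K (n + 1) * (A * tLast K n * B) = A * (xLast K (n + 1) * tLast K n) * B := by
          rw [← mul_assoc A, hA]; simp only [mul_assoc]
        rw [h3, xLast_mul_tLast]
        noncomm_ring
      rw [map_zero, add_zero, evalLast_C, map_mul, map_mul, incl_xLast]
      exact h2 _ _ (incl_mul_xLast a)
    | add u v hu hv =>
      have : ((u + v, 0) : _ × (NilHecke K (n + 1))[X]) = (u, 0) + (v, 0) := by simp
      rw [this, map_add, mul_add]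
      exact AddSubgroup.add_mem _ hu hv
  have hX' : ∀ c ∈ (kangKashiwaraHom K n).range,
      xLast K (n + 1) * c ∈ (kangKashiwaraHom K n).range := by
    rintro _ ⟨⟨u, p⟩, rfl⟩
    have hsplit : kangKashiwaraHom K n (u, p) =
        kangKashiwaraHom K n (u, 0) + evalLast K (n + 1) p := by
      rw [← kangKashiwaraHom_zero_left, ← map_add]; simp
    rw [hsplit, mul_add]
    refine AddSubgroup.add_mem _ (hX u) ⟨(0, X * p), ?_⟩
    rw [kangKashiwaraHom_zero_left, map_mul, evalLast_X, xLast_eq]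
  -- The element `c` must vary, because the induction on the degree of `r` peels off a factor `X` on
  -- the side of `c`.
  suffices h : ∀ c ∈ (kangKashiwaraHom K n).range,
      evalLast K (n + 1) r * c ∈ (kangKashiwaraHom K n).range from h _ ⟨_, rfl⟩
  induction r using Polynomial.induction_on with
  | C a => intro c hc; rw [evalLast_C]; exact hC a c hc
  | add p q hp hq =>
    intro c hc
    rw [map_add, add_mul]
    exact AddSubgroup.add_mem _ (hp c hc) (hq c hc)
  | monomial m a ih =>
    intro c hc
    rw [pow_succ, ← mul_assoc, map_mul, evalLast_X, ← xLast_eq, mul_assoc]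
    exact ih _ (hX' c hc)

/-- By PBW the strings generate over `H_{n+1}[X]`. The empty one is in the polynomial part, and any
other is `τ_n` times a string of `H_{n+1}`. -/
theorem kangKashiwaraHom_surjective : Function.Surjective (kangKashiwaraHom K n) := by
  rw [← AddMonoidHom.range_eq_top, eq_top_iff]
  rintro c -
  rw [← toHecke_ofHecke c]
  generalize ofHecke K (n + 1) c = v
  induction v using CosetModule.induction with
  | zero => rw [map_zero]; exact AddSubgroup.zero_mem _
  | add v w hv hw => rw [map_add]; exact AddSubgroup.add_mem _ hv hw
  | smul r k hk =>
    rw [toHecke_smul_e r hk]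
    rcases eq_or_lt_of_le (show k ≤ n + 1 by omega) with rfl | h
    · rw [tDown_of_le le_rfl, mul_one]
      exact ⟨(0, r), kangKashiwaraHom_zero_left r⟩
    · refine kangKashiwaraHom_range_evalLast_mul r
        ⟨(Ind.mk 1 (Res.mk n (NilHecke K (n + 1)) (tDown K (n + 1) n k)), 0), ?_⟩
      rw [kangKashiwaraHom_mk, map_one, one_mul, map_zero, add_zero, incl_tDown (by omega), tLast_eq,
        tDown_succ (by omega)]

variable (K n) in
/-- The coefficients in `H_{n+1}[X]` of all but the last generator. -/
def headCoeff : NilHecke K (n + 2) →+ (Fin (n + 1) →₀ (NilHecke K (n + 1))[X]) :=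
  ((Finsupp.lcomapDomain (R := (NilHecke K (n + 1))[X]) (M := (NilHecke K (n + 1))[X]) Fin.castSucc
    (Fin.castSucc_injective (n + 1))).toAddMonoidHom).comp (ofHecke K (n + 1)).toAddMonoidHom

theorem headCoeff_apply (c : NilHecke K (n + 2)) (k : Fin (n + 1)) :
    headCoeff K n c k = ofHecke K (n + 1) c k.castSucc := rfl

theorem headCoeff_incl_mul (b : NilHecke K (n + 1)) (c : NilHecke K (n + 2)) :
    headCoeff K n (incl K (n + 1) b * c) = b • headCoeff K n c := by
  ext1 k
  rw [Finsupp.smul_apply, headCoeff_apply, headCoeff_apply, ofHecke_incl_mul, Finsupp.smul_apply,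
    smul_eq_mul, ← smul_eq_C_mul]

theorem e_last_castSucc (k : Fin (n + 1)) : e K (n + 1) (n + 1) k.castSucc = 0 := by
  rw [e_of_lt (by omega), Finsupp.single_apply, if_neg]
  intro h
  have := congrArg Fin.val h
  have := k.2
  simp at *
  omega

theorem headCoeff_evalLast (p : (NilHecke K (n + 1))[X]) :
    headCoeff K n (evalLast K (n + 1) p) = 0 := by
  ext1 k
  rw [headCoeff_apply, ofHecke_evalLast, Finsupp.smul_apply, e_last_castSucc, smul_zero]
  rfl

/-- Commuting `τ` past a dot only produces errors without `τ`, that is, multiples of the last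
generator. Hence the leading term is `X ^ a` on the generator `n`. -/
theorem ofHecke_tLast_mul_pow (a : ℕ) : ∃ r : (NilHecke K (n + 1))[X],
    ofHecke K (n + 1) (tLast K n * xPrev K n ^ a) =
      (X ^ a : (NilHecke K (n + 1))[X]) • e K (n + 1) n + r • e K (n + 1) (n + 1) := by
  induction a with
  | zero =>
    refine ⟨0, ?_⟩
    rw [pow_zero, mul_one, pow_zero, one_smul, zero_smul, add_zero, ← one_mul (tLast K n), ofHecke_mul,
      ofHecke_one, tLast_eq, act_t (by omega), tOp_pred (by omega)]
  | succ a ih =>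
    obtain ⟨r, hr⟩ := ih
    refine ⟨r * C (x K (n + 1) n) - X ^ a, ?_⟩
    rw [pow_succ, ← mul_assoc, ofHecke_mul, hr, xPrev_eq, act_x (by omega), map_add, map_smul, map_smul,
      xOp_self (by omega), xOp_of_lt (by omega), smul_sub, smul_smul, smul_smul, ← pow_succ, sub_smul]
    simp [tDown_of_le]
    abel

/-- The errors from `ofHecke_tLast_mul_pow` are invisible to `headCoeff`, so the tensors `1 ⊗ x^a
τ_{n-1} ⋯ τ_k` go to independent elements. -/
theorem headCoeff_tLast_mul (a : ℕ) (k : Fin (n + 1)) :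
    headCoeff K n (tLast K n * incl K (n + 1) (xLast K n ^ a * tDown K (n + 1) n k)) =
      Finsupp.single k (X ^ a) := by
  obtain ⟨r, hr⟩ := ofHecke_tLast_mul_pow (K := K) (n := n) a
  -- Right multiplication by a string of `H_{n+1}` preserves the multiples of the last generator and
  -- prolongs the string `τ_n` to `τ_n ⋯ τ_k`.
  have h1 : (act K (n + 1) (incl K (n + 1) (tDown K (n + 1) n k))).unop (e K (n + 1) (n + 1)) =
      (C (tDown K (n + 1) n k) : (NilHecke K (n + 1))[X]) • e K (n + 1) (n + 1) := ofHecke_incl _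
  have h2 : (act K (n + 1) (incl K (n + 1) (tDown K (n + 1) n k))).unop (e K (n + 1) n) =
      e K (n + 1) k := by
    rw [← ofHecke_tDown (show n ≤ n + 1 by omega), ← ofHecke_mul, tDown_succ le_rfl,
      tDown_of_le le_rfl, mul_one, incl_tDown (by omega), ← tDown_succ (by omega),
      ofHecke_tDown (by omega)]
  ext1 l
  rw [map_mul (incl K (n + 1)), map_pow, incl_xLast, ← mul_assoc, headCoeff_apply, ofHecke_mul, hr, map_add, map_smul,
    map_smul, h1, h2, Finsupp.add_apply, Finsupp.smul_apply, Finsupp.smul_apply, Finsupp.smul_apply,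
    e_last_castSucc, smul_zero, smul_zero, add_zero, e_of_lt (by omega), Finsupp.single_apply,
    Finsupp.single_apply]
  simp [Fin.ext_iff]

variable (K n) in
/-- The reconstruction of an element of `H_{n+1} ⊗_{H_n} H_{n+1}` from coefficients. -/
def ofHeadCoeff : (Fin (n + 1) →₀ (NilHecke K (n + 1))[X]) →ₗ[NilHecke K (n + 1)]
    Ind K n (Res K n (NilHecke K (n + 1))) :=
  Finsupp.lsum ℕ fun k => Polynomial.lsum fun a => LinearMap.toSpanSingleton (NilHecke K (n + 1)) _
    (Ind.mk 1 (Res.mk n (NilHecke K (n + 1)) (xLast K n ^ a * tDown K (n + 1) n k)))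

theorem ofHeadCoeff_single (k : Fin (n + 1)) (a : ℕ) :
    ofHeadCoeff K n (Finsupp.single k (X ^ a)) =
      Ind.mk 1 (Res.mk n (NilHecke K (n + 1)) (xLast K n ^ a * tDown K (n + 1) n k)) := by
  rw [ofHeadCoeff, Finsupp.lsum_single, ← monomial_one_right_eq_X_pow, Polynomial.lsum_apply,
    sum_monomial_index _ _ (LinearMap.map_zero _), LinearMap.toSpanSingleton_apply, one_smul]

/-- Left linearity over `H_{n+1}` reduces to `1 ⊗ b`. By PBW for `H_{n+1}`, the element `b` is a
combination of `x^a τ_{n-1} ⋯ τ_k` with coefficients in `H_n`, which cross the tensor sign. -/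
theorem ofHeadCoeff_kangKashiwaraHom (u : Ind K n (Res K n (NilHecke K (n + 1)))) :
    ofHeadCoeff K n (headCoeff K n (kangKashiwaraHom K n (u, 0))) = u := by
  have hadd : ∀ u v : Ind K n (Res K n (NilHecke K (n + 1))),
      ofHeadCoeff K n (headCoeff K n (kangKashiwaraHom K n (u, 0))) = u →
      ofHeadCoeff K n (headCoeff K n (kangKashiwaraHom K n (v, 0))) = v →
      ofHeadCoeff K n (headCoeff K n (kangKashiwaraHom K n (u + v, 0))) = u + v := by
    intro u v hu hv
    have : ((u + v, 0) : _ × (NilHecke K (n + 1))[X]) = (u, 0) + (v, 0) := by simp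
    rw [this, map_add, map_add, map_add, hu, hv]
  have hsmul : ∀ (a b c : NilHecke K (n + 1)),
      ofHeadCoeff K n (headCoeff K n (kangKashiwaraHom K n
        (Ind.mk b (Res.mk n (NilHecke K (n + 1)) c), 0))) = Ind.mk b (Res.mk n _ c) →
      ofHeadCoeff K n (headCoeff K n (kangKashiwaraHom K n
        (Ind.mk (a * b) (Res.mk n (NilHecke K (n + 1)) c), 0))) = Ind.mk (a * b) (Res.mk n _ c) := by
    intro a b c h
    rw [kangKashiwaraHom_mk] at h ⊢
    rw [map_zero, add_zero] at h ⊢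
    rw [map_mul (incl K (n + 1)), mul_assoc, mul_assoc, headCoeff_incl_mul, map_smul, ← mul_assoc, h, Ind.smul_mk]
  induction u using Ind.induction with
  | add u v hu hv => exact hadd u v hu hv
  | mk a b =>
    change ofHeadCoeff K n (headCoeff K n (kangKashiwaraHom K n
      (Ind.mk a (Res.mk n (NilHecke K (n + 1)) (Res.val n _ b)), 0))) =
        Ind.mk a (Res.mk n (NilHecke K (n + 1)) (Res.val n _ b))
    generalize Res.val n (NilHecke K (n + 1)) b = b
    rw [← mul_one a]
    apply hsmul
    rw [← toHecke_ofHecke b]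
    generalize ofHecke K n b = v
    induction v using CosetModule.induction with
    | zero =>
      rw [map_zero, (Res.mk (K := K) n (NilHecke K (n + 1))).map_zero, Ind.mk_zero, Prod.mk_zero_zero,
        map_zero, map_zero, map_zero]
    | add v w hv hw =>
      rw [map_add, map_add, Ind.mk_add]
      exact hadd _ _ hv hw
    | smul r k hk =>
      rw [toHecke_smul_e r hk]
      induction r using Polynomial.induction_on' with
      | add p q hp hq =>
        rw [map_add, add_mul, map_add, Ind.mk_add]
        exact hadd _ _ hp hq
      | monomial m c =>
        -- The coefficient `c` of `H_n` moves to the left factor, where `hsmul` strips it off again.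
        have key : Ind.mk (1 : NilHecke K (n + 1)) (Res.mk (K := K) n (NilHecke K (n + 1))
            (evalLast K n (monomial m c) * tDown K (n + 1) n k)) =
            Ind.mk (incl K n c * 1) (Res.mk (K := K) n (NilHecke K (n + 1))
              (xLast K n ^ m * tDown K (n + 1) n k)) := by
          rw [← C_mul_X_pow_eq_monomial, map_mul (evalLast K n), evalLast_C, map_pow, evalLast_X, ← xLast_eq, mul_one,
            Ind.incl_mk, mul_assoc]
          rfl
        rw [key]
        apply hsmul
        rw [kangKashiwaraHom_mk, map_one, one_mul, map_zero, add_zero,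
          headCoeff_tLast_mul m ⟨k, hk⟩, ofHeadCoeff_single]

/-- The head coefficients kill the polynomial part and determine `u`; the last coefficient then
determines `p`. -/
theorem kangKashiwaraHom_injective : Function.Injective (kangKashiwaraHom K n) := by
  rw [injective_iff_map_eq_zero]
  rintro ⟨u, p⟩ h
  have hsplit : kangKashiwaraHom K n (u, p) =
      kangKashiwaraHom K n (u, 0) + evalLast K (n + 1) p := by
    rw [← kangKashiwaraHom_zero_left, ← map_add]; simp
  rw [hsplit] at h
  have hu : u = 0 := by
    have h1 := congrArg (headCoeff K n) h
    rw [map_add, headCoeff_evalLast, add_zero, map_zero] at h1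
    rw [← ofHeadCoeff_kangKashiwaraHom u, h1, map_zero]
  subst hu
  have hp : ofHecke K (n + 1) (evalLast K (n + 1) p) = 0 := by
    rw [kangKashiwaraHom_zero_left, map_zero, zero_add] at h
    rw [h, map_zero]
  rw [ofHecke_evalLast, e_of_lt (by omega), Finsupp.smul_single, smul_eq_mul, mul_one,
    Finsupp.single_eq_zero] at hp
  rw [hp]
  rfl

theorem kangKashiwara_bijective (n : ℕ) : Function.Bijective (kangKashiwara K n) :=
  ⟨kangKashiwaraHom_injective, kangKashiwaraHom_surjective⟩

end KangKashiwara

end TwoRepSl2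

end

/-! ### The adjunction of induction and restriction, and projectivity. -/

noncomputable section

namespace TwoRepSl2

section Lift

variable {K : Type u} [Field K] {n : ℕ} {M : Type u} [AddCommGroup M] [Module K M]
  [Module (NilHecke K n) M]

/-- A balanced `K`-bilinear map out of `H_{n+1} × M` induces a `K`-linear map out of the induced
module. -/
def Ind.liftₗ {N : Type*} [AddCommGroup N] [Module K N] (β : NilHecke K (n + 1) →ₗ[K] M →ₗ[K] N)
    (hβ : ∀ a h m, β (a * incl K n h) m = β a (h • m)) : Ind K n M →ₗ[K] N :=
  (Submodule.liftQ ((indRel (K := K) n M).restrictScalars K) (TensorProduct.lift β) (by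
    intro z hz
    have hz' : z ∈ indRel (K := K) n M := hz
    unfold indRel at hz'
    rw [LinearMap.mem_ker]
    -- The relations form an `H_{n+1}`-span while the map is only `K`-linear, so vanishing is needed
    -- on every `H_{n+1}`-multiple of a relation.
    refine Submodule.closure_induction (p := fun z _ => TensorProduct.lift β z = 0)
      (map_zero _) (fun y z _ _ hy hz => by rw [_root_.map_add, hy, hz, add_zero]) ?_ hz'
    rintro c _ ⟨a, h, m, rfl⟩
    rw [smul_sub, TensorProduct.smul_tmul', TensorProduct.smul_tmul', map_sub,
      TensorProduct.lift.tmul, TensorProduct.lift.tmul, smul_eq_mul, smul_eq_mul, ← mul_assoc, hβ,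
      sub_self])).comp
    (Submodule.Quotient.restrictScalarsEquiv K (indRel (K := K) n M)).symm.toLinearMap

theorem Ind.liftₗ_mk {N : Type*} [AddCommGroup N] [Module K N]
    (β : NilHecke K (n + 1) →ₗ[K] M →ₗ[K] N)
    (hβ : ∀ a h m, β (a * incl K n h) m = β a (h • m)) (a : NilHecke K (n + 1)) (m : M) :
    Ind.liftₗ β hβ (Ind.mk a m) = β a m := rfl

theorem Ind.hom_ext {N : Type*} [AddCommGroup N] [Module (NilHecke K (n + 1)) N]
    {f g : Ind K n M →ₗ[NilHecke K (n + 1)] N}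
    (h : ∀ m, f (Ind.mk 1 m) = g (Ind.mk 1 m)) : f = g := by
  refine LinearMap.ext fun z => ?_
  induction z using Ind.induction with
  | mk a m => rw [Ind.mk_eq_smul, _root_.map_smul, _root_.map_smul, h]
  | add y z hy hz => rw [_root_.map_add, _root_.map_add, hy, hz]

variable [IsScalarTower K (NilHecke K n) M]
  {N : Type u} [AddCommGroup N] [Module K N] [Module (NilHecke K (n + 1)) N]
  [IsScalarTower K (NilHecke K (n + 1)) N]

/-- The adjunction between induction and restriction. -/
def Ind.lift (f : M →ₗ[NilHecke K n] Res K n N) : Ind K n M →ₗ[NilHecke K (n + 1)] N :=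
  { Ind.liftₗ (N := N) (LinearMap.mk₂ K (fun a m => a • Res.val n N (f m))
      (fun a b m => add_smul _ _ _) (fun r a m => smul_assoc _ _ _)
      (fun a m m' => by rw [_root_.map_add, _root_.map_add, smul_add])
      (fun r a m => by
        rw [LinearMap.map_smul_of_tower, _root_.map_smul, smul_comm]))
      (fun a h m => by
        refine (mul_smul a (incl K n h) (Res.val n N (f m))).trans ?_
        exact congrArg (fun z => a • Res.val n N z) (f.map_smul h m).symm) with
    map_smul' := fun c z => by
      induction z using Ind.induction with
      | mk a m => exact mul_smul c a _
      | add y z hy hz =>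
        simp only [AddHom.toFun_eq_coe, LinearMap.coe_toAddHom, RingHom.id_apply] at hy hz ⊢
        rw [smul_add, _root_.map_add, _root_.map_add, smul_add, hy, hz] }

theorem Ind.lift_mk (f : M →ₗ[NilHecke K n] Res K n N) (a : NilHecke K (n + 1)) (m : M) :
    Ind.lift f (Ind.mk a m) = a • Res.val n N (f m) := rfl

end Lift

section Projective

variable {K : Type u} [Field K] {n : ℕ}

/-- A surjection onto the induced module is split by lifting the unit `m ↦ 1 ⊗ m` through its
restriction and passing to the adjoint map. -/
theorem Ind.projective (M : Type u) [AddCommGroup M] [Module K M] [Module (NilHecke K n) M]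
    [IsScalarTower K (NilHecke K n) M] [Module.Projective (NilHecke K n) M] :
    Module.Projective (NilHecke K (n + 1)) (Ind K n M) := by
  refine Module.Projective.of_lifting_property'' fun f hf => ?_
  let η : M →ₗ[NilHecke K n] Res K n (Ind K n M) :=
    { toFun := fun m => Res.mk n _ (Ind.mk 1 m)
      map_add' := fun m m' => Ind.mk_add 1 m m'
      map_smul' := fun h m => by
        rw [← Ind.incl_mk, Ind.mk_eq_smul]
        rfl }
  obtain ⟨g, hg⟩ := Module.projective_lifting_property (Res.map n f) η hf
  refine ⟨Ind.lift g, Ind.hom_ext fun m => ?_⟩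
  rw [LinearMap.comp_apply, Ind.lift_mk, one_smul]
  exact congrArg (fun φ : M →ₗ[NilHecke K n] Res K n (Ind K n M) => φ m) hg

-- By PBW this module is a finite direct sum of copies of `H_n[X]`, and polynomials are free over
-- `H_n` on the powers of `X`.
open NilHecke.CosetModule Polynomial in
theorem projective_res_self :
    Module.Projective (NilHecke K n) (Res K n (NilHecke K (n + 1))) := by
  let f : NilHecke.CosetModule K n →ₗ[NilHecke K n] Res K n (NilHecke K (n + 1)) :=
    { toFun := fun v => Res.mk (K := K) n _ (toHecke K n v)
      map_add' := fun v w => by rw [map_add, map_add]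
      map_smul' := fun b v => by
        have h : b • v = (C b : (NilHecke K n)[X]) • v := by
          ext1 k
          rw [Finsupp.smul_apply, Finsupp.smul_apply, smul_eq_mul, smul_eq_C_mul]
        rw [h, toHecke_smul, NilHecke.evalLast_C]
        rfl }
  have : Module.Free (NilHecke K n) (NilHecke K n)[X] :=
    Module.Free.of_basis (Polynomial.basisMonomials _)
  exact Module.Projective.of_equiv (LinearEquiv.ofBijective f
    ⟨Function.LeftInverse.injective ofHecke_toHecke, fun h => ⟨ofHecke K n h, toHecke_ofHecke h⟩⟩)

-- A projective `B`-module is a summand of a free one, which is a direct sum of copies of the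
-- projective `A`-module `B`.
open Classical in
theorem projective_tower {A B M : Type*} [Ring A] [Ring B] [AddCommGroup M] [Module A B] [Module A M]
    [Module B M] [IsScalarTower A B B] [IsScalarTower A B M] [Module.Projective A B] [Module.Projective B M] :
    Module.Projective A M := by
  obtain ⟨s, hs⟩ := Module.projective_def'.1 ‹Module.Projective B M›
  have : Module.Projective A (M →₀ B) :=
    Module.Projective.of_equiv (finsuppLequivDFinsupp (ι := M) (M := B) A).symm
  have : IsScalarTower A B (M →₀ B) :=
    ⟨fun a b v => Finsupp.ext fun m => smul_assoc a b (v m)⟩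
  exact Module.Projective.of_split (s.restrictScalars A)
    ((Finsupp.linearCombination B id).restrictScalars A) (LinearMap.ext fun m => LinearMap.congr_fun hs m)

theorem Res.projective (M : Type u) [AddCommGroup M] [Module K M] [Module (NilHecke K (n + 1)) M]
    [IsScalarTower K (NilHecke K (n + 1)) M] [Module.Projective (NilHecke K (n + 1)) M] :
    Module.Projective (NilHecke K n) (Res K n M) := by
  let _ : Module (NilHecke K n) (NilHecke K (n + 1)) :=
    inferInstanceAs (Module (NilHecke K n) (Res K n (NilHecke K (n + 1))))
  let _ : Module (NilHecke K (n + 1)) (Res K n M) := inferInstanceAs (Module (NilHecke K (n + 1)) M)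
  have : IsScalarTower (NilHecke K n) (NilHecke K (n + 1)) (Res K n M) :=
    ⟨fun a b m => mul_smul (incl K n a) b (Res.val n M m)⟩
  have : IsScalarTower (NilHecke K n) (NilHecke K (n + 1)) (NilHecke K (n + 1)) :=
    ⟨fun a b c => mul_assoc (incl K n a) b c⟩
  have : Module.Projective (NilHecke K n) (NilHecke K (n + 1)) := projective_res_self
  have : Module.Projective (NilHecke K (n + 1)) (Res K n M) :=
    inferInstanceAs (Module.Projective (NilHecke K (n + 1)) M)
  exact projective_tower (B := NilHecke K (n + 1))

end Projective

end TwoRepSl2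

end

/-! ### Gradings as eigenspaces of a weight operator. -/

noncomputable section

namespace TwoRepSl2

section Weights

variable {K : Type u} [Field K]

/-- In characteristic `0` the powers of `2` lie in the rational subfield, so they separate the
degrees. -/
theorem two_zpow_injective [CharZero K] : Function.Injective fun j : ℤ => (2 : K) ^ j := by
  intro a b h
  have h' : ((2 : ℚ) ^ a : ℚ) = (2 : ℚ) ^ b := by
    apply Rat.cast_injective (α := K)
    push_cast
    exact h
  exact zpow_right_injective₀ (by norm_num) (by norm_num) h'

/-- Subspaces on which an operator acts with the eigenvalues `2 ^ j` form a grading as soon as they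
span. -/
theorem isInternal_of_weights [CharZero K] {V : Type*} [AddCommGroup V] [Module K V]
    {A : ℤ → Submodule K V} (φ : V →ₗ[K] V) (hφ : ∀ j, ∀ v ∈ A j, φ v = (2 : K) ^ j • v)
    (hA : ⨆ j, A j = ⊤) : DirectSum.IsInternal A := by
  rw [DirectSum.isInternal_submodule_iff_iSupIndep_and_iSup_eq_top]
  refine ⟨?_, hA⟩
  refine ((Module.End.eigenspaces_iSupIndep φ).comp (two_zpow_injective (K := K))).mono fun j v hv => ?_
  exact Module.End.mem_eigenspace_iff.2 (hφ j v hv)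

/-- The converse of `isInternal_of_weights`: a grading provides its operator. It lets gradings be
transported through tensor products as operators. -/
theorem exists_weights {V : Type*} [AddCommGroup V] [Module K V]
    {A : ℤ → Submodule K V} (hA : DirectSum.IsInternal A) :
    ∃ φ : V →ₗ[K] V, ∀ j, ∀ v ∈ A j, φ v = (2 : K) ^ j • v := by
  classical
  refine ⟨(DirectSum.toModule K ℤ V fun j => (2 : K) ^ j • (A j).subtype).comp
    (LinearEquiv.ofBijective (DirectSum.coeLinearMap A) hA).symm.toLinearMap, fun j v hv => ?_⟩
  have h : (LinearEquiv.ofBijective (DirectSum.coeLinearMap A) hA).symm v =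
      DirectSum.lof K ℤ (fun j => A j) j ⟨v, hv⟩ := by
    rw [LinearEquiv.symm_apply_eq]
    exact (DirectSum.coeLinearMap_lof A j ⟨v, hv⟩).symm
  rw [LinearMap.comp_apply, LinearEquiv.coe_coe, h, DirectSum.toModule_lof]
  rfl

theorem iSup_induction_top {V : Type*} [AddCommGroup V] [Module K V] {A : ℤ → Submodule K V}
    (hA : ⨆ j, A j = ⊤) {P : V → Prop} (mem : ∀ j, ∀ v ∈ A j, P v)
    (add : ∀ v w, P v → P w → P (v + w)) (v : V) : P v :=
  Submodule.iSup_induction A (motive := P) (hA ▸ Submodule.mem_top) mem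
    (mem 0 0 (Submodule.zero_mem _)) add

/-- A family of subspaces of the pieces of a grading that spans everything must fill each piece.
This identifies graded pieces from a list of generators. -/
theorem eq_of_le_of_iSup_eq_top {V : Type*} [AddCommGroup V] [Module K V] {A G : ℤ → Submodule K V}
    (hA : DirectSum.IsInternal A) (hle : ∀ j, G j ≤ A j) (hG : ⨆ j, G j = ⊤) (j : ℤ) : A j = G j := by
  rw [DirectSum.isInternal_submodule_iff_iSupIndep_and_iSup_eq_top] at hA
  refine le_antisymm (fun v hv => ?_) (hle j)
  have hsplit : G j ⊔ ⨆ i, ⨆ (_ : i ≠ j), G i = ⊤ := by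
    rw [← hG]
    refine le_antisymm (sup_le (le_iSup G j) (iSup₂_le fun i _ => le_iSup G i)) (iSup_le fun i => ?_)
    by_cases h : i = j
    · rw [h]; exact le_sup_left
    · exact le_sup_of_le_right (le_iSup₂_of_le i h le_rfl)
  obtain ⟨g, hg, h, hh, rfl⟩ := Submodule.mem_sup.1 (hsplit ▸ Submodule.mem_top : v ∈ _)
  have h1 : h ∈ A j := by
    have := Submodule.sub_mem _ hv (hle j hg)
    rwa [add_sub_cancel_left] at this
  have h2 : h ∈ ⨆ i, ⨆ (_ : i ≠ j), A i := iSup₂_mono (fun i _ => hle i) hh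
  have h3 : h = 0 := (Submodule.disjoint_def.1 (hA.1 j)) h h1 h2
  rwa [h3, add_zero]

end Weights

namespace NilHecke

variable {K : Type u} [Field K] {n : ℕ}

theorem gr_one : (1 : NilHecke K n) ∈ gr K n 0 := Submodule.subset_span ⟨[], rfl, rfl⟩

theorem gr_mul {i j : ℤ} {a b : NilHecke K n} (ha : a ∈ gr K n i) (hb : b ∈ gr K n j) :
    a * b ∈ gr K n (i + j) := by
  unfold gr at ha hb
  induction ha using Submodule.span_induction with
  | zero => rw [zero_mul]; exact Submodule.zero_mem _
  | add x y _ _ hx hy => rw [add_mul]; exact Submodule.add_mem _ hx hy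
  | smul r x _ hx => rw [smul_mul_assoc]; exact Submodule.smul_mem _ r hx
  | mem a ha =>
    obtain ⟨l, rfl, rfl⟩ := ha
    induction hb using Submodule.span_induction with
    | zero => rw [mul_zero]; exact Submodule.zero_mem _
    | add x y _ _ hx hy => rw [mul_add]; exact Submodule.add_mem _ hx hy
    | smul r x _ hx => rw [mul_smul_comm]; exact Submodule.smul_mem _ r hx
    | mem b hb =>
      obtain ⟨l', rfl, rfl⟩ := hb
      exact Submodule.subset_span ⟨l ++ l', by simp, by simp⟩

theorem gr_gen (g : Gen n) : gen K g ∈ gr K n g.deg := Submodule.subset_span ⟨[g], by simp, by simp⟩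

theorem gr_pow {i : ℤ} {a : NilHecke K n} (ha : a ∈ gr K n i) (k : ℕ) : a ^ k ∈ gr K n (k * i) := by
  induction k with
  | zero => simpa using gr_one
  | succ k ih =>
    rw [pow_succ]
    have := gr_mul ih ha
    rwa [show (k : ℤ) * i + i = ((k + 1 : ℕ) : ℤ) * i by push_cast; ring] at this

theorem gr_incl {i : ℤ} {a : NilHecke K n} (ha : a ∈ gr K n i) : incl K n a ∈ gr K (n + 1) i := by
  unfold gr at ha
  induction ha using Submodule.span_induction with
  | zero => rw [map_zero]; exact Submodule.zero_mem _
  | add x y _ _ hx hy => rw [map_add]; exact Submodule.add_mem _ hx hy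
  | smul r x _ hx => rw [map_smul]; exact Submodule.smul_mem _ r hx
  | mem a ha =>
    obtain ⟨l, rfl, rfl⟩ := ha
    refine Submodule.subset_span ⟨l.map Gen.succ, ?_, ?_⟩
    · rw [List.map_map]
      congr 2
      funext g
      cases g <;> rfl
    · rw [map_list_prod, List.map_map, List.map_map]
      congr 2
      funext g
      exact (incl_gen g).symm

theorem gr_xLast : xLast K n ∈ gr K (n + 1) 2 :=
  gr_gen (Gen.x n (by omega))

theorem gr_xPrev : xPrev K n ∈ gr K (n + 2) 2 :=
  gr_gen (Gen.x n (by omega))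

theorem gr_tLast : tLast K n ∈ gr K (n + 2) (-2) :=
  gr_gen (Gen.t n (by omega))

theorem iSup_gr : ⨆ i, gr K n i = ⊤ := by
  rw [eq_top_iff]
  rintro a -
  induction a using NilHecke.induction with
  | scalar r =>
    rw [Algebra.algebraMap_eq_smul_one]
    exact Submodule.smul_mem _ r (Submodule.mem_iSup_of_mem 0 gr_one)
  | gen g => exact Submodule.mem_iSup_of_mem _ (gr_gen g)
  | add a b ha hb => exact Submodule.add_mem _ ha hb
  | mul a b ha hb =>
    refine Submodule.iSup_induction (gr K n) (motive := fun a => a * b ∈ ⨆ i, gr K n i) ha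
      (fun i a ha => ?_) (by rw [zero_mul]; exact Submodule.zero_mem _)
      (fun x y hx hy => by rw [add_mul]; exact Submodule.add_mem _ hx hy)
    refine Submodule.iSup_induction (gr K n) (motive := fun b => a * b ∈ ⨆ i, gr K n i) hb
      (fun j b hb => Submodule.mem_iSup_of_mem _ (gr_mul ha hb))
      (by rw [mul_zero]; exact Submodule.zero_mem _)
      (fun x y hx hy => by rw [mul_add]; exact Submodule.add_mem _ hx hy)

/-- All defining relations are homogeneous, so rescaling each generator by `2` to its degree
respects them. -/
theorem weight_rel [CharZero K] {a b : FreeAlgebra K (Gen n)} (h : Rel K n a b) :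
    FreeAlgebra.lift K (fun g : Gen n => (2 : K) ^ g.deg • gen K g) a =
      FreeAlgebra.lift K (fun g : Gen n => (2 : K) ^ g.deg • gen K g) b := by
  have h2 : (2 : K) ≠ 0 := two_ne_zero
  have key := gen_rel h
  cases h <;> simp only [map_mul, map_sub, map_neg, map_one, map_zero, FreeAlgebra.lift_ι_apply,
    Gen.deg, smul_mul_smul_comm, ← zpow_add₀ h2] at key ⊢ <;> norm_num
  case t_x_succ => exact key
  case t_x_self => exact key
  case t_sq => exact key
  all_goals rw [key]

variable (K n) in
/-- The automorphism of `H_n` that multiplies elements of degree `d` by `2 ^ d`. -/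
def weightHom [CharZero K] : NilHecke K n →ₐ[K] NilHecke K n :=
  RingQuot.liftAlgHom K
    ⟨FreeAlgebra.lift K (fun g : Gen n => (2 : K) ^ g.deg • gen K g), fun _ _ h => weight_rel h⟩

theorem weightHom_gen [CharZero K] (g : Gen n) :
    weightHom K n (gen K g) = (2 : K) ^ g.deg • gen K g := by
  refine (RingQuot.liftAlgHom_mkAlgHom_apply (S := K) _ _ _).trans ?_
  simp

theorem weightHom_of_mem [CharZero K] {i : ℤ} {a : NilHecke K n} (ha : a ∈ gr K n i) :
    weightHom K n a = (2 : K) ^ i • a := by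
  unfold gr at ha
  induction ha using Submodule.span_induction with
  | zero => rw [map_zero, smul_zero]
  | add x y _ _ hx hy => rw [map_add, hx, hy, smul_add]
  | smul r x _ hx => rw [map_smul, hx, smul_comm]
  | mem a ha =>
    obtain ⟨l, rfl, rfl⟩ := ha
    induction l with
    | nil => simp
    | cons g l ih =>
      rw [List.map_cons, List.map_cons, List.prod_cons, List.sum_cons, map_mul, ih, weightHom_gen,
        smul_mul_smul_comm, ← zpow_add₀ two_ne_zero]

theorem weightHom_incl [CharZero K] (a : NilHecke K n) :
    weightHom K (n + 1) (incl K n a) = incl K n (weightHom K n a) := by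
  refine iSup_induction_top
    (P := fun a => weightHom K (n + 1) (incl K n a) = incl K n (weightHom K n a)) iSup_gr (fun i a ha => ?_) (fun a b ha hb => ?_) a
  · rw [weightHom_of_mem ha, weightHom_of_mem (gr_incl ha), map_smul]
  · simp only [map_add, ha, hb]

end NilHecke

end TwoRepSl2

end

/-! ### The grading of induced modules and stability of the category. -/

noncomputable section

namespace TwoRepSl2

section Generation

open Polynomial NilHecke

variable {K : Type u} [Field K]

theorem evalLast_monomial {n : ℕ} (k : ℕ) (a : NilHecke K n) :
    evalLast K n (monomial k a) = incl K n a * xLast K n ^ k := by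
  rw [← C_mul_X_pow_eq_monomial, map_mul, map_pow, evalLast_C, evalLast_X, xLast_eq]

theorem mk_incl_mul_pow {n : ℕ} {M : Type u} [AddCommGroup M] [Module K M] [Module (NilHecke K n) M]
    (a : NilHecke K n) (k : ℕ) (m : M) :
    Ind.mk (incl K n a * xLast K n ^ k) m = Ind.mk (xLast K n ^ k) (a • m) := by
  have h : Commute (incl K n a) (xLast K n) := incl_mul_xLast a
  rw [(h.pow_right k).eq, Ind.mul_incl_mk]

/-- Without strands below there are no crossings, and `H_1` is spanned over `H_0` by powers of the
one variable. -/
theorem ind_zero_induction {M : Type u} [AddCommGroup M] [Module K M]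
    [Module (NilHecke K 0) M] {P : Ind K 0 M → Prop}
    (pow : ∀ k m, P (Ind.mk (xLast K 0 ^ k) m))
    (add : ∀ y z, P y → P z → P (y + z)) (z : Ind K 0 M) : P z := by
  have h0 : P 0 := by
    have := pow 0 0
    rwa [Ind.mk_zero] at this
  induction z using Ind.induction with
  | add y z hy hz => exact add y z hy hz
  | mk c m =>
    rw [← CosetModule.toHecke_ofHecke c]
    generalize CosetModule.ofHecke K 0 c = v
    induction v using CosetModule.induction with
    | zero => rw [map_zero, Ind.zero_mk]; exact h0
    | add v w hv hw => rw [map_add, Ind.add_mk]; exact add _ _ hv hw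
    | smul r k hk =>
      obtain rfl : k = 0 := by omega
      rw [CosetModule.toHecke_smul_e r hk, tDown_of_le le_rfl, mul_one]
      induction r using Polynomial.induction_on' with
      | add p q hp hq => rw [map_add, Ind.add_mk]; exact add _ _ hp hq
      | monomial j a =>
        rw [evalLast_monomial, mk_incl_mul_pow]
        exact pow _ _

/-- The Kang-Kashiwara decomposition tensored with `M`: the right factor of `a τ b` and the
coefficients of the powers are absorbed into `m`. -/
theorem ind_succ_induction {n : ℕ} {M : Type u} [AddCommGroup M] [Module K M]
    [Module (NilHecke K (n + 1)) M] {P : Ind K (n + 1) M → Prop}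
    (tau : ∀ (a : NilHecke K (n + 1)) (m : M), P (Ind.mk (incl K (n + 1) a * tLast K n) m))
    (pow : ∀ k m, P (Ind.mk (xLast K (n + 1) ^ k) m))
    (add : ∀ y z, P y → P z → P (y + z)) (z : Ind K (n + 1) M) : P z := by
  have h0 : P 0 := by
    have := pow 0 0
    rwa [Ind.mk_zero] at this
  induction z using Ind.induction with
  | add y z hy hz => exact add y z hy hz
  | mk c m =>
    obtain ⟨⟨u, p⟩, rfl⟩ := kangKashiwaraHom_surjective c
    have hsplit : kangKashiwaraHom K n (u, p) =
        kangKashiwaraHom K n (u, 0) + evalLast K (n + 1) p := by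
      rw [← kangKashiwaraHom_zero_left, ← map_add]; simp
    rw [hsplit, Ind.add_mk]
    refine add _ _ ?_ ?_
    · induction u using Ind.induction with
      | add u v hu hv =>
        have : ((u + v, 0) : _ × (NilHecke K (n + 1))[X]) = (u, 0) + (v, 0) := by simp
        rw [this, map_add, Ind.add_mk]
        exact add _ _ (hu (hsplit := by rw [← kangKashiwaraHom_zero_left, ← map_add]; simp))
          (hv (hsplit := by rw [← kangKashiwaraHom_zero_left, ← map_add]; simp))
      | mk a b =>
        change P (Ind.mk (kangKashiwaraHom K n
          (Ind.mk a (Res.mk n (NilHecke K (n + 1)) (Res.val n _ b)), 0)) m)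
        rw [kangKashiwaraHom_mk, map_zero, add_zero, Ind.mul_incl_mk]
        exact tau _ _
    · induction p using Polynomial.induction_on' with
      | add p q hp hq =>
        rw [map_add, Ind.add_mk]
        exact add _ _ (hp (hsplit := by rw [← kangKashiwaraHom_zero_left, ← map_add]; simp))
          (hq (hsplit := by rw [← kangKashiwaraHom_zero_left, ← map_add]; simp))
      | monomial j a =>
        rw [evalLast_monomial, mk_incl_mul_pow]
        exact pow _ _

variable {n : ℕ} {M : Type u} [AddCommGroup M] [Module K M]

/-- The map `H_{n+1} ⊗_{H_n} M → H_{n+2} ⊗_{H_{n+1}} M`, `a ⊗ m ↦ a c ⊗ m`, for an element `c` that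
commutes with `H_n`. -/
def crossing [Module (NilHecke K (n + 1)) M] [IsScalarTower K (NilHecke K (n + 1)) M]
    (c : NilHecke K (n + 2))
    (hc : ∀ h, c * incl K (n + 1) (incl K n h) = incl K (n + 1) (incl K n h) * c) :
    Ind K n (Res K n M) →ₗ[NilHecke K (n + 1)] Res K (n + 1) (Ind K (n + 1) M) :=
  Ind.lift
    { toFun := fun m => Res.mk (K := K) n _ (Res.mk (K := K) (n + 1) _ (Ind.mk c (Res.val n M m)))
      map_add' := fun m m' => Ind.mk_add c (Res.val n M m) (Res.val n M m')
      map_smul' := fun h m => by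
        change Ind.mk c (incl K n h • Res.val n M m) =
          incl K (n + 1) (incl K n h) • Ind.mk c (Res.val n M m)
        rw [← Ind.mul_incl_mk, hc]
        rfl }

end Generation

section Graded

open NilHecke

variable {K : Type u} [Field K]

/-- Graded modules that are left-bounded and locally finite-dimensional. -/
structure IsGradedModule (n : ℕ) (M : Type u) [AddCommGroup M] [Module K M] [Module (NilHecke K n) M]
    (gr : ℤ → Submodule K M) : Prop where
  isInternal : DirectSum.IsInternal gr
  smul_mem : ∀ (i j : ℤ) (a : NilHecke K n) (m : M),
    a ∈ NilHecke.gr K n i → m ∈ gr j → a • m ∈ gr (i + j)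
  bounded : ∃ b : ℤ, ∀ j < b, gr j = ⊥
  finite : ∀ j, Module.Finite K (gr j)

theorem IsGradedModule.iSup_eq_top {n : ℕ} {M : Type u} [AddCommGroup M] [Module K M]
    [Module (NilHecke K n) M] {gr : ℤ → Submodule K M} (h : IsGradedModule n M gr) :
    ⨆ j, gr j = ⊤ := ((isInternal_iff _).1 h.isInternal).2

theorem IsGradedModule.res {n : ℕ} {M : Type u} [AddCommGroup M] [Module K M]
    [Module (NilHecke K (n + 1)) M] [IsScalarTower K (NilHecke K (n + 1)) M]
    {gr : ℤ → Submodule K M} (h : IsGradedModule (n + 1) M gr) :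
    IsGradedModule n (Res K n M) (fun d => (gr d).comap (Res.val n M)) where
  isInternal := h.isInternal
  smul_mem i j a m ha hm := h.smul_mem i j (incl K n a) (Res.val n M m) (gr_incl ha) hm
  bounded := h.bounded
  finite := h.finite

/-- The tensor product grading of an induced module. -/
def indGr {n : ℕ} {M : Type u} [AddCommGroup M] [Module K M] [Module (NilHecke K n) M]
    (gr : ℤ → Submodule K M) (d : ℤ) : Submodule K (Ind K n M) :=
  Submodule.span K {z : Ind K n M | ∃ (i j : ℤ) (a : NilHecke K (n + 1)) (m : M),
    i + j = d ∧ a ∈ NilHecke.gr K (n + 1) i ∧ m ∈ gr j ∧ z = Ind.mk a m}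

variable {n : ℕ} {M : Type u} [AddCommGroup M] [Module K M] [Module (NilHecke K n) M]
  {gr : ℤ → Submodule K M}

theorem mk_mem_indGr {i j : ℤ} {a : NilHecke K (n + 1)} {m : M}
    (ha : a ∈ NilHecke.gr K (n + 1) i) (hm : m ∈ gr j) : Ind.mk a m ∈ indGr (n := n) gr (i + j) :=
  Submodule.subset_span ⟨i, j, a, m, rfl, ha, hm, rfl⟩

theorem smul_mem_indGr {i j : ℤ} {a : NilHecke K (n + 1)} {z : Ind K n M}
    (ha : a ∈ NilHecke.gr K (n + 1) i) (hz : z ∈ indGr (n := n) gr j) :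
    a • z ∈ indGr (n := n) gr (i + j) := by
  unfold indGr at hz
  induction hz using Submodule.span_induction with
  | zero => rw [smul_zero]; exact Submodule.zero_mem _
  | add x y _ _ hx hy => rw [smul_add]; exact Submodule.add_mem _ hx hy
  | smul r x _ hx => rw [smul_comm]; exact Submodule.smul_mem _ r hx
  | mem z hz =>
    obtain ⟨k, l, b, m, rfl, hb, hm, rfl⟩ := hz
    rw [Ind.smul_mk, ← add_assoc]
    exact mk_mem_indGr (gr_mul ha hb) hm

theorem iSup_indGr (h : ⨆ j, gr j = ⊤) : ⨆ d, indGr (n := n) gr d = ⊤ := by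
  rw [eq_top_iff]
  rintro z -
  induction z using Ind.induction with
  | add y z hy hz => exact Submodule.add_mem _ hy hz
  | mk a m =>
    refine iSup_induction_top (P := fun a => Ind.mk a m ∈ ⨆ d, indGr (n := n) gr d) iSup_gr
      (fun i a ha => ?_) (fun a b ha hb => by rw [Ind.add_mk]; exact Submodule.add_mem _ ha hb) a
    refine iSup_induction_top (P := fun m => Ind.mk a m ∈ ⨆ d, indGr (n := n) gr d) h
      (fun j m hm => ?_) (fun a b ha hb => by rw [Ind.mk_add]; exact Submodule.add_mem _ ha hb) m
    exact Submodule.mem_iSup_of_mem _ (mk_mem_indGr ha hm)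

/-- The operator `a ⊗ m ↦ weight(a) ⊗ φ(m)` acts by `2 ^ d` in degree `d`, so the pieces are
independent; that they span is `iSup_indGr`. -/
theorem isInternal_indGr [CharZero K] [IsScalarTower K (NilHecke K n) M] (h : DirectSum.IsInternal gr)
    (hs : ∀ (i j : ℤ) (a : NilHecke K n) (m : M),
      a ∈ NilHecke.gr K n i → m ∈ gr j → a • m ∈ gr (i + j)) :
    DirectSum.IsInternal (indGr (n := n) gr) := by
  have htop := ((isInternal_iff _).1 h).2
  obtain ⟨φ, hφ⟩ := exists_weights h
  -- This compatibility of the weights of `H_n` and `M` is what makes the operator respect the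
  -- relations of the tensor product.
  have hφs : ∀ (a : NilHecke K n) (m : M), φ (a • m) = weightHom K n a • φ m := by
    intro a m
    refine iSup_induction_top (P := fun a => φ (a • m) = weightHom K n a • φ m) iSup_gr
      (fun i a ha => ?_) (fun a b ha hb => by rw [add_smul, map_add, map_add, ha, hb, add_smul]) a
    refine iSup_induction_top (P := fun m => φ (a • m) = weightHom K n a • φ m) htop
      (fun j m hm => ?_) (fun a b ha hb => by rw [smul_add, map_add, map_add, ha, hb, smul_add]) m
    rw [hφ _ _ (hs i j a m ha hm), hφ j m hm, weightHom_of_mem ha, smul_comm _ (_ : K), smul_assoc,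
      smul_smul, ← zpow_add₀ two_ne_zero, add_comm j i]
  let β : NilHecke K (n + 1) →ₗ[K] M →ₗ[K] Ind K n M := LinearMap.mk₂ K
    (fun a m => Ind.mk (weightHom K (n + 1) a) (φ m))
    (fun a b m => by rw [map_add, Ind.add_mk]) (fun r a m => by rw [map_smul, Ind.smul_mk'])
    (fun a m m' => by rw [map_add, Ind.mk_add]) (fun r a m => by rw [map_smul, Ind.mk_smul])
  refine isInternal_of_weights (Ind.liftₗ β fun a h m => ?_) (fun d z hz => ?_) (iSup_indGr htop)
  · change Ind.mk (weightHom K (n + 1) (a * incl K n h)) (φ m) =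
      Ind.mk (weightHom K (n + 1) a) (φ (h • m))
    rw [map_mul, weightHom_incl, Ind.mul_incl_mk, hφs]
  · unfold indGr at hz
    induction hz using Submodule.span_induction with
    | zero => rw [map_zero, smul_zero]
    | add x y _ _ hx hy => rw [map_add, hx, hy, smul_add]
    | smul r x _ hx => rw [map_smul, hx, smul_comm]
    | mem z hz =>
      obtain ⟨i, j, a, m, rfl, ha, hm, rfl⟩ := hz
      rw [Ind.liftₗ_mk]
      change Ind.mk (weightHom K (n + 1) a) (φ m) = _
      rw [weightHom_of_mem ha, hφ j m hm, Ind.smul_mk', Ind.mk_smul, smul_smul,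
        ← zpow_add₀ two_ne_zero]

/-- The map `m ↦ a ⊗ m`. -/
def mkₗ (a : NilHecke K (n + 1)) : M →ₗ[K] Ind K n M where
  toFun m := Ind.mk a m
  map_add' := Ind.mk_add a
  map_smul' r m := Ind.mk_smul r a m

variable (gr) in
/-- The part of degree `d` of the sum of the subspaces `x_{n+1}^k ⊗ M`. -/
def powGr (d : ℤ) : Submodule K (Ind K n M) :=
  ⨆ k : ℕ, (gr (d - k * 2)).map (mkₗ (xLast K n ^ k))

theorem powGr_le (d : ℤ) : powGr (n := n) gr d ≤ indGr (n := n) gr d := by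
  refine iSup_le fun k => ?_
  rintro _ ⟨m, hm, rfl⟩
  have := mk_mem_indGr (gr := gr) (gr_pow (gr_xLast (K := K) (n := n)) k) hm
  rwa [add_sub_cancel] at this

theorem mk_pow_mem_iSup_powGr (h : ⨆ j, gr j = ⊤) (k : ℕ) (m : M) :
    Ind.mk (xLast K n ^ k) m ∈ ⨆ d, powGr (n := n) gr d := by
  refine iSup_induction_top (P := fun m => Ind.mk (xLast K n ^ k) m ∈ ⨆ d, powGr (n := n) gr d) h
    (fun j m hm => ?_) (fun a b ha hb => by rw [Ind.mk_add]; exact Submodule.add_mem _ ha hb) m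
  refine Submodule.mem_iSup_of_mem (j + k * 2) (Submodule.mem_iSup_of_mem k ⟨m, ?_, rfl⟩)
  rwa [add_sub_cancel_right]

theorem powGr_eq_bot {b d : ℤ} (hb : ∀ j < b, gr j = ⊥) (hd : d < b) : powGr (n := n) gr d = ⊥ := by
  refine iSup_eq_bot.2 fun k => ?_
  rw [hb _ (by omega), Submodule.map_bot]

theorem powGr_finite {b : ℤ} (hb : ∀ j < b, gr j = ⊥) (hf : ∀ j, Module.Finite K (gr j)) (d : ℤ) :
    (powGr (n := n) gr d).FG := by
  -- Only powers with `d - 2 k ≥ b` contribute; `d - b + 1` is a crude bound for their number.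
  have : powGr (n := n) gr d =
      ⨆ k ∈ Finset.range (d - b + 1).toNat, (gr (d - k * 2)).map (mkₗ (xLast K n ^ k)) := by
    refine le_antisymm (iSup_le fun k => ?_) (iSup₂_le fun k _ => le_iSup_of_le k le_rfl)
    by_cases hk : k < (d - b + 1).toNat
    · exact le_iSup₂_of_le k (Finset.mem_range.2 hk) le_rfl
    · rw [hb _ (by omega), Submodule.map_bot]
      exact bot_le
  rw [this]
  exact Submodule.fg_biSup _ _ fun k _ => (Module.Finite.iff_fg.1 (hf _)).map _

theorem crossing_mem {n : ℕ} {M : Type u} [AddCommGroup M] [Module K M]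
    [Module (NilHecke K (n + 1)) M] [IsScalarTower K (NilHecke K (n + 1)) M]
    {gr : ℤ → Submodule K M} {c : NilHecke K (n + 2)}
    (hc : ∀ h, c * incl K (n + 1) (incl K n h) = incl K (n + 1) (incl K n h) * c) {e : ℤ}
    (he : c ∈ NilHecke.gr K (n + 2) e) (d : ℤ) {z : Ind K n (Res K n M)}
    (hz : z ∈ indGr (n := n) (fun d => (gr d).comap (Res.val n M)) d) :
    Res.val (n + 1) _ (crossing (M := M) c hc z) ∈ indGr (n := n + 1) gr (d + e) := by
  unfold indGr at hz
  induction hz using Submodule.span_induction with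
  | zero => rw [map_zero, map_zero]; exact Submodule.zero_mem _
  | add x y _ _ hx hy => rw [map_add, map_add]; exact Submodule.add_mem _ hx hy
  | smul r x _ hx =>
    rw [LinearMap.map_smul_of_tower, map_smul]
    exact Submodule.smul_mem _ r hx
  | mem z hz =>
    obtain ⟨i, j, a, m, rfl, ha, hm, rfl⟩ := hz
    have := mk_mem_indGr (n := n + 1) (gr := gr) (m := Res.val n M m) (gr_mul (gr_incl ha) he) hm
    rwa [show i + e + j = i + j + e by ring] at this

theorem indGr_zero_eq [CharZero K] {M : Type u} [AddCommGroup M] [Module K M] [Module (NilHecke K 0) M]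
    [IsScalarTower K (NilHecke K 0) M] {gr : ℤ → Submodule K M} (h : IsGradedModule 0 M gr) (d : ℤ) :
    indGr (n := 0) gr d = powGr (n := 0) gr d := by
  refine eq_of_le_of_iSup_eq_top (isInternal_indGr h.isInternal h.smul_mem) powGr_le ?_ d
  rw [eq_top_iff]
  rintro z -
  induction z using ind_zero_induction with
  | add y z hy hz => exact Submodule.add_mem _ hy hz
  | pow k m => exact mk_pow_mem_iSup_powGr h.iSup_eq_top k m

/-- A graded form of the Kang-Kashiwara decomposition. The shift by `2` compensates the degree `-2`
of `τ`, and equality follows because the right sides span. -/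
theorem indGr_succ_eq [CharZero K] {n : ℕ} {M : Type u} [AddCommGroup M] [Module K M]
    [Module (NilHecke K (n + 1)) M] [IsScalarTower K (NilHecke K (n + 1)) M]
    {gr : ℤ → Submodule K M} (h : IsGradedModule (n + 1) M gr) (d : ℤ) :
    indGr (n := n + 1) gr d =
      (indGr (n := n) (fun d => (gr d).comap (Res.val n M)) (d + 2)).map
        ((Res.val (n + 1) (Ind K (n + 1) M)).comp
          ((crossing (M := M) (tLast K n) (tLast_comm n)).restrictScalars K)) ⊔
      powGr (n := n + 1) gr d := by
  refine eq_of_le_of_iSup_eq_top (isInternal_indGr h.isInternal h.smul_mem)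
    (G := fun d => (indGr (n := n) (fun d => (gr d).comap (Res.val n M)) (d + 2)).map
        ((Res.val (n + 1) (Ind K (n + 1) M)).comp
          ((crossing (M := M) (tLast K n) (tLast_comm n)).restrictScalars K)) ⊔
      powGr (n := n + 1) gr d) (fun d => sup_le ?_ (powGr_le d)) ?_ d
  · rintro _ ⟨z, hz, rfl⟩
    have := crossing_mem (tLast_comm n) gr_tLast (d + 2) hz
    rwa [add_neg_cancel_right] at this
  · rw [eq_top_iff]
    rintro z -
    induction z using ind_succ_induction with
    | add y z hy hz => exact Submodule.add_mem _ hy hz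
    | pow k m =>
      exact (iSup_mono fun d => le_sup_right : (⨆ d, powGr (n := n + 1) gr d) ≤ _) (mk_pow_mem_iSup_powGr h.iSup_eq_top k m)
    | tau a m =>
      refine iSup_induction_top (P := fun z => Res.val (n + 1) (Ind K (n + 1) M)
        (crossing (M := M) (tLast K n) (tLast_comm n) z) ∈ _)
        (iSup_indGr (n := n) (gr := fun d => (gr d).comap (Res.val n M)) h.iSup_eq_top)
        (fun j z hz => ?_) (fun y z hy hz => ?_) (Ind.mk a (Res.mk n M m))
      · refine Submodule.mem_iSup_of_mem (j - 2) (Submodule.mem_sup_left ⟨z, ?_, rfl⟩)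
        rwa [sub_add_cancel]
      · simp only [map_add]
        exact Submodule.add_mem _ hy hz

/-- Induction on the number of strands, with `M` replaced by its restriction: one fewer strand is
left for the part with `τ`, and the powers of `x` raise degrees. -/
theorem indGr_bounded_finite [CharZero K] : ∀ (n : ℕ) (M : Type u) [AddCommGroup M] [Module K M]
    [Module (NilHecke K n) M] [IsScalarTower K (NilHecke K n) M]
    (gr : ℤ → Submodule K M) (_ : IsGradedModule n M gr),
    (∃ b : ℤ, ∀ j < b, indGr (n := n) gr j = ⊥) ∧ ∀ j, (indGr (n := n) gr j).FG
  | 0, M, _, _, _, _, gr, h => by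
    obtain ⟨b, hb⟩ := h.bounded
    simp only [indGr_zero_eq h]
    exact ⟨⟨b, fun j hj => powGr_eq_bot hb hj⟩, powGr_finite hb h.finite⟩
  | n + 1, M, _, _, _, _, gr, h => by
    obtain ⟨b, hb⟩ := h.bounded
    obtain ⟨⟨b', hb'⟩, hf⟩ := indGr_bounded_finite n (Res K n M) _ h.res
    simp only [indGr_succ_eq h]
    -- The crossing lowers degrees by `2`, hence the bound `b' - 2` for its image.
    refine ⟨⟨min b (b' - 2), fun j hj => ?_⟩, fun j => ?_⟩
    · rw [powGr_eq_bot hb (by omega), hb' _ (by omega), Submodule.map_bot, sup_bot_eq]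
    · exact ((hf _).map _).sup (powGr_finite hb h.finite j)

theorem IsGradedModule.ind [CharZero K] [IsScalarTower K (NilHecke K n) M]
    (h : IsGradedModule n M gr) : IsGradedModule (n + 1) (Ind K n M) (indGr (n := n) gr) where
  isInternal := isInternal_indGr h.isInternal h.smul_mem
  smul_mem _ _ _ _ ha hm := smul_mem_indGr ha hm
  bounded := (indGr_bounded_finite n M gr h).1
  finite j := Module.Finite.iff_fg.2 ((indGr_bounded_finite n M gr h).2 j)

theorem HCat.isGradedModule (A : HCat K) (n : ℕ) : IsGradedModule n (A.fam.M n) (A.fam.gr n) where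
  isInternal := A.isObj.isInternal n
  smul_mem := A.isObj.smul_mem n
  bounded := A.isObj.bounded n
  finite := A.isObj.finite n

theorem HCat.isObj_res (A : HCat K) : A.fam.res.IsObj where
  isInternal n := (A.isGradedModule (n + 1)).res.isInternal
  smul_mem n := (A.isGradedModule (n + 1)).res.smul_mem
  projective n := by
    have := A.isObj.projective (n + 1)
    exact Res.projective (A.fam.M (n + 1))
  bounded n := (A.isGradedModule (n + 1)).res.bounded
  finite n := (A.isGradedModule (n + 1)).res.finite
  support := A.isObj.support.preimage (f := (· + 1)) (add_left_injective 1).injOn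

theorem HCat.isObj_ind [CharZero K] (A : HCat K) : A.fam.ind.IsObj where
  isInternal
    | 0 => HCat.zero.isObj.isInternal 0
    | n + 1 => (A.isGradedModule n).ind.isInternal
  smul_mem
    | 0 => HCat.zero.isObj.smul_mem 0
    | n + 1 => (A.isGradedModule n).ind.smul_mem
  projective
    | 0 => HCat.zero.isObj.projective 0
    | n + 1 => by
      have := A.isObj.projective n
      exact Ind.projective (A.fam.M n)
  bounded
    | 0 => HCat.zero.isObj.bounded 0
    | n + 1 => (A.isGradedModule n).ind.bounded
  finite
    | 0 => HCat.zero.isObj.finite 0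
    | n + 1 => (A.isGradedModule n).ind.finite
  support := by
    refine (A.isObj.support.image (· + 1)).subset ?_
    rintro (_ | n) hn
    · exact absurd hn (not_nontrivial_iff_subsingleton.2 (inferInstanceAs (Subsingleton PUnit)))
    · refine ⟨n, ?_, rfl⟩
      by_contra h
      have h' : Subsingleton (A.fam.M n) := not_nontrivial_iff_subsingleton.1 h
      refine not_nontrivial_iff_subsingleton.2 ⟨?_⟩ hn
      have h0 : ∀ z : Ind K n (A.fam.M n), z = 0 := fun z => by
        induction z using Ind.induction with
        | mk a m => rw [Subsingleton.elim m 0, Ind.mk_zero]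
        | add y z hy hz => rw [hy, hz, add_zero]
      exact fun y z => (h0 y).trans (h0 z).symm

end Graded

end TwoRepSl2

end

/-! ### Identities in `H_2` and `H_3`. -/

noncomputable section

namespace TwoRepSl2

section RingIdentities

set_option linter.unusedSimpArgs false

variable {R : Type*} [Ring R]

/-- The relations between `x_1, x_2, τ_1` in `H_2`. -/
structure TwoStrand (y z s : R) : Prop where
  zy : z * y = y * z
  sy : s * y = z * s - 1
  sz : s * z = y * s + 1
  ss : s * s = 0

/-- The relations between `x_1, x_2, x_3, τ_1, τ_2` in `H_3`. -/
structure ThreeStrand (y z u s r : R) : Prop extends TwoStrand y z s where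
  uy : u * y = y * u
  uz : u * z = z * u
  su : s * u = u * s
  ry : r * y = y * r
  rz : r * z = u * r - 1
  ru : r * u = z * r + 1
  rr : r * r = 0
  rsr : r * s * r = s * r * s

/-- The element `(x_1 - x_2) s_1`. -/
def crossElt (y z s : R) : R := (y - z) * ((y - z) * s + 1)

/-- Each relation is also needed inside a longer word bracketed to the right. With both forms, words
are brought to a normal form with the dots to the left of the crossings. -/
theorem mul_eq_assoc {a b c : R} (h : a * b = c) (x : R) : a * (b * x) = c * x := by
  rw [← mul_assoc, h]

namespace TwoStrand

variable {y z s : R}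

/-- The double commutator of `y` with `τ`. Its three terms become the three terms of `(X_1 - X_0)²`
after projection. -/
theorem crossElt_eq (h : TwoStrand y z s) :
    crossElt y z s = y * y * s - 2 * (y * s * y) + s * (y * y) := by
  have h1 := mul_eq_assoc h.zy
  have h2 := mul_eq_assoc h.sy
  have h3 := mul_eq_assoc h.sz
  have h4 := mul_eq_assoc h.ss
  simp only [crossElt, mul_assoc, mul_add, add_mul, mul_sub, sub_mul, mul_one, one_mul, mul_zero,
    zero_mul, two_mul, h.zy, h.sy, h.sz, h.ss, h1, h2, h3, h4]
  abel

theorem crossElt_eq' (h : TwoStrand y z s) :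
    crossElt y z s = z * z * s - 2 * (z * s * z) + s * z * z := by
  have h1 := mul_eq_assoc h.zy
  have h2 := mul_eq_assoc h.sy
  have h3 := mul_eq_assoc h.sz
  have h4 := mul_eq_assoc h.ss
  simp only [crossElt, mul_assoc, mul_add, add_mul, mul_sub, sub_mul, mul_one, one_mul, mul_zero,
    zero_mul, two_mul, h.zy, h.sy, h.sz, h.ss, h1, h2, h3, h4]
  abel

/-- The element `(y - z) s + 1` acts as the transposition of the two variables, and `y - z` commutes
with both. -/
theorem crossElt_mul_right (h : TwoStrand y z s) :
    crossElt y z s * z = y * crossElt y z s := by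
  have h1 := mul_eq_assoc h.zy
  have h2 := mul_eq_assoc h.sy
  have h3 := mul_eq_assoc h.sz
  have h4 := mul_eq_assoc h.ss
  simp only [crossElt, mul_assoc, mul_add, add_mul, mul_sub, sub_mul, mul_one, one_mul, mul_zero,
    zero_mul, two_mul, h.zy, h.sy, h.sz, h.ss, h1, h2, h3, h4]
  abel

theorem crossElt_mul_left (h : TwoStrand y z s) :
    crossElt y z s * y = z * crossElt y z s := by
  have h1 := mul_eq_assoc h.zy
  have h2 := mul_eq_assoc h.sy
  have h3 := mul_eq_assoc h.sz
  have h4 := mul_eq_assoc h.ss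
  simp only [crossElt, mul_assoc, mul_add, add_mul, mul_sub, sub_mul, mul_one, one_mul, mul_zero,
    zero_mul, two_mul, h.zy, h.sy, h.sz, h.ss, h1, h2, h3, h4]
  abel

/-- The product has only one crossing left because `τ² = 0`; this is the source of the linear terms
in the mixed braid relations. -/
theorem tau_mul_crossElt (h : TwoStrand y z s) :
    s * crossElt y z s = s * y - y * s - 1 := by
  have h1 := mul_eq_assoc h.zy
  have h2 := mul_eq_assoc h.sy
  have h3 := mul_eq_assoc h.sz
  have h4 := mul_eq_assoc h.ss
  simp only [crossElt, mul_assoc, mul_add, add_mul, mul_sub, sub_mul, mul_one, one_mul, mul_zero,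
    zero_mul, two_mul, h.zy, h.sy, h.sz, h.ss, h1, h2, h3, h4]
  abel

theorem crossElt_mul_tau (h : TwoStrand y z s) :
    crossElt y z s * s = y * s - s * y - 1 := by
  have h1 := mul_eq_assoc h.zy
  have h2 := mul_eq_assoc h.sy
  have h3 := mul_eq_assoc h.sz
  have h4 := mul_eq_assoc h.ss
  simp only [crossElt, mul_assoc, mul_add, add_mul, mul_sub, sub_mul, mul_one, one_mul, mul_zero,
    zero_mul, two_mul, h.zy, h.sy, h.sz, h.ss, h1, h2, h3, h4]
  abel

end TwoStrand

namespace ThreeStrand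

variable {y z u s r : R}

/-- The product of the two elements `c` behaves like a 3-cycle times a polynomial, and conjugates
one crossing into the other. -/
theorem cross_braid (h : ThreeStrand y z u s r) :
    r * (crossElt y z s * crossElt z u r) = crossElt y z s * crossElt z u r * s := by
  -- The braid relation is oriented from `r s r` to `s r s`, so that words in the two crossings also
  -- have a normal form.
  have h0 : r * (s * r) = s * (r * s) := by rw [← mul_assoc, h.rsr, mul_assoc]
  have h0' : ∀ x, r * (s * (r * x)) = s * (r * (s * x)) := fun x => by
    simp only [← mul_assoc, h.rsr]
  have h1 := mul_eq_assoc h.zy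
  have h2 := mul_eq_assoc h.sy
  have h3 := mul_eq_assoc h.sz
  have h4 := mul_eq_assoc h.ss
  have h5 := mul_eq_assoc h.uy
  have h6 := mul_eq_assoc h.uz
  have h7 := mul_eq_assoc h.su
  have h8 := mul_eq_assoc h.ry
  have h9 := mul_eq_assoc h.rz
  have h10 := mul_eq_assoc h.ru
  have h11 := mul_eq_assoc h.rr
  simp only [crossElt, mul_assoc, mul_add, add_mul, mul_sub, sub_mul, mul_one, one_mul, mul_zero,
    zero_mul, two_mul, h.zy, h.sy, h.sz, h.ss, h.uy, h.uz, h.su, h.ry, h.rz, h.ru, h.rr, h0, h0', h1, h2,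
    h3, h4, h5, h6, h7, h8, h9, h10, h11]
  abel

theorem cross_braid' (h : ThreeStrand y z u s r) :
    s * (crossElt z u r * crossElt y z s) = crossElt z u r * crossElt y z s * r := by
  have h0 : r * (s * r) = s * (r * s) := by rw [← mul_assoc, h.rsr, mul_assoc]
  have h0' : ∀ x, r * (s * (r * x)) = s * (r * (s * x)) := fun x => by
    simp only [← mul_assoc, h.rsr]
  have h1 := mul_eq_assoc h.zy
  have h2 := mul_eq_assoc h.sy
  have h3 := mul_eq_assoc h.sz
  have h4 := mul_eq_assoc h.ss
  have h5 := mul_eq_assoc h.uy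
  have h6 := mul_eq_assoc h.uz
  have h7 := mul_eq_assoc h.su
  have h8 := mul_eq_assoc h.ry
  have h9 := mul_eq_assoc h.rz
  have h10 := mul_eq_assoc h.ru
  have h11 := mul_eq_assoc h.rr
  simp only [crossElt, mul_assoc, mul_add, add_mul, mul_sub, sub_mul, mul_one, one_mul, mul_zero,
    zero_mul, two_mul, h.zy, h.sy, h.sz, h.ss, h.uy, h.uz, h.su, h.ry, h.rz, h.ru, h.rr, h0, h0', h1, h2,
    h3, h4, h5, h6, h7, h8, h9, h10, h11]
  abel

/-- The right side has the form `∑ a r b` with `a`, `b` in the subalgebra of the first two strands,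
so the projection can be read off. -/
theorem tau_tau_cross (h : ThreeStrand y z u s r) :
    r * s * crossElt z u r = (y - z) * (y - z) * s * r * s + (z - 2 * y) * s * r + s * r * z -
      2 * r + (y - z) * r * s := by
  have h0 : r * (s * r) = s * (r * s) := by rw [← mul_assoc, h.rsr, mul_assoc]
  have h0' : ∀ x, r * (s * (r * x)) = s * (r * (s * x)) := fun x => by
    simp only [← mul_assoc, h.rsr]
  have h1 := mul_eq_assoc h.zy
  have h2 := mul_eq_assoc h.sy
  have h3 := mul_eq_assoc h.sz
  have h4 := mul_eq_assoc h.ss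
  have h5 := mul_eq_assoc h.uy
  have h6 := mul_eq_assoc h.uz
  have h7 := mul_eq_assoc h.su
  have h8 := mul_eq_assoc h.ry
  have h9 := mul_eq_assoc h.rz
  have h10 := mul_eq_assoc h.ru
  have h11 := mul_eq_assoc h.rr
  simp only [crossElt, mul_assoc, mul_add, add_mul, mul_sub, sub_mul, mul_one, one_mul, mul_zero,
    zero_mul, two_mul, h.zy, h.sy, h.sz, h.ss, h.uy, h.uz, h.su, h.ry, h.rz, h.ru, h.rr, h0, h0', h1, h2,
    h3, h4, h5, h6, h7, h8, h9, h10, h11]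
  abel

/-- The mirror image of `tau_tau_cross`, again expanded around the single outer crossing `r`. -/
theorem cross_tau_tau (h : ThreeStrand y z u s r) :
    crossElt z u r * s * r = z * z * s * r * s - 2 * (z * s * r * (z * s)) + s * r * (z * z * s) +
      z * s * r - s * r * z := by
  have h0 : r * (s * r) = s * (r * s) := by rw [← mul_assoc, h.rsr, mul_assoc]
  have h0' : ∀ x, r * (s * (r * x)) = s * (r * (s * x)) := fun x => by
    simp only [← mul_assoc, h.rsr]
  have h1 := mul_eq_assoc h.zy
  have h2 := mul_eq_assoc h.sy
  have h3 := mul_eq_assoc h.sz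
  have h4 := mul_eq_assoc h.ss
  have h5 := mul_eq_assoc h.uy
  have h6 := mul_eq_assoc h.uz
  have h7 := mul_eq_assoc h.su
  have h8 := mul_eq_assoc h.ry
  have h9 := mul_eq_assoc h.rz
  have h10 := mul_eq_assoc h.ru
  have h11 := mul_eq_assoc h.rr
  simp only [crossElt, mul_assoc, mul_add, add_mul, mul_sub, sub_mul, mul_one, one_mul, mul_zero,
    zero_mul, two_mul, h.zy, h.sy, h.sz, h.ss, h.uy, h.uz, h.su, h.ry, h.rz, h.ru, h.rr, h0, h0', h1, h2,
    h3, h4, h5, h6, h7, h8, h9, h10, h11]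
  abel

end ThreeStrand

end RingIdentities

end TwoRepSl2

end

/-! ### The projection onto the Kang-Kashiwara tensor part, and the operators for `X` and `T`. -/

noncomputable section

namespace TwoRepSl2

section Strands

open NilHecke

variable {K : Type u} [Field K]

theorem twoStrand (n : ℕ) : TwoStrand (xPrev K n) (xLast K (n + 1)) (tLast K n) where
  zy := by rw [xLast_eq, xPrev_eq, x_mul_x]
  sy := by rw [xLast_mul_tLast, add_sub_cancel_right]
  sz := tLast_mul_xLast
  ss := tLast_mul_self

theorem threeStrand (n : ℕ) : ThreeStrand (incl K (n + 2) (xPrev K n)) (xPrev K (n + 1))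
    (xLast K (n + 2)) (incl K (n + 2) (tLast K n)) (tLast K (n + 1)) where
  zy := by rw [← incl_xLast (n := n + 1), ← map_mul, (twoStrand n).zy, map_mul]
  sy := by rw [← incl_xLast (n := n + 1), ← map_mul, (twoStrand n).sy, map_sub, map_mul, map_one]
  sz := by rw [← incl_xLast (n := n + 1), ← map_mul, (twoStrand n).sz, map_add, map_mul, map_one]
  ss := by rw [← map_mul, tLast_mul_self, map_zero]
  uy := (incl_mul_xLast _).symm
  uz := (twoStrand (n + 1)).zy
  su := incl_mul_xLast _
  ry := by rw [← incl_xLast, tLast_comm]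
  rz := (twoStrand (n + 1)).sy
  ru := (twoStrand (n + 1)).sz
  rr := tLast_mul_self
  rsr := by
    rw [tLast_eq, tLast_eq, incl_t (by omega)]
    exact t_braid n

variable (K) in
/-- The element `(x_{n+1} - x_{n+2}) s_{n+1}`. -/
def cross (n : ℕ) : NilHecke K (n + 2) := crossElt (xPrev K n) (xLast K (n + 1)) (tLast K n)

theorem xPrev_comm (n : ℕ) (h : NilHecke K n) : Commute (xPrev K n) (incl K (n + 1) (incl K n h)) := by
  have := congrArg (incl K (n + 1)) (incl_mul_xLast h)
  rw [map_mul, map_mul, incl_xLast] at this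
  exact this.symm

theorem cross_comm (n : ℕ) (h : NilHecke K n) :
    cross K n * incl K (n + 1) (incl K n h) = incl K (n + 1) (incl K n h) * cross K n := by
  have h1 := xPrev_comm n h
  have h2 : Commute (xLast K (n + 1)) (incl K (n + 1) (incl K n h)) :=
    (incl_mul_xLast (incl K n h)).symm
  have h3 : Commute (tLast K n) (incl K (n + 1) (incl K n h)) := tLast_comm n h
  exact (h1.sub_left h2).mul_left (((h1.sub_left h2).mul_left h3).add_left (Commute.one_left _))

theorem gr_cross (n : ℕ) : cross K n ∈ NilHecke.gr K (n + 2) 2 := by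
  have h1 : xPrev K n - xLast K (n + 1) ∈ NilHecke.gr K (n + 2) 2 :=
    Submodule.sub_mem _ gr_xPrev gr_xLast
  have h2 : (xPrev K n - xLast K (n + 1)) * tLast K n ∈ NilHecke.gr K (n + 2) 0 := by
    have := gr_mul h1 (gr_tLast (K := K) (n := n))
    rwa [show (2 : ℤ) + -2 = 0 by norm_num] at this
  have h3 := gr_mul h1 (Submodule.add_mem _ h2 gr_one)
  rwa [add_zero] at h3

/-- Additive statements about `H_{n+2}` need checking only on the two kinds of terms of the
splitting. -/
theorem hecke_induction {n : ℕ} {P : NilHecke K (n + 2) → Prop}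
    (tau : ∀ a b, P (incl K (n + 1) a * tLast K n * incl K (n + 1) b))
    (pow : ∀ a k, P (incl K (n + 1) a * xLast K (n + 1) ^ k))
    (add : ∀ c d, P c → P d → P (c + d)) (c : NilHecke K (n + 2)) : P c := by
  obtain ⟨⟨u, p⟩, rfl⟩ := kangKashiwaraHom_surjective c
  have hsplit : kangKashiwaraHom K n (u, p) =
      kangKashiwaraHom K n (u, 0) + evalLast K (n + 1) p := by
    rw [← kangKashiwaraHom_zero_left, ← map_add]; simp
  rw [hsplit]
  clear hsplit
  refine add _ _ ?_ ?_
  · induction u using Ind.induction with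
    | add u v hu hv =>
      have : ((u + v, 0) : _ × (NilHecke K (n + 1))[X]) = (u, 0) + (v, 0) := by simp
      rw [this, map_add]
      exact add _ _ hu hv
    | mk a b =>
      change P (kangKashiwaraHom K n
        (Ind.mk a (Res.mk n (NilHecke K (n + 1)) (Res.val n _ b)), 0))
      rw [kangKashiwaraHom_mk, map_zero, add_zero]
      exact tau a _
  · induction p using Polynomial.induction_on' with
    | add p q hp hq => rw [map_add]; exact add _ _ hp hq
    | monomial j a => rw [evalLast_monomial]; exact pow _ _

end Strands

section Projection

open NilHecke

variable {K : Type u} [Field K]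

variable (K) in
/-- The projection of `H_{n+2}` to `H_{n+1} ⊗_{H_n} H_{n+1}`. -/
def projHom (n : ℕ) : NilHecke K (n + 2) →+ Ind K n (Res K n (NilHecke K (n + 1))) :=
  (AddMonoidHom.fst _ _).comp
    (AddEquiv.ofBijective (kangKashiwaraHom K n)
      ⟨kangKashiwaraHom_injective, kangKashiwaraHom_surjective⟩).symm.toAddMonoidHom

theorem projHom_kangKashiwaraHom (n : ℕ)
    (p : Ind K n (Res K n (NilHecke K (n + 1))) × (NilHecke K (n + 1))[X]) :
    projHom K n (kangKashiwaraHom K n p) = p.1 :=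
  congrArg Prod.fst ((AddEquiv.ofBijective (kangKashiwaraHom K n)
      ⟨kangKashiwaraHom_injective, kangKashiwaraHom_surjective⟩).symm_apply_apply p)

theorem projHom_tau {n : ℕ} (a b : NilHecke K (n + 1)) :
    projHom K n (incl K (n + 1) a * tLast K n * incl K (n + 1) b) =
      Ind.mk a (Res.mk n (NilHecke K (n + 1)) b) := by
  have h := kangKashiwaraHom_mk a b 0
  rw [map_zero, add_zero] at h
  rw [← h, projHom_kangKashiwaraHom]

theorem projHom_pow {n : ℕ} (a : NilHecke K (n + 1)) (k : ℕ) :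
    projHom K n (incl K (n + 1) a * xLast K (n + 1) ^ k) = 0 := by
  rw [← evalLast_monomial, ← kangKashiwaraHom_zero_left, projHom_kangKashiwaraHom]

/-- Both summands of the splitting are stable under left multiplication by `H_{n+1}`. -/
theorem projHom_incl_mul {n : ℕ} (b : NilHecke K (n + 1)) (c : NilHecke K (n + 2)) :
    projHom K n (incl K (n + 1) b * c) = b • projHom K n c := by
  induction c using hecke_induction with
  | tau a a' => rw [← mul_assoc, ← mul_assoc, ← map_mul, projHom_tau, projHom_tau, Ind.smul_mk]
  | pow a k => rw [← mul_assoc, ← map_mul, projHom_pow, projHom_pow, smul_zero]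
  | add c d hc hd => rw [mul_add, map_add, map_add, smul_add, hc, hd]

theorem projHom_smul {n : ℕ} (r : K) (c : NilHecke K (n + 2)) :
    projHom K n (r • c) = r • projHom K n c := by
  have h := projHom_incl_mul (algebraMap K _ r) c
  rwa [AlgHom.commutes, ← Algebra.smul_def, algebraMap_smul] at h

variable {n : ℕ} (M : Type u) [AddCommGroup M] [Module K M] [Module (NilHecke K (n + 1)) M]
  [IsScalarTower K (NilHecke K (n + 1)) M]

/-- The map `H_{n+1} ⊗_{H_n} H_{n+1} → H_{n+1} ⊗_{H_n} M`, `a ⊗ b ↦ a ⊗ b m`. -/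
def actInd (m : M) : Ind K n (Res K n (NilHecke K (n + 1))) →ₗ[NilHecke K (n + 1)]
    Ind K n (Res K n M) :=
  Ind.map (Res.map n (LinearMap.toSpanSingleton (NilHecke K (n + 1)) M m))

variable {M}

theorem actInd_mk (m : M) (a b : NilHecke K (n + 1)) :
    actInd M m (Ind.mk a (Res.mk n (NilHecke K (n + 1)) b)) = Ind.mk a (Res.mk n M (b • m)) := rfl

theorem actInd_add (m m' : M) (z : Ind K n (Res K n (NilHecke K (n + 1)))) :
    actInd M (m + m') z = actInd M m z + actInd M m' z := by
  induction z using Ind.induction with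
  | mk a b =>
    change Ind.mk a (Res.mk n M (Res.val n (NilHecke K (n + 1)) b • (m + m'))) =
      Ind.mk a (Res.mk n M _) + Ind.mk a (Res.mk n M _)
    rw [smul_add, map_add, Ind.mk_add]
    rfl
  | add y z hy hz => rw [map_add, map_add, map_add, hy, hz]; abel

theorem actInd_smul (r : K) (m : M) (z : Ind K n (Res K n (NilHecke K (n + 1)))) :
    actInd M (r • m) z = r • actInd M m z := by
  induction z using Ind.induction with
  | mk a b =>
    change Ind.mk a (Res.mk n M (Res.val n (NilHecke K (n + 1)) b • (r • m))) =
      r • Ind.mk a (Res.mk n M _)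
    rw [smul_comm, map_smul, Ind.mk_smul]
    rfl
  | add y z hy hz => rw [map_add, map_add, smul_add, hy, hz]

variable (M) in
/-- The projection `H_{n+2} ⊗_{H_{n+1}} M → H_{n+1} ⊗_{H_n} M`. -/
def proj : Ind K (n + 1) M →ₗ[K] Ind K n (Res K n M) :=
  Ind.liftₗ (LinearMap.mk₂ K (fun c m => actInd M m (projHom K n c))
    (fun a b m => by rw [map_add, map_add])
    (fun r a m => by rw [projHom_smul, LinearMap.map_smul_of_tower])
    (fun a m m' => actInd_add _ _ _) (fun r a m => actInd_smul _ _ _)) (fun c h m => by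
      change actInd M m (projHom K n (c * incl K (n + 1) h)) = actInd M (h • m) (projHom K n c)
      -- Balancing amounts to right linearity: `H_{n+1}` is absorbed by the right factor of `a τ b`
      -- and commutes with the last variable.
      induction c using hecke_induction with
      | tau a b =>
        rw [mul_assoc, ← map_mul, projHom_tau, projHom_tau, actInd_mk, actInd_mk, mul_smul]
      | pow a k =>
        have h' : Commute (incl K (n + 1) h) (xLast K (n + 1)) := incl_mul_xLast h
        rw [mul_assoc, ← (h'.pow_right k).eq, ← mul_assoc, ← map_mul, projHom_pow, projHom_pow,
          map_zero, map_zero]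
      | add c d hc hd => rw [add_mul, map_add, map_add, map_add, map_add, hc, hd])

theorem proj_mk (c : NilHecke K (n + 2)) (m : M) :
    proj M (Ind.mk c m) = actInd M m (projHom K n c) := rfl

theorem proj_tau (a : NilHecke K (n + 1)) (m : M) :
    proj M (Ind.mk (incl K (n + 1) a * tLast K n) m) = Ind.mk a (Res.mk n M m) := by
  have h := projHom_tau a (1 : NilHecke K (n + 1))
  rw [map_one, mul_one] at h
  rw [proj_mk, h, actInd_mk, one_smul]

theorem proj_tau_incl (a b : NilHecke K (n + 1)) (m : M) :
    proj M (Ind.mk (incl K (n + 1) a * tLast K n * incl K (n + 1) b) m) =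
      Ind.mk a (Res.mk n M (b • m)) := by
  rw [Ind.mul_incl_mk, proj_tau]

theorem proj_tau_one (m : M) : proj M (Ind.mk (tLast K n) m) = Ind.mk 1 (Res.mk n M m) := by
  have h := proj_tau (1 : NilHecke K (n + 1)) m
  rwa [map_one, one_mul] at h

theorem proj_incl_mul_pow (a : NilHecke K (n + 1)) (k : ℕ) (m : M) :
    proj M (Ind.mk (incl K (n + 1) a * xLast K (n + 1) ^ k) m) = 0 := by
  rw [proj_mk, projHom_pow, map_zero]

theorem proj_pow (k : ℕ) (m : M) : proj M (Ind.mk (xLast K (n + 1) ^ k) m) = 0 := by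
  have h := proj_incl_mul_pow (1 : NilHecke K (n + 1)) k m
  rwa [map_one, one_mul] at h

theorem proj_incl (a : NilHecke K (n + 1)) (m : M) :
    proj M (Ind.mk (incl K (n + 1) a) m) = 0 := by
  have h := proj_incl_mul_pow a 0 m
  rwa [pow_zero, mul_one] at h

theorem proj_smul (b : NilHecke K (n + 1)) (z : Ind K (n + 1) M) :
    proj M (incl K (n + 1) b • z) = b • proj M z := by
  induction z using Ind.induction with
  | mk c m => rw [Ind.smul_mk, proj_mk, proj_mk, projHom_incl_mul, map_smul]
  | add y z hy hz => rw [smul_add, map_add, map_add, smul_add, hy, hz]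

theorem proj_incl_mul (b : NilHecke K (n + 1)) (c : NilHecke K (n + 2)) (m : M) :
    proj M (Ind.mk (incl K (n + 1) b * c) m) = b • proj M (Ind.mk c m) := by
  rw [← proj_smul, Ind.smul_mk]

theorem proj_kangKashiwara (a b : NilHecke K (n + 1)) (p : (NilHecke K (n + 1))[X]) (m : M) :
    proj M (Ind.mk (kangKashiwara K n (Ind.mk a (Res.mk n (NilHecke K (n + 1)) b), p)) m) =
      Ind.mk a (Res.mk n M (b • m)) :=
  congrArg (actInd M m) (projHom_kangKashiwaraHom n _)

variable (M) in
/-- The projection as a homomorphism of `H_{n+1}`-modules. -/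
def projRes : Res K (n + 1) (Ind K (n + 1) M) →ₗ[NilHecke K (n + 1)] Ind K n (Res K n M) where
  toFun := proj M
  map_add' := map_add (proj M)
  map_smul' := proj_smul

theorem proj_map {N : Type u} [AddCommGroup N] [Module K N] [Module (NilHecke K (n + 1)) N]
    [IsScalarTower K (NilHecke K (n + 1)) N] (f : M →ₗ[NilHecke K (n + 1)] N)
    (z : Ind K (n + 1) M) : proj N (Ind.map f z) = Ind.map (Res.map n f) (proj M z) := by
  induction z using ind_succ_induction with
  | tau a m => rw [Ind.map_mk, proj_tau, proj_tau]; rfl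
  | pow k m => rw [Ind.map_mk, proj_pow, proj_pow, map_zero]
  | add y z hy hz => rw [map_add, map_add, map_add, map_add, hy, hz]

end Projection

section Dots

open NilHecke

variable {K : Type u} [Field K] {n : ℕ}

/-- The map `a ⊗ m ↦ a x_{n+1} ⊗ m` on an induced module. -/
def xInd (n : ℕ) (M : Type u) [AddCommGroup M] [Module K M] [Module (NilHecke K n) M]
    [IsScalarTower K (NilHecke K n) M] : Ind K n M →ₗ[NilHecke K (n + 1)] Ind K n M :=
  Ind.lift
    { toFun := fun m => Res.mk (K := K) n _ (Ind.mk (xLast K n) m)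
      map_add' := fun m m' => Ind.mk_add (xLast K n) m m'
      map_smul' := fun h m => by
        change Ind.mk (xLast K n) (h • m) = incl K n h • Ind.mk (xLast K n) m
        rw [← Ind.mul_incl_mk, ← incl_mul_xLast]
        rfl }

theorem xInd_mk {M : Type u} [AddCommGroup M] [Module K M] [Module (NilHecke K n) M]
    [IsScalarTower K (NilHecke K n) M] (a : NilHecke K (n + 1)) (m : M) :
    xInd n M (Ind.mk a m) = Ind.mk (a * xLast K n) m := rfl

/-- The map `m ↦ x_{n+1} m` on the restriction of a module. -/
def xRes (n : ℕ) (M : Type u) [AddCommGroup M] [Module K M] [Module (NilHecke K (n + 1)) M]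
    [IsScalarTower K (NilHecke K (n + 1)) M] : Res K n M →ₗ[NilHecke K n] Res K n M where
  toFun m := Res.mk (K := K) n M (xLast K n • Res.val n M m)
  map_add' m m' := smul_add (xLast K n) (Res.val n M m) (Res.val n M m')
  map_smul' h m := by
    change xLast K n • incl K n h • Res.val n M m = incl K n h • xLast K n • Res.val n M m
    rw [smul_smul, ← incl_mul_xLast, mul_smul]

/-- The map `a ⊗ (b ⊗ m) ↦ a b τ_{n+1} ⊗ (1 ⊗ m)` on a module induced twice. -/
def tInd (n : ℕ) (M : Type u) [AddCommGroup M] [Module K M] [Module (NilHecke K n) M]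
    [IsScalarTower K (NilHecke K n) M] :
    Ind K (n + 1) (Ind K n M) →ₗ[NilHecke K (n + 2)] Ind K (n + 1) (Ind K n M) :=
  Ind.lift (Ind.lift
    { toFun := fun m => Res.mk (K := K) n _ (Res.mk (K := K) (n + 1) _
        (Ind.mk (M := Ind K n M) (tLast K n) (Ind.mk 1 m)))
      map_add' := fun m m' => by
        rw [Ind.mk_add, Ind.mk_add, _root_.map_add, _root_.map_add]
      map_smul' := fun h m => by
        change Ind.mk (M := Ind K n M) (tLast K n) (Ind.mk 1 (h • m)) =
          incl K (n + 1) (incl K n h) • Ind.mk (M := Ind K n M) (tLast K n) (Ind.mk 1 m)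
        rw [← Ind.incl_mk, Ind.mk_eq_smul (incl K n h), ← Ind.mul_incl_mk, tLast_comm]
        rfl })

theorem tInd_mk_one {M : Type u} [AddCommGroup M] [Module K M] [Module (NilHecke K n) M]
    [IsScalarTower K (NilHecke K n) M] (a : NilHecke K (n + 2)) (m : M) :
    tInd n M (Ind.mk a (Ind.mk 1 m)) = Ind.mk (a * tLast K n) (Ind.mk 1 m) := by
  change Ind.mk (a * (incl K (n + 1) 1 * tLast K n)) (Ind.mk 1 m) = _
  rw [map_one, one_mul]

theorem tInd_mk {M : Type u} [AddCommGroup M] [Module K M] [Module (NilHecke K n) M]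
    [IsScalarTower K (NilHecke K n) M] (a : NilHecke K (n + 2)) (b : NilHecke K (n + 1)) (m : M) :
    tInd n M (Ind.mk a (Ind.mk b m)) = Ind.mk (a * incl K (n + 1) b * tLast K n) (Ind.mk 1 m) := by
  rw [Ind.mk_eq_smul b, ← Ind.mul_incl_mk, tInd_mk_one]

/-- The map `m ↦ -τ_{n+1} m` on a module restricted twice. -/
def tRes (n : ℕ) (M : Type u) [AddCommGroup M] [Module K M] [Module (NilHecke K (n + 2)) M]
    [IsScalarTower K (NilHecke K (n + 2)) M] :
    Res K n (Res K (n + 1) M) →ₗ[NilHecke K n] Res K n (Res K (n + 1) M) where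
  toFun m := Res.mk (K := K) n (Res K (n + 1) M) (Res.mk (K := K) (n + 1) M
    (-(tLast K n • Res.val (n + 1) M (Res.val n (Res K (n + 1) M) m))))
  map_add' m m' := by
    change -(tLast K n • (Res.val (n + 1) M (Res.val n (Res K (n + 1) M) m) +
      Res.val (n + 1) M (Res.val n (Res K (n + 1) M) m'))) = -(_ • _) + -(_ • _)
    rw [smul_add, neg_add]
    rfl
  map_smul' h m := by
    change -(tLast K n • incl K (n + 1) (incl K n h) • Res.val (n + 1) M (Res.val n (Res K (n + 1) M) m)) =
      incl K (n + 1) (incl K n h) • -(tLast K n • Res.val (n + 1) M (Res.val n (Res K (n + 1) M) m))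
    rw [smul_smul, tLast_comm, mul_smul, smul_neg]

/-- The map `a ⊗ m ↦ a (x_{n+1} - x_{n+2}) s_{n+1} ⊗ m`. -/
def crossRes (n : ℕ) (M : Type u) [AddCommGroup M] [Module K M] [Module (NilHecke K (n + 1)) M]
    [IsScalarTower K (NilHecke K (n + 1)) M] :
    Ind K n (Res K n M) →ₗ[NilHecke K (n + 1)] Res K (n + 1) (Ind K (n + 1) M) :=
  crossing (cross K n) (cross_comm n)

/-- The map `a ⊗ m ↦ a (x_{n+1} - x_{n+2}) s_{n+1} ⊗ m` as a `K`-linear map. -/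
def crossInd (n : ℕ) (M : Type u) [AddCommGroup M] [Module K M] [Module (NilHecke K (n + 1)) M]
    [IsScalarTower K (NilHecke K (n + 1)) M] : Ind K n (Res K n M) →ₗ[K] Ind K (n + 1) M :=
  (Res.val (n + 1) (Ind K (n + 1) M)).comp ((crossRes n M).restrictScalars K)

end Dots

end TwoRepSl2

end

/-! ### Dot relations and the quadratic relations. -/

noncomputable section

namespace TwoRepSl2

section Relations

open NilHecke

variable {K : Type u} [Field K] {n : ℕ}

section OneStep

variable {M : Type u} [AddCommGroup M] [Module K M] [Module (NilHecke K n) M]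

theorem mk_smul_mk_one (a : NilHecke K (n + 2)) (b : NilHecke K (n + 1)) (m : M) :
    Ind.mk a (Ind.mk b m) = Ind.mk (a * incl K (n + 1) b) (Ind.mk 1 m) := by
  rw [Ind.mk_eq_smul b, ← Ind.mul_incl_mk]

/-- Linear maps out of a module induced twice are determined on the elements `1 ⊗ (1 ⊗ m)`. -/
theorem ind_ind_hom_ext {N : Type*} [AddCommGroup N] [Module (NilHecke K (n + 2)) N]
    {f g : Ind K (n + 1) (Ind K n M) →ₗ[NilHecke K (n + 2)] N}
    (h : ∀ m, f (Ind.mk 1 (Ind.mk 1 m)) = g (Ind.mk 1 (Ind.mk 1 m))) : f = g := by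
  refine Ind.hom_ext fun v => ?_
  induction v using Ind.induction with
  | mk b m => rw [mk_smul_mk_one, Ind.mk_eq_smul, map_smul, map_smul, h]
  | add v w hv hw => rw [Ind.mk_add, map_add, map_add, hv, hw]

/-- Linear maps out of a module induced three times are determined on the elements
`1 ⊗ (1 ⊗ (1 ⊗ m))`. -/
theorem ind_ind_ind_hom_ext {N : Type*} [AddCommGroup N] [Module (NilHecke K (n + 3)) N]
    {f g : Ind K (n + 2) (Ind K (n + 1) (Ind K n M)) →ₗ[NilHecke K (n + 3)] N}
    (h : ∀ m, f (Ind.mk 1 (Ind.mk 1 (Ind.mk 1 m))) = g (Ind.mk 1 (Ind.mk 1 (Ind.mk 1 m)))) :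
    f = g := by
  refine ind_ind_hom_ext fun v => ?_
  induction v using Ind.induction with
  | mk b m =>
    have e : Ind.mk (1 : NilHecke K (n + 3)) (Ind.mk (1 : NilHecke K (n + 2)) (Ind.mk b m)) =
        incl K (n + 2) (incl K (n + 1) b) • Ind.mk 1 (Ind.mk 1 (Ind.mk 1 m)) := by
      rw [Ind.mk_eq_smul b, ← Ind.incl_mk, Ind.mk_eq_smul (incl K (n + 1) b), ← Ind.incl_mk,
        Ind.mk_eq_smul (incl K (n + 2) _)]
    rw [e, map_smul, map_smul, h]
  | add v w hv hw => simp only [Ind.mk_add, map_add, hv, hw]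

variable [IsScalarTower K (NilHecke K n) M]

/-- Every element is a sum of `c ⊗ (1 ⊗ m)`, on which all maps are right multiplications in
`H_{n+2}`. -/
theorem tInd_xInd (z : Ind K (n + 1) (Ind K n M)) :
    tInd n M (xInd (n + 1) (Ind K n M) z) - Ind.map (xInd n M) (tInd n M z) = z := by
  induction z using Ind.induction with
  | mk a v =>
    induction v using Ind.induction with
    | mk b m =>
      have h := twoStrand (K := K) n
      rw [mk_smul_mk_one]
      generalize a * incl K (n + 1) b = c
      rw [xInd_mk, tInd_mk_one, tInd_mk_one, Ind.map_mk, xInd_mk, one_mul,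
        mk_smul_mk_one _ (xLast K n), ← Ind.sub_mk, incl_xLast, mul_assoc, mul_assoc, ← mul_sub, h.sy,
        sub_sub_cancel, mul_one]
    | add v w hv hw =>
      rw [Ind.mk_add]
      simp only [map_add]
      rw [add_sub_add_comm, hv, hw]
  | add y z hy hz =>
    simp only [map_add]
    rw [add_sub_add_comm, hy, hz]

theorem tInd_map_xInd (z : Ind K (n + 1) (Ind K n M)) :
    tInd n M (Ind.map (xInd n M) z) - xInd (n + 1) (Ind K n M) (tInd n M z) = -z := by
  induction z using Ind.induction with
  | mk a v =>
    induction v using Ind.induction with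
    | mk b m =>
      have h := twoStrand (K := K) n
      rw [mk_smul_mk_one]
      generalize a * incl K (n + 1) b = c
      rw [Ind.map_mk, xInd_mk, tInd_mk_one, xInd_mk, one_mul, tInd_mk, ← Ind.sub_mk,
        incl_xLast, mul_assoc, mul_assoc _ (tLast K n), ← mul_sub, h.sz, sub_add_cancel_left, mul_neg,
        mul_one, Ind.neg_mk]
    | add v w hv hw =>
      rw [Ind.mk_add]
      simp only [map_add]
      rw [add_sub_add_comm, hv, hw, neg_add]
  | add y z hy hz =>
    simp only [map_add]
    rw [add_sub_add_comm, hy, hz, neg_add]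

theorem tInd_tInd (z : Ind K (n + 1) (Ind K n M)) : tInd n M (tInd n M z) = 0 := by
  induction z using Ind.induction with
  | mk a v =>
    induction v using Ind.induction with
    | mk b m => rw [tInd_mk, tInd_mk_one, mul_assoc, tLast_mul_self, mul_zero, Ind.zero_mk]
    | add v w hv hw =>
      rw [Ind.mk_add]
      simp only [map_add]
      rw [hv, hw, add_zero]
  | add y z hy hz => simp only [map_add]; rw [hy, hz, add_zero]

theorem tInd_braid (z : Ind K (n + 2) (Ind K (n + 1) (Ind K n M))) :
    tInd (n + 1) (Ind K n M) (Ind.map (tInd n M) (tInd (n + 1) (Ind K n M) z)) =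
      Ind.map (tInd n M) (tInd (n + 1) (Ind K n M) (Ind.map (tInd n M) z)) := by
  suffices h : (tInd (n + 1) (Ind K n M)).comp ((Ind.map (tInd n M)).comp (tInd (n + 1) (Ind K n M))) =
      (Ind.map (tInd n M)).comp ((tInd (n + 1) (Ind K n M)).comp (Ind.map (tInd n M))) from
    LinearMap.congr_fun h z
  refine ind_ind_ind_hom_ext fun m => ?_
  simp only [LinearMap.comp_apply, Ind.map_mk, tInd_mk, map_one, one_mul, mul_one]
  rw [mk_smul_mk_one _ (tLast K n)]
  exact congrArg (fun c => Ind.mk c _) (threeStrand n).rsr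

end OneStep

section Cross

variable {M : Type u} [AddCommGroup M] [Module K M] [Module (NilHecke K (n + 1)) M]

theorem ind_res_induction {P : Ind K n (Res K n M) → Prop}
    (mk : ∀ a (m : M), P (Ind.mk a (Res.mk n M m))) (add : ∀ y z, P y → P z → P (y + z))
    (z : Ind K n (Res K n M)) : P z :=
  Ind.induction n (Res K n M) mk add z

variable [IsScalarTower K (NilHecke K (n + 1)) M]

theorem xRes_mk (m : M) : xRes n M (Res.mk (K := K) n M m) = Res.mk (K := K) n M (xLast K n • m) := rfl

theorem crossInd_mk (a : NilHecke K (n + 1)) (m : M) :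
    crossInd n M (Ind.mk a (Res.mk n M m)) = Ind.mk (incl K (n + 1) a * cross K n) m := rfl

theorem crossInd_smul (b : NilHecke K (n + 1)) (z : Ind K n (Res K n M)) :
    crossInd n M (b • z) = incl K (n + 1) b • crossInd n M z := map_smul (crossRes n M) b z

theorem proj_tau_mul_incl (b : NilHecke K (n + 1)) (m : M) :
    proj M (Ind.mk (tLast K n * incl K (n + 1) b) m) = Ind.mk 1 (Res.mk n M (b • m)) := by
  rw [Ind.mul_incl_mk, proj_tau_one]

/-- In `z τ = τ y + 1` the constant term falls into the polynomial part, which the projection kills.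
Only the slide of the dot through `τ` is left. -/
theorem proj_xLast_smul (z : Ind K (n + 1) M) :
    proj M (xLast K (n + 1) • z) = Ind.map (xRes n M) (proj M z) := by
  induction z using ind_succ_induction with
  | tau a m =>
    rw [Ind.smul_mk, ← mul_assoc, ← incl_mul_xLast, mul_assoc, xLast_mul_tLast, ← incl_xLast, mul_add,
      mul_one, Ind.add_mk, _root_.map_add, proj_incl, ← mul_assoc, proj_tau_incl, proj_tau, add_zero]
    rfl
  | pow k m => rw [Ind.smul_mk, ← pow_succ', proj_pow, proj_pow, _root_.map_zero]
  | add y z hy hz => simp only [smul_add, map_add, hy, hz]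

theorem proj_xInd (z : Ind K (n + 1) M) :
    proj M (xInd (n + 1) M z) = xInd n (Res K n M) (proj M z) := by
  induction z using ind_succ_induction with
  | tau a m =>
    rw [xInd_mk, mul_assoc, tLast_mul_xLast, ← incl_xLast, mul_add, mul_one, Ind.add_mk,
      _root_.map_add, proj_incl, ← mul_assoc, ← map_mul, proj_tau, proj_tau, add_zero, xInd_mk]
  | pow k m => rw [xInd_mk, ← pow_succ, proj_pow, proj_pow, _root_.map_zero]
  | add y z hy hz => simp only [map_add, hy, hz]

/-- The element `c` exchanges the last two variables, so the dot added on the right is carried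
across it. -/
theorem crossInd_xInd (z : Ind K n (Res K n M)) :
    crossInd n M (xInd n (Res K n M) z) = xInd (n + 1) M (crossInd n M z) := by
  induction z using ind_res_induction with
  | mk a m =>
    rw [xInd_mk, crossInd_mk, crossInd_mk, xInd_mk, map_mul, incl_xLast, mul_assoc, mul_assoc]
    rw [show xPrev K n * cross K n = cross K n * xLast K (n + 1) from
      ((twoStrand n).crossElt_mul_right).symm]
  | add y z hy hz => simp only [map_add, hy, hz]

theorem crossInd_map_xRes (z : Ind K n (Res K n M)) :
    crossInd n M (Ind.map (xRes n M) z) = xLast K (n + 1) • crossInd n M z := by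
  induction z using ind_res_induction with
  | mk a m =>
    rw [Ind.map_mk, xRes_mk, crossInd_mk, crossInd_mk, ← Ind.mul_incl_mk, incl_xLast, mul_assoc,
      show cross K n * xPrev K n = xLast K (n + 1) * cross K n from (twoStrand n).crossElt_mul_left,
      Ind.smul_mk, ← mul_assoc, ← mul_assoc, incl_mul_xLast]
  | add y z hy hz => simp only [map_add, smul_add, hy, hz]

/-- The double commutator form of `c`, with `τ` replaced by the tensor sign. -/
theorem proj_cross (m : M) :
    proj M (Ind.mk (cross K n) m) =
      Ind.mk (xLast K n * xLast K n) (Res.mk n M m) -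
        (2 : ℕ) • Ind.mk (xLast K n) (Res.mk n M (xLast K n • m)) +
          Ind.mk 1 (Res.mk n M (xLast K n • xLast K n • m)) := by
  rw [show cross K n = _ from (twoStrand n).crossElt_eq, ← incl_xLast, two_mul, ← map_mul, Ind.add_mk,
    Ind.sub_mk, Ind.add_mk, _root_.map_add, _root_.map_sub, _root_.map_add, proj_tau, proj_tau_incl,
    proj_tau_mul_incl, mul_smul, two_nsmul]

/-- The three terms of `proj_cross` are the expanded square of the difference of the two dots. -/
theorem proj_crossInd (z : Ind K n (Res K n M)) :
    proj M (crossInd n M z) =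
      (xInd n (Res K n M) (xInd n (Res K n M) z - Ind.map (xRes n M) z) -
        Ind.map (xRes n M) (xInd n (Res K n M) z - Ind.map (xRes n M) z)) := by
  induction z using ind_res_induction with
  | mk a m =>
    rw [crossInd_mk, proj_incl_mul, proj_cross]
    simp only [map_sub, Ind.map_mk, xInd_mk, xRes_mk, smul_add, smul_sub, Ind.smul_mk, mul_one, two_nsmul, mul_assoc]
    abel
  | add y z hy hz =>
    simp only [map_add, map_sub] at hy hz ⊢
    rw [hy, hz]
    abel

/-- On terms with `τ` the form of `c` in `z` gives the square of right minus left multiplication by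
`z`. On powers of `z` the projection vanishes, and so does that difference. -/
theorem crossInd_proj (z : Ind K (n + 1) M) :
    crossInd n M (proj M z) =
      (xInd (n + 1) M (xInd (n + 1) M z - xLast K (n + 1) • z) -
        xLast K (n + 1) • (xInd (n + 1) M z - xLast K (n + 1) • z)) := by
  induction z using ind_succ_induction with
  | tau a m =>
    have h := incl_mul_xLast a
    have h' : ∀ c, xLast K (n + 1) * (incl K (n + 1) a * c) = incl K (n + 1) a * (xLast K (n + 1) * c) :=
      fun c => by rw [← mul_assoc, ← h, mul_assoc]
    rw [proj_tau, crossInd_mk, show cross K n = _ from (twoStrand n).crossElt_eq']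
    simp only [xInd_mk, Ind.smul_mk, mul_assoc, h', ← Ind.sub_mk, two_mul, ← mul_sub, ← mul_add]
    congr 2
    noncomm_ring
  | pow k m =>
    rw [proj_pow, _root_.map_zero, xInd_mk, Ind.smul_mk, ← pow_succ, ← pow_succ', sub_self,
      _root_.map_zero, smul_zero, sub_self]
  | add y z hy hz =>
    simp only [map_add, map_sub, smul_add, smul_sub] at hy hz ⊢
    rw [hy, hz]
    abel

theorem proj_tau_pow (k : ℕ) (m : M) :
    proj M (Ind.mk (tLast K n * xLast K (n + 1) ^ k) m) = Ind.mk (xLast K n ^ k) (Res.mk n M m) := by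
  induction k with
  | zero => rw [pow_zero, mul_one, pow_zero, proj_tau_one]
  | succ k ih => rw [pow_succ, ← mul_assoc, ← xInd_mk, proj_xInd, ih, xInd_mk, pow_succ]

/-- A dot is moved to the left through `τ`; the error is a power of the dot times `c`, whose
projection is known. The start is `tau_mul_crossElt`. -/
theorem proj_tau_pow_cross (k : ℕ) (m : M) :
    proj M (Ind.mk (tLast K n * xPrev K n ^ k * cross K n) m) =
      Ind.mk (xLast K n ^ k) (Res.mk n M (xLast K n • m)) -
        Ind.mk (xLast K n ^ (k + 1)) (Res.mk n M m) := by
  induction k with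
  | zero =>
    rw [pow_zero, mul_one, show tLast K n * cross K n = _ from (twoStrand n).tau_mul_crossElt,
      ← incl_xLast, Ind.sub_mk, Ind.sub_mk, _root_.map_sub, _root_.map_sub, proj_tau_mul_incl, proj_tau,
      ← map_one (incl K (n + 1)), proj_incl, sub_zero, pow_zero, zero_add, pow_one]
  | succ k ih =>
    have h : tLast K n * xPrev K n ^ (k + 1) * cross K n =
        xLast K (n + 1) * (tLast K n * xPrev K n ^ k * cross K n) -
          incl K (n + 1) (xLast K n ^ k) * cross K n := by
      rw [pow_succ', ← mul_assoc, (twoStrand n).sy, map_pow, incl_xLast]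
      noncomm_ring
    rw [h, Ind.sub_mk, ← Ind.smul_mk, _root_.map_sub, proj_xLast_smul, ih, proj_incl_mul, proj_cross]
    simp only [map_sub, Ind.map_mk, xRes_mk, smul_add, smul_sub, Ind.smul_mk, mul_one,
      two_nsmul, pow_succ, mul_assoc]
    abel

/-- The mirror image, with dots moved to the right through `τ`. -/
theorem proj_cross_pow_tau (k : ℕ) (m : M) :
    proj M (Ind.mk (cross K n * xPrev K n ^ k * tLast K n) m) =
      Ind.mk (xLast K n) (Res.mk n M (xLast K n ^ k • m)) -
        Ind.mk 1 (Res.mk n M (xLast K n ^ (k + 1) • m)) := by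
  induction k with
  | zero =>
    rw [pow_zero, mul_one, show cross K n * tLast K n = _ from (twoStrand n).crossElt_mul_tau,
      ← incl_xLast, Ind.sub_mk, Ind.sub_mk, _root_.map_sub, _root_.map_sub, proj_tau_mul_incl, proj_tau,
      ← map_one (incl K (n + 1)), proj_incl, sub_zero, pow_zero, zero_add, pow_one, one_smul]
  | succ k ih =>
    have h : cross K n * xPrev K n ^ (k + 1) * tLast K n =
        cross K n * xPrev K n ^ k * tLast K n * xLast K (n + 1) -
          cross K n * incl K (n + 1) (xLast K n ^ k) := by
      have h1 : xPrev K n * tLast K n = tLast K n * xLast K (n + 1) - 1 := by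
        rw [(twoStrand n).sz, add_sub_cancel_right]
      rw [pow_succ, mul_assoc, mul_assoc, h1, map_pow, incl_xLast]
      noncomm_ring
    rw [h, Ind.sub_mk, ← xInd_mk, _root_.map_sub, proj_xInd, ih, Ind.mul_incl_mk, proj_cross]
    simp only [map_sub, xInd_mk, two_nsmul, pow_succ', mul_smul, one_mul]
    abel

end Cross

end Relations

end TwoRepSl2

end

/-! ### Braid relations: two restrictions and an induction, and two inductions after `T_{10}`. -/

noncomputable section

namespace TwoRepSl2

section BraidRelations

open NilHecke

variable {K : Type u} [Field K] {n : ℕ}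

theorem incl_cross : incl K (n + 2) (cross K n) =
    crossElt (incl K (n + 2) (xPrev K n)) (xPrev K (n + 1)) (incl K (n + 2) (tLast K n)) := by
  simp only [cross, crossElt, map_mul, map_sub, map_add, map_one, incl_xLast]

section

variable {M : Type u} [AddCommGroup M] [Module K M] [Module (NilHecke K (n + 2)) M]
  [IsScalarTower K (NilHecke K (n + 2)) M]

theorem tRes_mk (m : M) :
    tRes n M (Res.mk (K := K) n (Res K (n + 1) M) (Res.mk (K := K) (n + 1) M m)) =
      Res.mk (K := K) n (Res K (n + 1) M) (Res.mk (K := K) (n + 1) M (-(tLast K n • m))) := rfl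

/-- Projecting twice. -/
theorem proj_proj_smul (b : NilHecke K (n + 1)) (z : Ind K (n + 2) M) :
    proj (Res K (n + 1) M) (proj M (incl K (n + 2) (incl K (n + 1) b) • z)) =
      b • proj (Res K (n + 1) M) (proj M z) := by
  rw [proj_smul, proj_smul]

/-- Since `τ² = 0`, moving a dot out of `τ y^j τ` leaves only terms `y^i τ`, up to left
multiplication by `z`. The first projection strips the `τ` and the second kills the power. -/
theorem proj_proj_tau_pow_tau (j : ℕ) (m : M) :
    proj (Res K (n + 1) M)
      (proj M (Ind.mk (tLast K (n + 1) * xPrev K (n + 1) ^ j * tLast K (n + 1)) m)) = 0 := by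
  induction j with
  | zero => rw [pow_zero, mul_one, tLast_mul_self, Ind.zero_mk, map_zero, map_zero]
  | succ j ih =>
    have h : tLast K (n + 1) * xPrev K (n + 1) ^ (j + 1) * tLast K (n + 1) =
        xLast K (n + 2) * (tLast K (n + 1) * xPrev K (n + 1) ^ j * tLast K (n + 1)) -
          incl K (n + 2) (xLast K (n + 1) ^ j) * tLast K (n + 1) := by
      rw [pow_succ', ← mul_assoc, (twoStrand (n + 1)).sy, map_pow, incl_xLast]
      noncomm_ring
    rw [h, Ind.sub_mk, ← Ind.smul_mk, map_sub, proj_xLast_smul, proj_tau, map_sub, proj_pow, sub_zero,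
      proj_map, ih, map_zero]

/-- Only terms with two nested crossings survive both projections, and there the braid relation
moves the outer `τ` to the inner one. -/
theorem proj_proj_tRes (z : Ind K (n + 2) M) :
    proj (Res K (n + 1) M) (proj M (-(tLast K (n + 1) • z))) =
      Ind.map (tRes n M) (proj (Res K (n + 1) M) (proj M z)) := by
  induction z using ind_succ_induction with
  | add y z hy hz => simp only [smul_add, map_add, neg_add, hy, hz]
  | pow k m =>
    rw [Ind.smul_mk, map_neg, map_neg, proj_tau_pow, proj_pow, proj_pow, map_zero, map_zero, neg_zero]
  | tau a m =>
    induction a using hecke_induction with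
    | add c d hc hd =>
      simp only [map_add, add_mul, Ind.add_mk, smul_add, neg_add] at hc hd ⊢
      rw [hc, hd]
    | pow b j =>
      have h : tLast K (n + 1) *
          (incl K (n + 2) (incl K (n + 1) b * xLast K (n + 1) ^ j) * tLast K (n + 1)) =
          incl K (n + 2) (incl K (n + 1) b) *
            (tLast K (n + 1) * xPrev K (n + 1) ^ j * tLast K (n + 1)) := by
        have hb := tLast_comm (n + 1) b
        rw [map_mul, map_pow, incl_xLast]
        simp only [← mul_assoc]
        rw [← hb]
      rw [Ind.smul_mk, h, map_neg, map_neg, proj_tau, proj_incl_mul_pow, map_zero, ← Ind.smul_mk,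
        proj_proj_smul, proj_proj_tau_pow_tau, smul_zero, neg_zero]
    | tau b b' =>
      -- The outer crossing commutes with `b` and `b'`, so the three crossings become adjacent and a
      -- braid move applies.
      have h : tLast K (n + 1) *
          (incl K (n + 2) (incl K (n + 1) b * tLast K n * incl K (n + 1) b') * tLast K (n + 1)) =
          incl K (n + 2) (incl K (n + 1) b * tLast K n) * tLast K (n + 1) *
            incl K (n + 2) (tLast K n * incl K (n + 1) b') := by
        have hb := tLast_comm (n + 1) b
        have hb' := tLast_comm (n + 1) b'
        have hr := (threeStrand (K := K) n).rsr
        simp only [map_mul]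
        calc _ = tLast K (n + 1) * incl K (n + 2) (incl K (n + 1) b) * incl K (n + 2) (tLast K n) *
              (incl K (n + 2) (incl K (n + 1) b') * tLast K (n + 1)) := by simp only [mul_assoc]
          _ = incl K (n + 2) (incl K (n + 1) b) * (tLast K (n + 1) * incl K (n + 2) (tLast K n) *
              tLast K (n + 1)) * incl K (n + 2) (incl K (n + 1) b') := by
            rw [hb, ← hb']; simp only [mul_assoc]
          _ = _ := by rw [hr]; simp only [mul_assoc]
      rw [Ind.smul_mk, h, map_neg, map_neg, proj_tau_incl, proj_tau, proj_tau, proj_tau_incl, Ind.map_mk,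
        mul_smul, ← Ind.mk_neg]
      rfl

/-- The content is `cross_braid`: the product of the two elements `c` turns the later crossing into
the earlier one. -/
theorem cross_cross_tRes (z : Ind K n (Res K n (Res K (n + 1) M))) :
    -(tLast K (n + 1) • crossInd (n + 1) M (crossInd n (Res K (n + 1) M) z)) =
      crossInd (n + 1) M (crossInd n (Res K (n + 1) M) (Ind.map (tRes n M) z)) := by
  have key : ∀ a (m : M), 
      -(tLast K (n + 1) • crossInd (n + 1) M (crossInd n (Res K (n + 1) M)
        (Ind.mk a (Res.mk n _ (Res.mk (n + 1) M m))))) =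
      crossInd (n + 1) M (crossInd n (Res K (n + 1) M) (Ind.map (tRes n M)
        (Ind.mk a (Res.mk n _ (Res.mk (n + 1) M m))))) := by
    intro a m
    have h : tLast K (n + 1) * (incl K (n + 2) (cross K n) * cross K (n + 1)) =
        incl K (n + 2) (cross K n) * cross K (n + 1) * incl K (n + 2) (tLast K n) := by
      have := (threeStrand (K := K) n).cross_braid
      rwa [← incl_cross] at this
    have ha := tLast_comm (n + 1) a
    rw [Ind.map_mk, tRes_mk, crossInd_mk, crossInd_mk, crossInd_mk, crossInd_mk, Ind.smul_mk, Ind.mk_neg,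
      ← Ind.mul_incl_mk, map_mul, mul_assoc, ← mul_assoc, ha, mul_assoc, h]
    simp only [mul_assoc]
  induction z using ind_res_induction with
  | mk a m => exact key a m
  | add y z hy hz => simp only [map_add, smul_add, neg_add, hy, hz]

end

section

variable {M : Type u} [AddCommGroup M] [Module K M] [Module (NilHecke K (n + 1)) M]
  [IsScalarTower K (NilHecke K (n + 1)) M]

/-- Both sides are linear over `H_{n+2}`, so evaluation on `1 ⊗ (1 ⊗ m)` leaves exactly
`cross_braid'`. -/
theorem tInd_map_cross (z : Ind K (n + 1) (Ind K n (Res K n M))) :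
    crossInd (n + 1) (Ind K (n + 1) M) (Ind.map (crossRes n M) (tInd n (Res K n M) z)) =
      tInd (n + 1) M (crossInd (n + 1) (Ind K (n + 1) M) (Ind.map (crossRes n M) z)) := by
  let f := (crossRes (n + 1) (Ind K (n + 1) M)).comp ((Ind.map (crossRes n M)).comp (tInd n (Res K n M)))
  let g := (Res.map (n + 2) (tInd (n + 1) M)).comp
    ((crossRes (n + 1) (Ind K (n + 1) M)).comp (Ind.map (crossRes n M)))
  suffices h : f = g from LinearMap.congr_fun h z
  refine ind_ind_hom_ext fun m => ?_
  obtain ⟨m, rfl⟩ : ∃ m', Res.mk (K := K) n M m' = m := ⟨m, rfl⟩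
  have h := (threeStrand (K := K) n).cross_braid'
  rw [← incl_cross] at h
  change Ind.mk (incl K (n + 2) (1 * (incl K (n + 1) 1 * tLast K n)) * cross K (n + 1))
    (Ind.mk (incl K (n + 1) 1 * cross K n) m) = tInd (n + 1) M (Ind.mk (incl K (n + 2) 1 * cross K (n + 1))
    (Ind.mk (incl K (n + 1) 1 * cross K n) m))
  simp only [map_one, one_mul]
  rw [tInd_mk, mk_smul_mk_one]
  refine congrArg (fun c => Ind.mk c (Ind.mk 1 m)) ?_
  rw [mul_assoc]
  exact h

end

end BraidRelations

end TwoRepSl2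

end

/-! ### The relation with one restriction and two inductions, and the two divided differences. -/

noncomputable section

namespace TwoRepSl2

section MixedBraidRelations

open NilHecke

variable {K : Type u} [Field K] {n : ℕ}

section

variable {M : Type u} [AddCommGroup M] [Module K M] [Module (NilHecke K (n + 1)) M]
  [IsScalarTower K (NilHecke K (n + 1)) M]

variable (M) in
/-- The composite `H_{n+3} ⊗ (H_{n+2} ⊗ M) → H_{n+2} ⊗ (H_{n+2} ⊗ M) → H_{n+2} ⊗ (H_{n+1} ⊗ M)` of two
projections. -/
def projProj : Ind K (n + 2) (Ind K (n + 1) M) →ₗ[K] Ind K (n + 1) (Ind K n (Res K n M)) :=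
  ((Ind.map (projRes M)).restrictScalars K).comp (proj (Ind K (n + 1) M))

theorem projProj_smul (b : NilHecke K (n + 2)) (z : Ind K (n + 2) (Ind K (n + 1) M)) :
    projProj M (incl K (n + 2) b • z) = b • projProj M z := by
  change Ind.map (projRes M) (proj (Ind K (n + 1) M) (incl K (n + 2) b • z)) = _
  rw [proj_smul, map_smul]
  rfl

theorem projProj_tau (a : NilHecke K (n + 2)) (v : Ind K (n + 1) M) :
    projProj M (Ind.mk (incl K (n + 2) a * tLast K (n + 1)) v) = Ind.mk a (proj M v) := by
  change Ind.map (projRes M) (proj (Ind K (n + 1) M) _) = _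
  rw [proj_tau]
  rfl

theorem projProj_xLast_smul (z : Ind K (n + 2) (Ind K (n + 1) M)) :
    projProj M (xLast K (n + 2) • z) = Ind.map (Ind.map (xRes n M)) (projProj M z) := by
  have e : (projRes M).comp (xRes (n + 1) (Ind K (n + 1) M)) =
      (Ind.map (xRes n M)).comp (projRes M) := LinearMap.ext fun v => proj_xLast_smul (M := M) v
  change Ind.map (projRes M) (proj (Ind K (n + 1) M) _) = _
  rw [proj_xLast_smul, ← LinearMap.comp_apply, ← Ind.map_comp, e, Ind.map_comp]
  rfl

/-- As for two restrictions, except that the second projection now kills the inner tensor `1 ⊗ m`.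
-/
theorem projProj_tau_pow_tau (j : ℕ) (m : M) :
    projProj M (Ind.mk (tLast K (n + 1) * xPrev K (n + 1) ^ j * tLast K (n + 1)) (Ind.mk 1 m)) = 0 := by
  induction j with
  | zero => rw [pow_zero, mul_one, tLast_mul_self, Ind.zero_mk, map_zero]
  | succ j ih =>
    have h : tLast K (n + 1) * xPrev K (n + 1) ^ (j + 1) * tLast K (n + 1) =
        xLast K (n + 2) * (tLast K (n + 1) * xPrev K (n + 1) ^ j * tLast K (n + 1)) -
          incl K (n + 2) (xLast K (n + 1) ^ j) * tLast K (n + 1) := by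
      rw [pow_succ', ← mul_assoc, (twoStrand (n + 1)).sy, map_pow, incl_xLast]
      noncomm_ring
    rw [h, Ind.sub_mk, ← Ind.smul_mk, map_sub, projProj_xLast_smul, projProj_tau, ih, map_zero,
      ← map_one (incl K (n + 1)), proj_incl, Ind.mk_zero, sub_zero]

theorem projProj_pow_tau (k : ℕ) (m : M) :
    projProj M (Ind.mk (xLast K (n + 2) ^ k * tLast K (n + 1)) (Ind.mk 1 m)) = 0 := by
  induction k with
  | zero =>
    have h := projProj_tau 1 (Ind.mk (1 : NilHecke K (n + 2)) m)
    rw [map_one, one_mul, ← map_one (incl K (n + 1)), proj_incl, Ind.mk_zero] at h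
    rwa [pow_zero, one_mul, ← map_one (incl K (n + 1))]
  | succ k ih => rw [pow_succ', mul_assoc, ← Ind.smul_mk, projProj_xLast_smul, ih, map_zero]

/-- Terms with fewer than two crossings are killed on both sides; on the rest a braid move
identifies the results. -/
theorem tInd_projProj (z : Ind K (n + 2) (Ind K (n + 1) M)) :
    tInd n (Res K n M) (projProj M z) = projProj M (tInd (n + 1) M z) := by
  induction z using ind_succ_induction with
  | add y z hy hz => simp only [map_add, hy, hz]
  | pow k v =>
    change tInd n (Res K n M) (Ind.map (projRes M) (proj (Ind K (n + 1) M) _)) = _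
    rw [proj_pow, map_zero, map_zero]
    induction v using Ind.induction with
    | add v w hv hw => rw [Ind.mk_add, map_add, map_add, ← hv, ← hw, add_zero]
    | mk b m =>
      rw [tInd_mk, ← (show Commute _ _ from incl_mul_xLast b).pow_right k |>.eq, mul_assoc, ← Ind.smul_mk,
        projProj_smul, projProj_pow_tau, smul_zero]
  | tau a v =>
    rw [projProj_tau]
    induction v using ind_succ_induction with
    | add v w hv hw => simp only [Ind.mk_add, map_add, hv, hw]
    | pow k m =>
      rw [proj_pow, Ind.mk_zero, map_zero, tInd_mk, map_pow, incl_xLast, mul_assoc, mul_assoc,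
        ← mul_assoc (tLast K (n + 1)), ← Ind.smul_mk, projProj_smul, projProj_tau_pow_tau, smul_zero]
    | tau b m =>
      have h : incl K (n + 2) a * tLast K (n + 1) * incl K (n + 2) (incl K (n + 1) b * tLast K n) *
          tLast K (n + 1) = incl K (n + 2) (a * incl K (n + 1) b * tLast K n) * tLast K (n + 1) *
            incl K (n + 2) (tLast K n) := by
        have hb := tLast_comm (n + 1) b
        have hr := (threeStrand (K := K) n).rsr
        simp only [map_mul]
        calc _ = incl K (n + 2) a * (tLast K (n + 1) * incl K (n + 2) (incl K (n + 1) b)) *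
              incl K (n + 2) (tLast K n) * tLast K (n + 1) := by simp only [mul_assoc]
          _ = incl K (n + 2) a * incl K (n + 2) (incl K (n + 1) b) *
              (tLast K (n + 1) * incl K (n + 2) (tLast K n) * tLast K (n + 1)) := by
            rw [hb]; simp only [mul_assoc]
          _ = _ := by rw [hr]; simp only [mul_assoc]
      rw [proj_tau, tInd_mk, tInd_mk, h, Ind.mul_incl_mk, projProj_tau, Ind.smul_mk, mul_one, proj_tau_one]

end

section

variable {M : Type u} [AddCommGroup M] [Module K M] [Module (NilHecke K (n + 1)) M]
  [IsScalarTower K (NilHecke K (n + 1)) M]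

/-- The second bracket is zero, because on powers of the last variable left and right multiplication
agree. It is kept to match the full divided difference. -/
theorem proj_tau_cross_pow (k : ℕ) (m : M) :
    proj M (tLast K n • crossInd n M (Ind.mk (xLast K n ^ k) (Res.mk n M m))) =
      (Ind.map (xRes n M) (Ind.mk (xLast K n ^ k) (Res.mk n M m)) -
          xInd n (Res K n M) (Ind.mk (xLast K n ^ k) (Res.mk n M m))) +
        (xLast K n • Ind.mk (xLast K n ^ k) (Res.mk n M m) -
          xInd n (Res K n M) (Ind.mk (xLast K n ^ k) (Res.mk n M m))) := by
  rw [crossInd_mk, Ind.smul_mk, map_pow, incl_xLast, ← mul_assoc, proj_tau_pow_cross, Ind.map_mk, xRes_mk,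
    xInd_mk, Ind.smul_mk, ← pow_succ, ← pow_succ', sub_self, add_zero]

end

section

variable {M : Type u} [AddCommGroup M] [Module K M] [Module (NilHecke K (n + 2)) M]
  [IsScalarTower K (NilHecke K (n + 2)) M]

/-- The cubic terms of `tau_tau_cross` are exactly what the other composite contributes, with
opposite sign; the linear terms form the divided difference. -/
theorem cross_tRes_proj_tau (m : M) :
    crossInd n (Res K (n + 1) M) (Ind.map (tRes n M) (proj (Res K (n + 1) M)
        (Ind.mk (tLast K n) (Res.mk (n + 1) M m)))) +
      proj M (tLast K (n + 1) • crossInd (n + 1) M (Ind.mk (tLast K n) (Res.mk (n + 1) M m))) =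
      (Ind.map (xRes (n + 1) M) (Ind.mk (tLast K n) (Res.mk (n + 1) M m)) -
          xInd (n + 1) (Res K (n + 1) M) (Ind.mk (tLast K n) (Res.mk (n + 1) M m))) +
        (xLast K (n + 1) • Ind.mk (tLast K n) (Res.mk (n + 1) M m) -
          xInd (n + 1) (Res K (n + 1) M) (Ind.mk (tLast K n) (Res.mk (n + 1) M m))) := by
  have h : tLast K (n + 1) * (incl K (n + 2) (tLast K n) * cross K (n + 1)) =
      incl K (n + 2) ((xPrev K n - xLast K (n + 1)) * (xPrev K n - xLast K (n + 1)) * tLast K n) *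
          tLast K (n + 1) * incl K (n + 2) (tLast K n) +
        incl K (n + 2) ((xLast K (n + 1) - 2 * xPrev K n) * tLast K n) * tLast K (n + 1) +
        incl K (n + 2) (tLast K n) * tLast K (n + 1) * incl K (n + 2) (xLast K (n + 1)) -
        incl K (n + 2) 2 * tLast K (n + 1) +
        incl K (n + 2) (xPrev K n - xLast K (n + 1)) * tLast K (n + 1) * incl K (n + 2) (tLast K n) := by
    have := (threeStrand (K := K) n).tau_tau_cross
    simp only [map_mul, map_sub, map_ofNat, incl_xLast]
    rw [← mul_assoc]
    exact this
  -- This form of `c` is aligned with the first and last terms of `h`, so that they cancel.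
  have e : cross K n = (xPrev K n - xLast K (n + 1)) * (xPrev K n - xLast K (n + 1)) * tLast K n +
      (xPrev K n - xLast K (n + 1)) := by
    rw [cross, crossElt, mul_add, mul_one, mul_assoc]
  rw [proj_tau_one, Ind.map_mk, tRes_mk, crossInd_mk, crossInd_mk, Ind.smul_mk, h, map_one, one_mul, e]
  simp only [Ind.add_mk, Ind.sub_mk, map_add (proj M), map_sub (proj M), proj_tau, proj_tau_incl]
  have e' : (xLast K (n + 1) - 2 * xPrev K n) * tLast K n =
      xLast K (n + 1) * tLast K n - xPrev K n * tLast K n - xPrev K n * tLast K n := by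
    noncomm_ring
  rw [Ind.map_mk, xRes_mk, xInd_mk, Ind.smul_mk, tLast_mul_xLast, map_neg, e',
    show (2 : NilHecke K (n + 2)) = 1 + 1 from one_add_one_eq_two.symm]
  simp only [Ind.add_mk, Ind.sub_mk, Ind.mk_neg]
  abel

/-- The sign of `T_{00} = -τ` turns the difference of the two composites into this sum. -/
theorem cross_tRes_proj (z : Ind K (n + 1) (Res K (n + 1) M)) :
    crossInd n (Res K (n + 1) M) (Ind.map (tRes n M) (proj (Res K (n + 1) M) z)) +
      proj M (tLast K (n + 1) • crossInd (n + 1) M z) =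
      (Ind.map (xRes (n + 1) M) z - xInd (n + 1) (Res K (n + 1) M) z) +
        (xLast K (n + 1) • z - xInd (n + 1) (Res K (n + 1) M) z) := by
  induction z using ind_succ_induction with
  | add y z hy hz =>
    simp only [map_add, smul_add]
    rw [add_add_add_comm, hy, hz]
    abel
  | pow k m =>
    rw [proj_pow, map_zero, map_zero, zero_add]
    exact proj_tau_cross_pow (n := n + 1) (M := M) k m
  | tau a m =>
    -- All maps commute with `H_{n+1}`, so the coefficient `a` can be pulled out and the case `a =
    -- 1` suffices.
    have h1 : ∀ v : Ind K (n + 2) M, tLast K (n + 1) • incl K (n + 2) (incl K (n + 1) a) • v =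
        incl K (n + 2) (incl K (n + 1) a) • tLast K (n + 1) • v := fun v => by
      rw [smul_smul, tLast_comm, mul_smul]
    have h2 : ∀ v : Ind K (n + 1) (Res K (n + 1) M), xLast K (n + 1) • incl K (n + 1) a • v =
        incl K (n + 1) a • xLast K (n + 1) • v := fun v => by
      rw [smul_smul, ← incl_mul_xLast, mul_smul]
    obtain ⟨m, rfl⟩ : ∃ m', Res.mk (K := K) (n + 1) M m' = m := ⟨m, rfl⟩
    rw [← Ind.smul_mk, proj_smul, (Ind.map (tRes n M)).map_smul, crossInd_smul, crossInd_smul, h1,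
      proj_smul, (Ind.map (xRes (n + 1) M)).map_smul, (xInd (n + 1) (Res K (n + 1) M)).map_smul, h2, ← smul_add, cross_tRes_proj_tau, smul_add, smul_sub, smul_sub]

end

section

variable {M : Type u} [AddCommGroup M] [Module K M] [Module (NilHecke K n) M]
  [IsScalarTower K (NilHecke K n) M]

/-- Now the first bracket vanishes, since it compares left and right dots on a power of the last
variable. -/
theorem proj_tInd_cross_pow (k : ℕ) (m : M) :
    proj (Ind K n M) (tInd n M (crossInd n (Ind K n M)
        (Ind.mk 1 (Res.mk n (Ind K n M) (Ind.mk (xLast K n ^ k) m))))) =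
      (Ind.map (Res.map n (xInd n M)) (Ind.mk 1 (Res.mk n (Ind K n M) (Ind.mk (xLast K n ^ k) m))) -
          Ind.map (xRes n (Ind K n M)) (Ind.mk 1 (Res.mk n (Ind K n M) (Ind.mk (xLast K n ^ k) m)))) +
        (xInd n (Res K n (Ind K n M)) (Ind.mk 1 (Res.mk n (Ind K n M) (Ind.mk (xLast K n ^ k) m))) -
          Ind.map (xRes n (Ind K n M)) (Ind.mk 1 (Res.mk n (Ind K n M) (Ind.mk (xLast K n ^ k) m)))) := by
  have e : Ind.map (Res.map n (xInd n M)) (Ind.mk 1 (Res.mk n (Ind K n M) (Ind.mk (xLast K n ^ k) m))) =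
      Ind.mk 1 (Res.mk n (Ind K n M) (Ind.mk (xLast K n ^ k * xLast K n) m)) := rfl
  rw [e, Ind.map_mk, xRes_mk, xInd_mk, crossInd_mk, map_one, one_mul, tInd_mk, map_pow, incl_xLast,
    proj_cross_pow_tau, Ind.smul_mk, Ind.smul_mk, Ind.smul_mk, mul_one, mul_one, one_mul, ← pow_succ, ← pow_succ',
    sub_self, zero_add]

end

section

variable {M : Type u} [AddCommGroup M] [Module K M] [Module (NilHecke K (n + 1)) M]
  [IsScalarTower K (NilHecke K (n + 1)) M]

/-- Via `cross_tau_tau` every term becomes a tensor of the form `a ⊗ (b ⊗ m)`. What remains is to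
move `y`, which lies in `H_{n+1}`, across the tensor sign until equal terms can be compared. -/
theorem proj_tInd_cross_tau (m : M) :
    proj (Ind K (n + 1) M) (tInd (n + 1) M (crossInd (n + 1) (Ind K (n + 1) M)
        (Ind.mk 1 (Res.mk (n + 1) (Ind K (n + 1) M) (Ind.mk (tLast K n) m))))) =
      Ind.map (crossRes n M) (tInd n (Res K n M) (Ind.map (projRes M)
        (Ind.mk 1 (Res.mk (n + 1) (Ind K (n + 1) M) (Ind.mk (tLast K n) m))))) +
      ((Ind.map (Res.map (n + 1) (xInd (n + 1) M)) (Ind.mk 1 (Res.mk (n + 1) (Ind K (n + 1) M) (Ind.mk (tLast K n) m))) -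
          Ind.map (xRes (n + 1) (Ind K (n + 1) M)) (Ind.mk 1 (Res.mk (n + 1) (Ind K (n + 1) M) (Ind.mk (tLast K n) m)))) +
        (xInd (n + 1) (Res K (n + 1) (Ind K (n + 1) M)) (Ind.mk 1 (Res.mk (n + 1) (Ind K (n + 1) M) (Ind.mk (tLast K n) m))) -
          Ind.map (xRes (n + 1) (Ind K (n + 1) M)) (Ind.mk 1 (Res.mk (n + 1) (Ind K (n + 1) M) (Ind.mk (tLast K n) m))))) := by
  have e1 : Ind.map (Res.map (n + 1) (xInd (n + 1) M)) (Ind.mk 1 (Res.mk (n + 1) (Ind K (n + 1) M) (Ind.mk (tLast K n) m))) =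
      Ind.mk 1 (Res.mk (n + 1) (Ind K (n + 1) M) (Ind.mk (tLast K n * xLast K (n + 1)) m)) := rfl
  have e2 : Ind.map (projRes M) (Ind.mk 1 (Res.mk (n + 1) (Ind K (n + 1) M) (Ind.mk (tLast K n) m))) =
      Ind.mk 1 (Ind.mk 1 (Res.mk n M m)) := congrArg (Ind.mk 1) (proj_tau_one m)
  have e3 : Ind.map (crossRes n M) (Ind.mk (tLast K n) (Ind.mk 1 (Res.mk n M m))) =
      Ind.mk (tLast K n) (Res.mk (n + 1) (Ind K (n + 1) M) (Ind.mk (cross K n) m)) := by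
    have := crossInd_mk (1 : NilHecke K (n + 1)) m
    rw [map_one, one_mul] at this
    exact congrArg (Ind.mk (tLast K n)) this
  have h : cross K (n + 1) * incl K (n + 2) (tLast K n) * tLast K (n + 1) =
      incl K (n + 2) (xLast K (n + 1) * xLast K (n + 1) * tLast K n) * tLast K (n + 1) *
          incl K (n + 2) (tLast K n) -
        incl K (n + 2) (xLast K (n + 1) * tLast K n) * tLast K (n + 1) *
          incl K (n + 2) (xLast K (n + 1) * tLast K n) -
        incl K (n + 2) (xLast K (n + 1) * tLast K n) * tLast K (n + 1) *
          incl K (n + 2) (xLast K (n + 1) * tLast K n) +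
        incl K (n + 2) (tLast K n) * tLast K (n + 1) *
          incl K (n + 2) (xLast K (n + 1) * xLast K (n + 1) * tLast K n) +
        incl K (n + 2) (xLast K (n + 1) * tLast K n) * tLast K (n + 1) -
        incl K (n + 2) (tLast K n) * tLast K (n + 1) * incl K (n + 2) (xLast K (n + 1)) := by
    have := (threeStrand (K := K) n).cross_tau_tau
    simp only [map_mul, incl_xLast]
    refine Eq.trans this ?_
    noncomm_ring
  have bal : ∀ (a b : NilHecke K (n + 2)), 
      Ind.mk (a * xPrev K n) (Res.mk (K := K) (n + 1) (Ind K (n + 1) M) (Ind.mk b m)) =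
        Ind.mk a (Res.mk (K := K) (n + 1) (Ind K (n + 1) M) (Ind.mk (xPrev K n * b) m)) := fun a b => by
    rw [← incl_xLast, Ind.mul_incl_mk]
    rfl
  -- Dots `z` do not cross the tensor sign, so they are first traded for dots `y` to the right of
  -- `τ`.
  have z1 : xLast K (n + 1) * tLast K n = tLast K n * xPrev K n + 1 := xLast_mul_tLast
  have z2 : xLast K (n + 1) * xLast K (n + 1) * tLast K n =
      tLast K n * xPrev K n * xPrev K n + xPrev K n + xLast K (n + 1) := by
    rw [mul_assoc, z1, mul_add, ← mul_assoc, z1, add_mul, one_mul, mul_one]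
  have hc : cross K n = xPrev K n * xPrev K n * tLast K n - (xPrev K n * (xLast K (n + 1) * tLast K n) + 
      xPrev K n * (xLast K (n + 1) * tLast K n)) + xLast K (n + 1) * xLast K (n + 1) * tLast K n +
      xPrev K n - xLast K (n + 1) := by
    have := (twoStrand (K := K) n).zy
    simp only [cross, crossElt, mul_add, mul_sub, sub_mul, mul_one, mul_assoc, mul_eq_assoc this]
    abel
  have bal1 : ∀ b : NilHecke K (n + 2),
      Ind.mk (xPrev K n) (Res.mk (K := K) (n + 1) (Ind K (n + 1) M) (Ind.mk b m)) =
        Ind.mk 1 (Res.mk (K := K) (n + 1) (Ind K (n + 1) M) (Ind.mk (xPrev K n * b) m)) := fun b => by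
    rw [← bal, one_mul]
  have b1 : Ind.mk (xLast K (n + 1) * xLast K (n + 1) * tLast K n)
        (Res.mk (K := K) (n + 1) (Ind K (n + 1) M) (Ind.mk (tLast K n) m)) =
      Ind.mk (tLast K n) (Res.mk (K := K) (n + 1) (Ind K (n + 1) M)
          (Ind.mk (xPrev K n * xPrev K n * tLast K n) m)) +
        Ind.mk 1 (Res.mk (K := K) (n + 1) (Ind K (n + 1) M) (Ind.mk (xPrev K n * tLast K n) m)) +
        Ind.mk (xLast K (n + 1)) (Res.mk (K := K) (n + 1) (Ind K (n + 1) M) (Ind.mk (tLast K n) m)) := by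
    rw [z2, Ind.add_mk, Ind.add_mk, bal, bal, bal1, mul_assoc]
  have b2 : ∀ b, Ind.mk (xLast K (n + 1) * tLast K n)
        (Res.mk (K := K) (n + 1) (Ind K (n + 1) M) (Ind.mk b m)) =
      Ind.mk (tLast K n) (Res.mk (K := K) (n + 1) (Ind K (n + 1) M) (Ind.mk (xPrev K n * b) m)) +
        Ind.mk 1 (Res.mk (K := K) (n + 1) (Ind K (n + 1) M) (Ind.mk b m)) := fun b => by
    rw [z1, Ind.add_mk, bal]
  rw [e1, e2, tInd_mk_one, one_mul, e3, crossInd_mk, map_one, one_mul, tInd_mk, h, Ind.map_mk, xRes_mk,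
    xInd_mk, one_mul, Ind.smul_mk, tLast_mul_xLast]
  simp only [Ind.add_mk, Ind.sub_mk, map_add (proj (Ind K (n + 1) M)), map_sub (proj (Ind K (n + 1) M)),
    proj_tau, proj_tau_incl, Ind.smul_mk, mul_one, b1, b2, hc, Ind.mk_add, Ind.mk_sub, map_add, map_sub]
  abel

/-- By linearity over `H_{n+2}` and then over `H_{n+1}`, it is enough to treat `1 ⊗ (τ ⊗ m)` and `1
⊗ (x^k ⊗ m)`. -/
theorem proj_tInd_cross (z : Ind K (n + 1) (Res K (n + 1) (Ind K (n + 1) M))) :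
    proj (Ind K (n + 1) M) (tInd (n + 1) M (crossInd (n + 1) (Ind K (n + 1) M) z)) =
      Ind.map (crossRes n M) (tInd n (Res K n M) (Ind.map (projRes M) z)) +
      ((Ind.map (Res.map (n + 1) (xInd (n + 1) M)) z - Ind.map (xRes (n + 1) (Ind K (n + 1) M)) z) +
        (xInd (n + 1) (Res K (n + 1) (Ind K (n + 1) M)) z -
          Ind.map (xRes (n + 1) (Ind K (n + 1) M)) z)) := by
  let f := (projRes (Ind K (n + 1) M)).comp ((Res.map (n + 2) (tInd (n + 1) M)).comp
    (crossRes (n + 1) (Ind K (n + 1) M)))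
  let g := (Ind.map (crossRes n M)).comp ((tInd n (Res K n M)).comp (Ind.map (projRes M))) +
    ((Ind.map (Res.map (n + 1) (xInd (n + 1) M)) - Ind.map (xRes (n + 1) (Ind K (n + 1) M))) +
      (xInd (n + 1) (Res K (n + 1) (Ind K (n + 1) M)) - Ind.map (xRes (n + 1) (Ind K (n + 1) M))))
  suffices h : f = g from LinearMap.congr_fun h z
  have htau : ∀ m, f (Ind.mk 1 (Res.mk (n + 1) (Ind K (n + 1) M) (Ind.mk (tLast K n) m))) =
    g (Ind.mk 1 (Res.mk (n + 1) (Ind K (n + 1) M) (Ind.mk (tLast K n) m))) := proj_tInd_cross_tau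
  have hg : ∀ z, g z = Ind.map (crossRes n M) (tInd n (Res K n M) (Ind.map (projRes M) z)) +
      ((Ind.map (Res.map (n + 1) (xInd (n + 1) M)) z - Ind.map (xRes (n + 1) (Ind K (n + 1) M)) z) +
        (xInd (n + 1) (Res K (n + 1) (Ind K (n + 1) M)) z -
          Ind.map (xRes (n + 1) (Ind K (n + 1) M)) z)) := fun _ => rfl
  have hpow : ∀ k m, f (Ind.mk 1 (Res.mk (n + 1) (Ind K (n + 1) M) (Ind.mk (xLast K (n + 1) ^ k) m))) =
      g (Ind.mk 1 (Res.mk (n + 1) (Ind K (n + 1) M) (Ind.mk (xLast K (n + 1) ^ k) m))) := by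
    intro k m
    have e : Ind.map (projRes M) (Ind.mk 1 (Res.mk (n + 1) (Ind K (n + 1) M)
        (Ind.mk (xLast K (n + 1) ^ k) m))) = 0 :=
      (congrArg (Ind.mk 1) (proj_pow k m)).trans (Ind.mk_zero 1)
    refine (proj_tInd_cross_pow (n := n + 1) k m).trans (Eq.symm ?_)
    rw [hg, e, map_zero, map_zero, zero_add]
  clear_value f g
  refine Ind.hom_ext fun v => ?_
  obtain ⟨v, rfl⟩ : ∃ v', Res.mk (K := K) (n + 1) (Ind K (n + 1) M) v' = v := ⟨v, rfl⟩
  induction v using ind_succ_induction with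
  | add v w hv hw => rw [map_add, Ind.mk_add, map_add, map_add, hv, hw]
  | pow k m => exact hpow k m
  | tau a m =>
    have e : Ind.mk (1 : NilHecke K (n + 2)) (Res.mk (K := K) (n + 1) (Ind K (n + 1) M)
        (Ind.mk (incl K (n + 1) a * tLast K n) m)) =
        incl K (n + 1) a • Ind.mk 1 (Res.mk (K := K) (n + 1) (Ind K (n + 1) M) (Ind.mk (tLast K n) m)) := by
      rw [Ind.smul_mk, mul_one, Ind.incl_mk]
      rfl
    rw [e, map_smul, map_smul, htau]

end

end MixedBraidRelations

end TwoRepSl2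

end

/-! ### Degrees and naturality of the operators. -/

noncomputable section

namespace TwoRepSl2

section Degrees

open NilHecke

variable {K : Type u} [Field K] {n : ℕ}

theorem xInd_mem {M : Type u} [AddCommGroup M] [Module K M] [Module (NilHecke K n) M]
    [IsScalarTower K (NilHecke K n) M] {gr : ℤ → Submodule K M} {d : ℤ} {z : Ind K n M}
    (hz : z ∈ indGr (n := n) gr d) : xInd n M z ∈ indGr (n := n) gr (d + 2) := by
  unfold indGr at hz
  induction hz using Submodule.span_induction with
  | zero => rw [map_zero]; exact Submodule.zero_mem _
  | add x y _ _ hx hy => rw [map_add]; exact Submodule.add_mem _ hx hy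
  | smul r x _ hx => rw [LinearMap.map_smul_of_tower]; exact Submodule.smul_mem _ r hx
  | mem z hz =>
    obtain ⟨i, j, a, m, rfl, ha, hm, rfl⟩ := hz
    rw [xInd_mk, add_right_comm]
    exact mk_mem_indGr (gr_mul ha gr_xLast) hm

theorem tInd_mem {M : Type u} [AddCommGroup M] [Module K M] [Module (NilHecke K n) M]
    [IsScalarTower K (NilHecke K n) M] {gr : ℤ → Submodule K M} {d : ℤ}
    {z : Ind K (n + 1) (Ind K n M)} (hz : z ∈ indGr (n := n + 1) (indGr (n := n) gr) d) :
    tInd n M z ∈ indGr (n := n + 1) (indGr (n := n) gr) (d + -2) := by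
  unfold indGr at hz
  induction hz using Submodule.span_induction with
  | zero => rw [map_zero]; exact Submodule.zero_mem _
  | add x y _ _ hx hy => rw [map_add]; exact Submodule.add_mem _ hx hy
  | smul r x _ hx => rw [LinearMap.map_smul_of_tower]; exact Submodule.smul_mem _ r hx
  | mem z hz =>
    obtain ⟨i, j, a, v, rfl, ha, hv, rfl⟩ := hz
    induction hv using Submodule.span_induction with
    | zero => rw [Ind.mk_zero, map_zero]; exact Submodule.zero_mem _
    | add x y _ _ hx hy => rw [Ind.mk_add, map_add]; exact Submodule.add_mem _ hx hy
    | smul r x _ hx =>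
      rw [Ind.mk_smul, LinearMap.map_smul_of_tower]
      exact Submodule.smul_mem _ r hx
    | mem v hv =>
      obtain ⟨k, l, b, m, rfl, hb, hm, rfl⟩ := hv
      rw [tInd_mk]
      have := mk_mem_indGr (n := n + 1) (gr := indGr (n := n) gr)
        (gr_mul (gr_mul ha (gr_incl hb)) gr_tLast) (mk_mem_indGr gr_one hm)
      rwa [show i + k + -2 + (0 + l) = i + (k + l) + -2 by ring] at this

variable {M : Type u} [AddCommGroup M] [Module K M] [Module (NilHecke K (n + 1)) M]
  [IsScalarTower K (NilHecke K (n + 1)) M] {gr : ℤ → Submodule K M}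

theorem proj_crossing_tLast (v : Ind K n (Res K n M)) :
    proj M (crossing (M := M) (tLast K n) (tLast_comm n) v) = v := by
  suffices h : (projRes M).comp (crossing (M := M) (tLast K n) (tLast_comm n)) = LinearMap.id from
    LinearMap.congr_fun h v
  exact Ind.hom_ext fun m => proj_tau (M := M) 1 m

/-- By `indGr_succ_eq` a homogeneous element is the image under `τ` of some `v` of degree `d + 2`
plus powers; the projection kills the powers and returns `v`. -/
theorem proj_mem [CharZero K] (h : IsGradedModule (n + 1) M gr) {d : ℤ} {z : Ind K (n + 1) M}
    (hz : z ∈ indGr (n := n + 1) gr d) :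
    proj M z ∈ indGr (n := n) (fun d => (gr d).comap (Res.val n M)) (d + 2) := by
  rw [indGr_succ_eq h] at hz
  obtain ⟨_, ⟨v, hv, rfl⟩, w, hw, rfl⟩ := Submodule.mem_sup.1 hz
  have h2 : proj M w = 0 := by
    have : powGr (n := n + 1) gr d ≤ LinearMap.ker (proj M) := by
      refine iSup_le fun k => ?_
      rintro _ ⟨m, _, rfl⟩
      exact proj_pow k m
    exact this hw
  rw [map_add, h2, add_zero]
  rw [← proj_crossing_tLast v] at hv
  exact hv

end Degrees

section Naturality

open NilHecke

variable {K : Type u} [Field K] {n : ℕ}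

theorem xInd_map {M N : Type u} [AddCommGroup M] [Module K M] [Module (NilHecke K n) M]
    [IsScalarTower K (NilHecke K n) M] [AddCommGroup N] [Module K N] [Module (NilHecke K n) N]
    [IsScalarTower K (NilHecke K n) N] (f : M →ₗ[NilHecke K n] N) (z : Ind K n M) :
    xInd n N (Ind.map f z) = Ind.map f (xInd n M z) := by
  induction z using Ind.induction with
  | mk a m => rfl
  | add y z hy hz => simp only [map_add, hy, hz]

theorem tInd_map {M N : Type u} [AddCommGroup M] [Module K M] [Module (NilHecke K n) M]
    [IsScalarTower K (NilHecke K n) M] [AddCommGroup N] [Module K N] [Module (NilHecke K n) N]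
    [IsScalarTower K (NilHecke K n) N] (f : M →ₗ[NilHecke K n] N) (z : Ind K (n + 1) (Ind K n M)) :
    tInd n N (Ind.map (Ind.map f) z) = Ind.map (Ind.map f) (tInd n M z) := by
  suffices h : (tInd n N).comp (Ind.map (Ind.map f)) = (Ind.map (Ind.map f)).comp (tInd n M) from
    LinearMap.congr_fun h z
  exact ind_ind_hom_ext fun m => rfl

variable {M : Type u} [AddCommGroup M] [Module K M] [Module (NilHecke K (n + 1)) M]
  [IsScalarTower K (NilHecke K (n + 1)) M] 
  {N : Type u} [AddCommGroup N] [Module K N] [Module (NilHecke K (n + 1)) N]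
  [IsScalarTower K (NilHecke K (n + 1)) N] 

theorem crossInd_map (f : M →ₗ[NilHecke K (n + 1)] N) (z : Ind K n (Res K n M)) :
    crossInd n N (Ind.map (Res.map n f) z) = Ind.map f (crossInd n M z) := by
  induction z using ind_res_induction with
  | mk a m => rfl
  | add y z hy hz => simp only [map_add, hy, hz]

end Naturality

section Data

variable {K : Type u} [Field K]

namespace NHFamily

variable (F : NHFamily K)

/-- The family of maps underlying `X_1`. -/
def xOne : F.ind.Maps F.ind
  | 0 => 0
  | n + 1 => xInd n (F.M n)

/-- The family of maps underlying `X_0`. -/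
def xZero : F.res.Maps F.res := fun n => xRes n (F.M (n + 1))

/-- The family of maps underlying `T_{11}`. -/
def tOneOne : F.ind.ind.Maps F.ind.ind
  | 0 => 0
  | 1 => 0
  | n + 2 => tInd n (F.M n)

/-- The family of maps underlying `T_{00}`. -/
def tZeroZero : F.res.res.Maps F.res.res := fun n => tRes n (F.M (n + 2))

/-- The family of maps underlying `T_{10}`. -/
def tOneZero : F.res.ind.Maps F.ind.res
  | 0 => 0
  | n + 1 => crossRes n (F.M (n + 1))

/-- The family of maps underlying `T_{01}`. -/
def tZeroOne : F.ind.res.Maps F.res.ind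
  | 0 => 0
  | n + 1 => projRes (F.M (n + 1))

theorem xOne_mem : F.xOne ∈ F.ind.mapsDeg F.ind 2
  | 0, _, _, _ => Submodule.zero_mem _
  | _ + 1, _, _, hm => xInd_mem hm

theorem xZero_mem (h : F.IsObj) : F.xZero ∈ F.res.mapsDeg F.res 2 := fun n j m hm => by
  have := h.smul_mem (n + 1) 2 j (xLast K n) m NilHecke.gr_xLast hm
  rwa [add_comm (2 : ℤ) j] at this

theorem tOneOne_mem : F.tOneOne ∈ F.ind.ind.mapsDeg F.ind.ind (-2)
  | 0, _, _, _ => Submodule.zero_mem _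
  | 1, _, _, _ => Submodule.zero_mem _
  | _ + 2, _, _, hm => tInd_mem hm

theorem tZeroZero_mem (h : F.IsObj) : F.tZeroZero ∈ F.res.res.mapsDeg F.res.res (-2) :=
  fun n j m hm => by
    have := h.smul_mem (n + 2) (-2) j (tLast K n) m NilHecke.gr_tLast hm
    rw [add_comm (-2 : ℤ) j] at this
    exact Submodule.neg_mem _ this

theorem tOneZero_mem : F.tOneZero ∈ F.res.ind.mapsDeg F.ind.res 2
  | 0, _, _, _ => Submodule.zero_mem _
  | n + 1, j, _, hm => crossing_mem (cross_comm n) (gr_cross n) j hm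

theorem tZeroOne_mem [CharZero K] (A : HCat K) : A.fam.tZeroOne ∈ A.fam.ind.res.mapsDeg A.fam.res.ind 2
  | 0, _, _, _ => Submodule.zero_mem _
  | n + 1, _, _, hm => proj_mem (A.isGradedModule (n + 1)) hm

end NHFamily

end Data

end TwoRepSl2

end

/-! ### The natural transformations. -/

noncomputable section

namespace TwoRepSl2

section Transformations

variable {K : Type u} [Field K]

theorem HCat.hom_sub {A B : HCat K} (f g : A ⟶ B) (n : ℕ) (m : A.fam.M n) :
    HCat.hom (f - g) n m = HCat.hom f n m - HCat.hom g n m := rfl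

theorem HCat.hom_comp {A B C : HCat K} (f : A ⟶ B) (g : B ⟶ C) (n : ℕ) (m : A.fam.M n) :
    HCat.hom (f ≫ g) n m = HCat.hom g n (HCat.hom f n m) := rfl

theorem subsingleton_ind {n : ℕ} {M : Type u} [AddCommGroup M] [Module K M] [Module (NilHecke K n) M]
    [Subsingleton M] : Subsingleton (Ind K n M) := by
  have h0 : ∀ z : Ind K n M, z = 0 := fun z => by
    induction z using Ind.induction with
    | mk a m => rw [Subsingleton.elim m 0, Ind.mk_zero]
    | add y z hy hz => rw [hy, hz, add_zero]
  exact ⟨fun y z => (h0 y).trans (h0 z).symm⟩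

/-- Induction applied `k` times lives on at least `k` strands. These vanishings settle the low
components, where the formulas say nothing. -/
instance (F : NHFamily K) : Subsingleton (F.ind.M 0) := inferInstanceAs (Subsingleton PUnit)

instance (F : NHFamily K) : Subsingleton (F.ind.ind.M 1) :=
  subsingleton_ind (n := 0) (M := F.ind.M 0)

instance (F : NHFamily K) : Subsingleton (F.ind.ind.ind.M 2) :=
  subsingleton_ind (n := 1) (M := F.ind.ind.M 1)

variable (h₀ : ∀ A : HCat K, A.fam.res.IsObj) (h₁ : ∀ A : HCat K, A.fam.ind.IsObj)

/-- The transformation `X_1`. -/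
def natXOne : indFunctor h₁ ⟶ indFunctor h₁ where
  app A := HCat.ofDeg A.fam.xOne A.fam.xOne_mem
  naturality _ B f := HCat.hom_ext fun n m => match n, m with
    | 0, _ => Subsingleton.elim (α := B.fam.ind.M 0) _ _
    | n + 1, m => xInd_map (HCat.hom f n) m

/-- The transformation `X_0`. -/
def natXZero : resFunctor h₀ ⟶ resFunctor h₀ where
  app A := HCat.ofDeg A.fam.xZero (A.fam.xZero_mem A.isObj)
  naturality _ _ f := HCat.hom_ext fun n m => ((HCat.hom f (n + 1)).map_smul (xLast K n) m).symm

/-- The transformation `T_{11}`. -/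
def natTOneOne : indFunctor h₁ ⋙ indFunctor h₁ ⟶ indFunctor h₁ ⋙ indFunctor h₁ where
  app A := HCat.ofDeg A.fam.tOneOne A.fam.tOneOne_mem
  naturality _ B f := HCat.hom_ext fun n m => match n, m with
    | 0, _ => Subsingleton.elim (α := B.fam.ind.M 0) _ _
    | 1, _ => Subsingleton.elim (α := B.fam.ind.ind.M 1) _ _
    | n + 2, m => tInd_map (HCat.hom f n) m

/-- The transformation `T_{00}`. -/
def natTZeroZero : resFunctor h₀ ⋙ resFunctor h₀ ⟶ resFunctor h₀ ⋙ resFunctor h₀ where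
  app A := HCat.ofDeg A.fam.tZeroZero (A.fam.tZeroZero_mem A.isObj)
  naturality A _ f := HCat.hom_ext fun n m => by
    have key : ∀ m : A.fam.M (n + 2),
        -(tLast K n • HCat.hom f (n + 2) m) = HCat.hom f (n + 2) (-(tLast K n • m)) := fun m => by
      rw [map_neg, map_smul]
    exact key m

/-- The transformation `T_{10}`. -/
def natTOneZero : resFunctor h₀ ⋙ indFunctor h₁ ⟶ indFunctor h₁ ⋙ resFunctor h₀ where
  app A := HCat.ofDeg A.fam.tOneZero A.fam.tOneZero_mem
  naturality A _ f := HCat.hom_ext fun n m => match n, m with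
    | 0, m => by
      rw [Subsingleton.elim (α := A.fam.res.ind.M 0) m 0]
      exact (LinearMap.map_zero _).trans (LinearMap.map_zero _).symm
    | n + 1, m => crossInd_map (HCat.hom f (n + 1)) m

/-- The transformation `T_{01}`. -/
def natTZeroOne [CharZero K] : indFunctor h₁ ⋙ resFunctor h₀ ⟶ resFunctor h₀ ⋙ indFunctor h₁ where
  app A := HCat.ofDeg A.fam.tZeroOne (NHFamily.tZeroOne_mem A)
  naturality _ B f := HCat.hom_ext fun n m => match n, m with
    | 0, _ => Subsingleton.elim (α := B.fam.ind.M 0) _ _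
    | n + 1, m => proj_map (HCat.hom f (n + 1)) m

variable (K) in
/-- The transformations `X_i` and `T_{ij}`. -/
def sl2Data [CharZero K] : TwoRepData (sl2Functors (K := K) HCat.isObj_res HCat.isObj_ind) where
  X
    | 0 => natXZero _
    | 1 => natXOne _
  T
    | 0, 0 => natTZeroZero _
    | 0, 1 => natTZeroOne _ _
    | 1, 0 => natTOneZero _ _
    | 1, 1 => natTOneOne _

theorem isSl2Data_sl2Data [CharZero K] : IsSl2Data (sl2Data K) where
  x_one _ _ _ _ := rfl
  x_zero _ _ _ := rfl
  t_one_one A n a b m := tInd_mk a b m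
  t_zero_zero _ _ _ := rfl
  t_one_zero A n a m := by
    rw [mul_assoc]
    rfl
  t_zero_one A n a b p m := proj_kangKashiwara a b p m

end Transformations

end TwoRepSl2

end

/-! ### The polynomials of the quiver, and the dot and quadratic relations on the category. -/

noncomputable section

namespace TwoRepSl2

section Quiver

variable {R : Type*} [Ring R]

theorem affineSl2_poly_self (i : Fin 2) (a b : R) : affineSl2.poly i i a b = 0 := if_pos rfl

theorem affineSl2_poly_zero_one (a b : R) : affineSl2.poly 0 1 a b = (b - a) * (b - a) := by
  simp [LoopFreeQuiver.poly, affineSl2, pow_two]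

theorem affineSl2_poly_one_zero (a b : R) : affineSl2.poly 1 0 a b = (a - b) * (a - b) := by
  simp [LoopFreeQuiver.poly, affineSl2, pow_two]

theorem affineSl2_divDiff_self (i : Fin 2) (a b c : R) : affineSl2.divDiff i i a b c = 0 := if_pos rfl

/-- The quotient of `(a - b)² - (c - b)²` by `a - c`; the sign `(-1) ^ 2` disappears because the
number of edges is even. -/
theorem affineSl2_divDiff_zero_one (a b c : R) :
    affineSl2.divDiff 0 1 a b c = (c - b) + (a - b) := by
  simp [LoopFreeQuiver.divDiff, affineSl2, Finset.sum_range_succ]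

theorem affineSl2_divDiff_one_zero (a b c : R) :
    affineSl2.divDiff 1 0 a b c = (c - b) + (a - b) := by
  simp [LoopFreeQuiver.divDiff, affineSl2, Finset.sum_range_succ]

theorem affineSl2_cartan_self (i : Fin 2) : affineSl2.cartan i i = 2 := if_pos rfl

theorem affineSl2_cartan_ne {i j : Fin 2} (h : i ≠ j) : affineSl2.cartan i j = -2 := by
  fin_cases i <;> fin_cases j <;> simp [LoopFreeQuiver.cartan, affineSl2] at h ⊢

end Quiver

section TwoRepresentation

theorem HCat.hom_eq_of_subsingleton {K : Type u} [Field K] {A B : HCat K} {n : ℕ}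
    (h : Subsingleton (A.fam.M n)) (f g : A ⟶ B) (m : A.fam.M n) :
    HCat.hom f n m = HCat.hom g n m := by
  rw [Subsingleton.elim m 0, map_zero, map_zero]

/-- Powers of the only variable commute with it. Hence the square of the dot difference vanishes on
zero strands, as it must since `T_{01} = 0` there. -/
theorem ind_zero_dots {K : Type u} [Field K] {M : Type u} [AddCommGroup M] [Module K M] [Module (NilHecke K 0) M]
    [IsScalarTower K (NilHecke K 0) M] (z : Ind K 0 M) : xInd 0 M z - xLast K 0 • z = 0 := by
  induction z using ind_zero_induction with
  | add y z hy hz => rw [map_add, smul_add, add_sub_add_comm, hy, hz, add_zero]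
  | pow k m => rw [xInd_mk, Ind.smul_mk, ← pow_succ, ← pow_succ', sub_self]

variable (K : Type u) [Field K] [CharZero K]

/-- The functors `E_0` and `E_1`. -/
abbrev sl2Fun : Fin 2 → (HCat K ⥤ HCat K) := sl2Functors HCat.isObj_res HCat.isObj_ind

theorem t_zero_zero_x (M : HCat K) :
    (sl2Data K).x 0 ((sl2Fun K 0).obj M) ≫ (sl2Data K).t 0 0 M -
      (sl2Data K).t 0 0 M ≫ (sl2Fun K 0).map ((sl2Data K).x 0 M) = 𝟙 _ := by
  refine HCat.hom_ext fun n m => ?_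
  have key : ∀ m : M.fam.M (n + 2),
      -(tLast K n • xPrev K n • m) - xLast K (n + 1) • (-(tLast K n • m)) = m := fun m => by
    rw [smul_neg, sub_neg_eq_add, smul_smul, smul_smul, (twoStrand n).sy, sub_smul, one_smul]
    abel
  rw [← incl_xLast] at key
  exact key m

theorem t_zero_zero_x' (M : HCat K) :
    (sl2Fun K 0).map ((sl2Data K).x 0 M) ≫ (sl2Data K).t 0 0 M -
      (sl2Data K).t 0 0 M ≫ (sl2Data K).x 0 ((sl2Fun K 0).obj M) =
        -𝟙 _ := by
  refine HCat.hom_ext fun n m => ?_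
  have key : ∀ m : M.fam.M (n + 2),
      -(tLast K n • xLast K (n + 1) • m) - xPrev K n • (-(tLast K n • m)) = -m := fun m => by
    rw [smul_neg, sub_neg_eq_add, smul_smul, smul_smul, (twoStrand n).sz, add_smul, one_smul]
    abel
  rw [← incl_xLast] at key
  exact key m

theorem t_one_one_x (M : HCat K) :
    (sl2Data K).x 1 ((sl2Fun K 1).obj M) ≫ (sl2Data K).t 1 1 M -
      (sl2Data K).t 1 1 M ≫ (sl2Fun K 1).map ((sl2Data K).x 1 M) = 𝟙 _ :=
  HCat.hom_ext fun n m => match n, m with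
    | 0, _ => Subsingleton.elim (α := M.fam.ind.ind.M 0) _ _
    | 1, _ => Subsingleton.elim (α := M.fam.ind.ind.M 1) _ _
    | n + 2, m => tInd_xInd (n := n) (M := M.fam.M n) m

theorem t_one_one_x' (M : HCat K) :
    (sl2Fun K 1).map ((sl2Data K).x 1 M) ≫ (sl2Data K).t 1 1 M -
      (sl2Data K).t 1 1 M ≫ (sl2Data K).x 1 ((sl2Fun K 1).obj M) = -𝟙 _ :=
  HCat.hom_ext fun n m => match n, m with
    | 0, _ => Subsingleton.elim (α := M.fam.ind.ind.M 0) _ _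
    | 1, _ => Subsingleton.elim (α := M.fam.ind.ind.M 1) _ _
    | n + 2, m => tInd_map_xInd (n := n) (M := M.fam.M n) m

theorem t_zero_one_x (M : HCat K) :
    (sl2Data K).x 0 ((sl2Fun K 1).obj M) ≫ (sl2Data K).t 0 1 M =
      (sl2Data K).t 0 1 M ≫ (sl2Fun K 1).map ((sl2Data K).x 0 M) :=
  HCat.hom_ext fun n m => match n, m with
    | 0, _ => Subsingleton.elim (α := M.fam.res.ind.M 0) _ _
    | n + 1, m => proj_xLast_smul (M := M.fam.M (n + 1)) m

theorem t_zero_one_x' (M : HCat K) :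
    (sl2Fun K 0).map ((sl2Data K).x 1 M) ≫ (sl2Data K).t 0 1 M =
      (sl2Data K).t 0 1 M ≫ (sl2Data K).x 1 ((sl2Fun K 0).obj M) :=
  HCat.hom_ext fun n m => match n, m with
    | 0, _ => Subsingleton.elim (α := M.fam.res.ind.M 0) _ _
    | n + 1, m => proj_xInd (M := M.fam.M (n + 1)) m

theorem t_one_zero_x (M : HCat K) :
    (sl2Data K).x 1 ((sl2Fun K 0).obj M) ≫ (sl2Data K).t 1 0 M =
      (sl2Data K).t 1 0 M ≫ (sl2Fun K 0).map ((sl2Data K).x 1 M) :=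
  HCat.hom_ext fun n m => match n, m with
    | 0, m => HCat.hom_eq_of_subsingleton (inferInstanceAs (Subsingleton (M.fam.res.ind.M 0))) _ _ m
    | n + 1, m => crossInd_xInd (M := M.fam.M (n + 1)) m

theorem t_one_zero_x' (M : HCat K) :
    (sl2Fun K 1).map ((sl2Data K).x 0 M) ≫ (sl2Data K).t 1 0 M =
      (sl2Data K).t 1 0 M ≫ (sl2Data K).x 0 ((sl2Fun K 1).obj M) :=
  HCat.hom_ext fun n m => match n, m with
    | 0, m => HCat.hom_eq_of_subsingleton (inferInstanceAs (Subsingleton (M.fam.res.ind.M 0))) _ _ m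
    | n + 1, m => crossInd_map_xRes (M := M.fam.M (n + 1)) m

theorem t_zero_zero_t (M : HCat K) : (sl2Data K).t 0 0 M ≫ (sl2Data K).t 0 0 M = 0 := by
  refine HCat.hom_ext fun n m => ?_
  have key : ∀ m : M.fam.M (n + 2), -(tLast K n • -(tLast K n • m)) = 0 := fun m => by
    rw [smul_neg, neg_neg, smul_smul, tLast_mul_self, zero_smul]
  exact key m

theorem t_one_one_t (M : HCat K) : (sl2Data K).t 1 1 M ≫ (sl2Data K).t 1 1 M = 0 :=
  HCat.hom_ext fun n m => match n, m with
    | 0, _ => Subsingleton.elim (α := M.fam.ind.ind.M 0) _ _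
    | 1, _ => Subsingleton.elim (α := M.fam.ind.ind.M 1) _ _
    | n + 2, m => tInd_tInd (n := n) (M := M.fam.M n) m

theorem t_one_zero_t (M : HCat K) :
    (sl2Data K).t 1 0 M ≫ (sl2Data K).t 0 1 M =
      ((sl2Data K).x 1 ((sl2Fun K 0).obj M) - (sl2Fun K 1).map ((sl2Data K).x 0 M)) ≫
        ((sl2Data K).x 1 ((sl2Fun K 0).obj M) - (sl2Fun K 1).map ((sl2Data K).x 0 M)) :=
  HCat.hom_ext fun n m => match n, m with
    | 0, _ => Subsingleton.elim (α := M.fam.res.ind.M 0) _ _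
    | n + 1, m => proj_crossInd (M := M.fam.M (n + 1)) m

theorem t_zero_one_t (M : HCat K) :
    (sl2Data K).t 0 1 M ≫ (sl2Data K).t 1 0 M =
      ((sl2Fun K 0).map ((sl2Data K).x 1 M) - (sl2Data K).x 0 ((sl2Fun K 1).obj M)) ≫
        ((sl2Fun K 0).map ((sl2Data K).x 1 M) - (sl2Data K).x 0 ((sl2Fun K 1).obj M)) :=
  HCat.hom_ext fun n m => match n, m with
    | 0, m => by
      have e : HCat.hom ((sl2Fun K 0).map ((sl2Data K).x 1 M) - (sl2Data K).x 0 ((sl2Fun K 1).obj M)) 0 m = 0 :=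
        ind_zero_dots (M := M.fam.M 0) m
      rw [HCat.hom_comp, HCat.hom_comp, e, map_zero]
      exact map_zero (HCat.hom ((sl2Data K).t 1 0 M) 0)
    | n + 1, m => crossInd_proj (M := M.fam.M (n + 1)) m

end TwoRepresentation

end TwoRepSl2

end

/-! ### The braid relations on the category. -/

noncomputable section

namespace TwoRepSl2

section TwoRepresentationBraid

/-- The lowest case of `cross_tRes_proj`: there are only powers of the last variable, and the
composite through `T_{01}` is absent. -/
theorem proj_tau_cross_zero {K : Type u} [Field K] {M : Type u} [AddCommGroup M] [Module K M] [Module (NilHecke K 1) M]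
    [IsScalarTower K (NilHecke K 1) M] (z : Ind K 0 (Res K 0 M)) :
    proj M (tLast K 0 • crossInd 0 M z) =
      (Ind.map (xRes 0 M) z - xInd 0 (Res K 0 M) z) + (xLast K 0 • z - xInd 0 (Res K 0 M) z) := by
  induction z using ind_zero_induction with
  | add y z hy hz =>
    simp only [map_add, smul_add]
    rw [hy, hz]
    abel
  | pow k m => exact proj_tau_cross_pow (n := 0) (M := M) k m

theorem proj_tInd_cross_zero {K : Type u} [Field K] {M : Type u} [AddCommGroup M] [Module K M] [Module (NilHecke K 0) M]
    [IsScalarTower K (NilHecke K 0) M] (z : Ind K 0 (Res K 0 (Ind K 0 M))) :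
    proj (Ind K 0 M) (tInd 0 M (crossInd 0 (Ind K 0 M) z)) =
      (Ind.map (Res.map 0 (xInd 0 M)) z - Ind.map (xRes 0 (Ind K 0 M)) z) +
        (xInd 0 (Res K 0 (Ind K 0 M)) z - Ind.map (xRes 0 (Ind K 0 M)) z) := by
  let f := (projRes (Ind K 0 M)).comp ((Res.map 1 (tInd 0 M)).comp (crossRes 0 (Ind K 0 M)))
  let g := (Ind.map (Res.map 0 (xInd 0 M)) - Ind.map (xRes 0 (Ind K 0 M))) +
      (xInd 0 (Res K 0 (Ind K 0 M)) - Ind.map (xRes 0 (Ind K 0 M)))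
  suffices h : f = g from LinearMap.congr_fun h z
  have hpow : ∀ k m, f (Ind.mk 1 (Res.mk 0 (Ind K 0 M) (Ind.mk (xLast K 0 ^ k) m))) =
      g (Ind.mk 1 (Res.mk 0 (Ind K 0 M) (Ind.mk (xLast K 0 ^ k) m))) := proj_tInd_cross_pow
  clear_value f g
  refine Ind.hom_ext fun v => ?_
  obtain ⟨v, rfl⟩ : ∃ v', Res.mk (K := K) 0 (Ind K 0 M) v' = v := ⟨v, rfl⟩
  induction v using ind_zero_induction with
  | add v w hv hw => rw [map_add, Ind.mk_add, map_add, map_add, hv, hw]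
  | pow k m => exact hpow k m

variable (K : Type u) [Field K] [CharZero K]


theorem braid_zero_zero_zero (M : HCat K) :
    (sl2Data K).t 0 0 ((sl2Fun K 0).obj M) ≫ (sl2Fun K 0).map ((sl2Data K).t 0 0 M) ≫ (sl2Data K).t 0 0 ((sl2Fun K 0).obj M) =
      (sl2Fun K 0).map ((sl2Data K).t 0 0 M) ≫ (sl2Data K).t 0 0 ((sl2Fun K 0).obj M) ≫ (sl2Fun K 0).map ((sl2Data K).t 0 0 M) := by
  refine HCat.hom_ext fun n m => ?_
  have key : ∀ m : M.fam.M (n + 3),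
      -(incl K (n + 2) (tLast K n) • -(tLast K (n + 1) • -(incl K (n + 2) (tLast K n) • m))) =
        -(tLast K (n + 1) • -(incl K (n + 2) (tLast K n) • -(tLast K (n + 1) • m))) := fun m => by
    simp only [smul_neg, neg_neg, smul_smul]
    rw [← mul_assoc, ← mul_assoc, (threeStrand n).rsr]
  exact key m

theorem braid_one_one_one (M : HCat K) :
    (sl2Data K).t 1 1 ((sl2Fun K 1).obj M) ≫ (sl2Fun K 1).map ((sl2Data K).t 1 1 M) ≫ (sl2Data K).t 1 1 ((sl2Fun K 1).obj M) =
      (sl2Fun K 1).map ((sl2Data K).t 1 1 M) ≫ (sl2Data K).t 1 1 ((sl2Fun K 1).obj M) ≫ (sl2Fun K 1).map ((sl2Data K).t 1 1 M) :=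
  HCat.hom_ext fun n m => match n, m with
    | 0, _ => Subsingleton.elim (α := M.fam.ind.ind.ind.M 0) _ _
    | 1, _ => Subsingleton.elim (α := M.fam.ind.ind.ind.M 1) _ _
    | 2, _ => Subsingleton.elim (α := M.fam.ind.ind.ind.M 2) _ _
    | n + 3, m => tInd_braid (n := n) (M := M.fam.M n) m

theorem braid_zero_zero_one (M : HCat K) :
    (sl2Data K).t 0 0 ((sl2Fun K 1).obj M) ≫ (sl2Fun K 0).map ((sl2Data K).t 0 1 M) ≫ (sl2Data K).t 0 1 ((sl2Fun K 0).obj M) =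
      (sl2Fun K 0).map ((sl2Data K).t 0 1 M) ≫ (sl2Data K).t 0 1 ((sl2Fun K 0).obj M) ≫ (sl2Fun K 1).map ((sl2Data K).t 0 0 M) :=
  HCat.hom_ext fun n m => match n, m with
    | 0, _ => Subsingleton.elim (α := M.fam.res.res.ind.M 0) _ _
    | n + 1, m => proj_proj_tRes (n := n) (M := M.fam.M (n + 2)) m

theorem braid_zero_one_one (M : HCat K) :
    (sl2Data K).t 0 1 ((sl2Fun K 1).obj M) ≫ (sl2Fun K 1).map ((sl2Data K).t 0 1 M) ≫ (sl2Data K).t 1 1 ((sl2Fun K 0).obj M) =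
      (sl2Fun K 0).map ((sl2Data K).t 1 1 M) ≫ (sl2Data K).t 0 1 ((sl2Fun K 1).obj M) ≫ (sl2Fun K 1).map ((sl2Data K).t 0 1 M) :=
  HCat.hom_ext fun n m => match n, m with
    | 0, _ => Subsingleton.elim (α := M.fam.res.ind.ind.M 0) _ _
    | 1, _ => Subsingleton.elim (α := M.fam.res.ind.ind.M 1) _ _
    | n + 2, m => tInd_projProj (n := n) (M := M.fam.M (n + 1)) m

theorem braid_one_zero_zero (M : HCat K) :
    (sl2Data K).t 1 0 ((sl2Fun K 0).obj M) ≫ (sl2Fun K 0).map ((sl2Data K).t 1 0 M) ≫ (sl2Data K).t 0 0 ((sl2Fun K 1).obj M) =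
      (sl2Fun K 1).map ((sl2Data K).t 0 0 M) ≫ (sl2Data K).t 1 0 ((sl2Fun K 0).obj M) ≫ (sl2Fun K 0).map ((sl2Data K).t 1 0 M) :=
  HCat.hom_ext fun n m => match n, m with
    | 0, m => HCat.hom_eq_of_subsingleton (inferInstanceAs (Subsingleton (M.fam.res.res.ind.M 0))) _ _ m
    | n + 1, m => cross_cross_tRes (n := n) (M := M.fam.M (n + 2)) m

theorem braid_one_one_zero (M : HCat K) :
    (sl2Data K).t 1 1 ((sl2Fun K 0).obj M) ≫ (sl2Fun K 1).map ((sl2Data K).t 1 0 M) ≫ (sl2Data K).t 1 0 ((sl2Fun K 1).obj M) =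
      (sl2Fun K 1).map ((sl2Data K).t 1 0 M) ≫ (sl2Data K).t 1 0 ((sl2Fun K 1).obj M) ≫ (sl2Fun K 0).map ((sl2Data K).t 1 1 M) :=
  HCat.hom_ext fun n m => match n, m with
    | 0, m => HCat.hom_eq_of_subsingleton (inferInstanceAs (Subsingleton (M.fam.res.ind.ind.M 0))) _ _ m
    | 1, m => HCat.hom_eq_of_subsingleton (inferInstanceAs (Subsingleton (M.fam.res.ind.ind.M 1))) _ _ m
    | n + 2, m => tInd_map_cross (n := n) (M := M.fam.M (n + 1)) m

theorem braid_zero_one_zero (M : HCat K) :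
    (sl2Data K).t 0 1 ((sl2Fun K 0).obj M) ≫ (sl2Fun K 1).map ((sl2Data K).t 0 0 M) ≫ (sl2Data K).t 1 0 ((sl2Fun K 0).obj M) -
      (sl2Fun K 0).map ((sl2Data K).t 1 0 M) ≫ (sl2Data K).t 0 0 ((sl2Fun K 1).obj M) ≫ (sl2Fun K 0).map ((sl2Data K).t 0 1 M) =
      ((sl2Fun K 0).map ((sl2Fun K 1).map ((sl2Data K).x 0 M)) - (sl2Fun K 0).map ((sl2Data K).x 1 ((sl2Fun K 0).obj M))) +
        ((sl2Data K).x 0 ((sl2Fun K 1).obj ((sl2Fun K 0).obj M)) - (sl2Fun K 0).map ((sl2Data K).x 1 ((sl2Fun K 0).obj M))) :=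
  HCat.hom_ext fun n m => match n, m with
    | 0, m => by
      refine Eq.trans ?_ (proj_tau_cross_zero (M := M.fam.M 1) m)
      rw [HCat.hom_sub]
      -- The first composite passes through an induced module on zero strands, so it is zero and
      -- only the second one, with its sign, is left.
      refine (congrArg (· - _) (map_zero (HCat.hom ((sl2Data K).t 1 0 ((sl2Fun K 0).obj M)) 0))).trans ?_
      refine (zero_sub _).trans (neg_eq_iff_eq_neg.2 ?_)
      exact map_neg (proj (M.fam.M 1)) _
    | n + 1, m => by
      refine Eq.trans ?_ (cross_tRes_proj (n := n) (M := M.fam.M (n + 2)) m)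
      rw [← sub_neg_eq_add, ← map_neg (proj (M.fam.M (n + 2)))]
      rfl

theorem braid_one_zero_one (M : HCat K) :
    (sl2Data K).t 1 0 ((sl2Fun K 1).obj M) ≫ (sl2Fun K 0).map ((sl2Data K).t 1 1 M) ≫ (sl2Data K).t 0 1 ((sl2Fun K 1).obj M) -
      (sl2Fun K 1).map ((sl2Data K).t 0 1 M) ≫ (sl2Data K).t 1 1 ((sl2Fun K 0).obj M) ≫ (sl2Fun K 1).map ((sl2Data K).t 1 0 M) =
      ((sl2Fun K 1).map ((sl2Fun K 0).map ((sl2Data K).x 1 M)) - (sl2Fun K 1).map ((sl2Data K).x 0 ((sl2Fun K 1).obj M))) +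
        ((sl2Data K).x 1 ((sl2Fun K 0).obj ((sl2Fun K 1).obj M)) - (sl2Fun K 1).map ((sl2Data K).x 0 ((sl2Fun K 1).obj M))) :=
  HCat.hom_ext fun n m => match n, m with
    | 0, _ => Subsingleton.elim (α := M.fam.ind.res.ind.M 0) _ _
    | 1, m => by
      refine Eq.trans ?_ (proj_tInd_cross_zero (M := M.fam.M 0) m)
      -- The second composite passes through a module induced twice on one strand, which is zero.
      refine sub_eq_self.2 ?_
      have := Subsingleton.elim (α := M.fam.res.ind.ind.M 1)
        (HCat.hom ((sl2Fun K 1).map ((sl2Data K).t 0 1 M) ≫ (sl2Data K).t 1 1 ((sl2Fun K 0).obj M)) 1 m) 0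
      exact (congrArg (HCat.hom ((sl2Fun K 1).map ((sl2Data K).t 1 0 M)) 1) this).trans (map_zero _)
    | n + 2, m => by
      have := proj_tInd_cross (n := n) (M := M.fam.M (n + 1)) m
      exact sub_eq_iff_eq_add'.2 this

end TwoRepresentationBraid

end TwoRepSl2

end

/-! ### Assembly of the 2-representation and uniqueness. -/

noncomputable section

namespace TwoRepSl2

section Main

variable (K : Type u) [Field K] [CharZero K]

/-- The 2-representation of `𝒰_q⁺` of affine `sl₂` on `𝓗`. -/
def sl2Rep : TwoRep K affineSl2 (sl2Fun K) where
  toTwoRepData := sl2Data K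
  map_add
    | 0, _, _ => rfl
    | 1, f, g => Subtype.ext ((NHFamily.indMapₗ _ _).map_add f.1 g.1)
  map_smul
    | 0, _, _ => rfl
    | 1, r, f => Subtype.ext ((NHFamily.indMapₗ _ _).map_smul r f.1)
  map_deg
    | 0, _, _, hf => NHFamily.resMap_deg hf
    | 1, _, _, hf => NHFamily.indMap_deg hf
  x_deg
    | 0, M => M.fam.xZero_mem M.isObj
    | 1, M => M.fam.xOne_mem
  t_deg
    | 0, 0, M => by rw [affineSl2_cartan_self]; exact M.fam.tZeroZero_mem M.isObj
    | 0, 1, M => by rw [affineSl2_cartan_ne (by decide)]; exact NHFamily.tZeroOne_mem M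
    | 1, 0, M => by rw [affineSl2_cartan_ne (by decide)]; exact M.fam.tOneZero_mem
    | 1, 1, M => by rw [affineSl2_cartan_self]; exact M.fam.tOneOne_mem
  t_x_ne
    | 0, 0, h, _ => absurd rfl h
    | 0, 1, _, M => sub_eq_zero.2 (t_zero_one_x K M)
    | 1, 0, _, M => sub_eq_zero.2 (t_one_zero_x K M)
    | 1, 1, h, _ => absurd rfl h
  t_x_eq
    | 0, M => t_zero_zero_x K M
    | 1, M => t_one_one_x K M
  t_x'_ne
    | 0, 0, h, _ => absurd rfl h
    | 0, 1, _, M => sub_eq_zero.2 (t_zero_one_x' K M)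
    | 1, 0, _, M => sub_eq_zero.2 (t_one_zero_x' K M)
    | 1, 1, h, _ => absurd rfl h
  t_x'_eq
    | 0, M => t_zero_zero_x' K M
    | 1, M => t_one_one_x' K M
  t_t
    | 0, 0, M => by rw [affineSl2_poly_self]; exact t_zero_zero_t K M
    | 0, 1, M => by rw [affineSl2_poly_zero_one]; exact t_one_zero_t K M
    | 1, 0, M => by rw [affineSl2_poly_one_zero]; exact t_zero_one_t K M
    | 1, 1, M => by rw [affineSl2_poly_self]; exact t_one_one_t K M
  braid_ne
    | 0, 0, 0, h, _ => absurd rfl h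
    | 0, 0, 1, _, M => sub_eq_zero.2 (braid_zero_zero_one K M)
    | 0, 1, 0, h, _ => absurd rfl h
    | 0, 1, 1, _, M => sub_eq_zero.2 (braid_zero_one_one K M)
    | 1, 0, 0, _, M => sub_eq_zero.2 (braid_one_zero_zero K M)
    | 1, 0, 1, h, _ => absurd rfl h
    | 1, 1, 0, _, M => sub_eq_zero.2 (braid_one_one_zero K M)
    | 1, 1, 1, h, _ => absurd rfl h
  braid_eq
    | 0, 0, M => by rw [affineSl2_divDiff_self]; exact sub_eq_zero.2 (braid_zero_zero_zero K M)
    | 0, 1, M => by rw [affineSl2_divDiff_zero_one]; exact braid_zero_one_zero K M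
    | 1, 0, M => by rw [affineSl2_divDiff_one_zero]; exact braid_one_zero_one K M
    | 1, 1, M => by rw [affineSl2_divDiff_self]; exact sub_eq_zero.2 (braid_one_one_one K M)

end Main

/-- The formulas determine the transformations. -/
theorem IsSl2Data.unique {K : Type u} [Field K] {h₀ : ∀ A : HCat K, A.fam.res.IsObj} {h₁ : ∀ A : HCat K, A.fam.ind.IsObj}
    {ρ ρ' : TwoRepData (sl2Functors h₀ h₁)} (h : IsSl2Data ρ) (h' : IsSl2Data ρ') : ρ = ρ' := by
  have x0 : ρ.X 0 = ρ'.X 0 := NatTrans.ext (funext fun A => HCat.hom_ext fun n m =>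
    (h.x_zero A n m).trans (h'.x_zero A n m).symm)
  have x1 : ρ.X 1 = ρ'.X 1 := NatTrans.ext (funext fun A => HCat.hom_ext fun n m => match n, m with
    | 0, _ => Subsingleton.elim (α := A.fam.ind.M 0) _ _
    | n + 1, m => by
      have e : HCat.hom (ρ.x 1 A) (n + 1) = HCat.hom (ρ'.x 1 A) (n + 1) :=
        Ind.map_ext (M := A.fam.M n) (N := A.fam.M n)
          fun a m => (h.x_one A n a m).trans (h'.x_one A n a m).symm
      exact LinearMap.congr_fun e m)
  have t00 : ρ.T 0 0 = ρ'.T 0 0 := NatTrans.ext (funext fun A => HCat.hom_ext fun n m =>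
    (h.t_zero_zero A n m).trans (h'.t_zero_zero A n m).symm)
  have t11 : ρ.T 1 1 = ρ'.T 1 1 := NatTrans.ext (funext fun A => HCat.hom_ext fun n m => match n, m with
    | 0, _ => Subsingleton.elim (α := A.fam.ind.ind.M 0) _ _
    | 1, _ => Subsingleton.elim (α := A.fam.ind.ind.M 1) _ _
    | n + 2, m => by
      have e : HCat.hom (ρ.t 1 1 A) (n + 2) = HCat.hom (ρ'.t 1 1 A) (n + 2) :=
        ind_ind_hom_ext (n := n) (M := A.fam.M n)
          fun m => (h.t_one_one A n 1 1 m).trans (h'.t_one_one A n 1 1 m).symm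
      exact LinearMap.congr_fun e m)
  have t10 : ρ.T 1 0 = ρ'.T 1 0 := NatTrans.ext (funext fun A => HCat.hom_ext fun n m => match n, m with
    | 0, m => HCat.hom_eq_of_subsingleton (inferInstanceAs (Subsingleton (A.fam.res.ind.M 0))) _ _ m
    | n + 1, m => by
      have e : HCat.hom (ρ.t 1 0 A) (n + 1) = HCat.hom (ρ'.t 1 0 A) (n + 1) :=
        Ind.hom_ext (n := n) (M := A.fam.res.M n)
          fun m => (h.t_one_zero A n 1 m).trans (h'.t_one_zero A n 1 m).symm
      exact LinearMap.congr_fun e m)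
  have t01 : ρ.T 0 1 = ρ'.T 0 1 := NatTrans.ext (funext fun A => HCat.hom_ext fun n m => match n, m with
    | 0, _ => Subsingleton.elim (α := A.fam.res.ind.M 0) _ _
    | n + 1, m => by
      have e : ∀ z : Ind K (n + 1) (A.fam.M (n + 1)),
          HCat.hom (ρ.t 0 1 A) (n + 1) (Res.mk (K := K) (n + 1) _ z) =
            HCat.hom (ρ'.t 0 1 A) (n + 1) (Res.mk (K := K) (n + 1) _ z) := fun z => by
        -- The formula for `T_{01}` with `b = 1` already suffices: `p = 0` gives the terms with `τ`,
        -- and `a = 0` with a monomial `p` gives the powers.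
        have key := fun a p m => (h.t_zero_one A n a 1 p m).trans (h'.t_zero_one A n a 1 p m).symm
        induction z using ind_succ_induction with
        | add y z hy hz =>
          exact (map_add (HCat.hom (ρ.t 0 1 A) (n + 1)) _ _).trans
            ((congrArg₂ (· + ·) hy hz).trans (map_add (HCat.hom (ρ'.t 0 1 A) (n + 1)) _ _).symm)
        | tau a m =>
          have := key a 0 m
          rwa [kangKashiwara_mk, map_zero, add_zero, map_one, mul_one] at this
        | pow k m =>
          have := key 0 (Polynomial.monomial k 1) m
          rwa [kangKashiwara_mk, map_zero, zero_mul, zero_mul, zero_add, evalLast_monomial, map_one,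
            one_mul] at this
      exact e m)
  refine TwoRepData.ext (funext fun i => ?_) (funext fun i => funext fun j => ?_)
  · exact match i with
      | 0 => x0
      | 1 => x1
  · exact match i, j with
      | 0, 0 => t00
      | 0, 1 => t01
      | 1, 0 => t10
      | 1, 1 => t11

end TwoRepSl2

end

theorem mainTheorem4 (K : Type u) [Field K] [IsAlgClosed K] [CharZero K] :
    (∀ n : ℕ, Function.Bijective (TwoRepSl2.kangKashiwara K n)) ∧
      ∃ (h₀ : ∀ A : TwoRepSl2.HCat K, A.fam.res.IsObj)
        (h₁ : ∀ A : TwoRepSl2.HCat K, A.fam.ind.IsObj),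
        ∃! ρ : TwoRepSl2.TwoRep K TwoRepSl2.affineSl2 (TwoRepSl2.sl2Functors h₀ h₁),
          TwoRepSl2.IsSl2Data ρ.toTwoRepData :=
  ⟨TwoRepSl2.kangKashiwara_bijective, TwoRepSl2.HCat.isObj_res, TwoRepSl2.HCat.isObj_ind,
    -- Apart from `X` and `T` a 2-representation consists of propositions, so uniqueness of the
    -- transformations is uniqueness of the 2-representation.
    TwoRepSl2.sl2Rep K, TwoRepSl2.isSl2Data_sl2Data, fun _ hρ =>
      TwoRepSl2.TwoRep.ext (congrArg TwoRepSl2.TwoRepData.X (hρ.unique TwoRepSl2.isSl2Data_sl2Data))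
        (congrArg TwoRepSl2.TwoRepData.T (hρ.unique TwoRepSl2.isSl2Data_sl2Data))⟩
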